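/- Let $H_3(\mathbb R)=\mathbb R^3$ with $(x,y,z)(x',y',z')=(x+x',\,y+y',\,z+z'+\tfrac12(xy'-x'y))$. Let $G=\mathbb R\ltimes_\alpha H_3(\mathbb R)$ be the oscillator group, i.e. $\mathbb R\times H_3(\mathbb R)$ with $(t,v)(t',v')=(t+t',\,v\cdot\alpha(t)v')$, where $\alpha(t)(x,y,z)=(x\cos t+y\sin t,\,-x\sin t+y\cos t,\,z)$, and let $\mathbb R\times H_3(\mathbb R)$ denote the direct product. For an integer $k\ge 1$ put $\Gamma_k=\mathbb Z\times\mathbb Z\times\frac1{2k}\mathbb Z\subset H_3(\mathbb R)$, $\Lambda_{k,0}=2\pi\mathbb Z\ltimes\Gamma_k$, $\Lambda_{k,\pi}=\pi\mathbb Z\ltimes\Gamma_k$, $\Lambda_{k,\pi/2}=\frac\pi2\mathbb Z\ltimes\Gamma_k$, and let $M_{k,0}$, $M_{k,\pi}$, $M_{k,\pi/2}$ be the compact quotient manifolds of $G$ by these lattices, acting by left translations. A form on a quotient of a Lie group by a discrete subgroup acting by left translations is called invariant under the group if its lift to the group is left-invariant. A symplectic form is a smooth closed nondegenerate $2$-form.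 **Theorem 1.2.** Let $k\ge1$. 1. The identity $(t,v)\mapsto(t,v)$ of $\mathbb R\times H_3(\mathbb R)$ induces a diffeomorphism from the Kodaira–Thurston manifold, the quotient of the direct product $\mathbb R\times H_3(\mathbb R)$ by $2\pi\mathbb Z\times\Gamma_k$ acting by left translations, onto $M_{k,0}$. In this way $\mathbb R\times H_3(\mathbb R)$ covers $M_{k,0}$. 2. $M_{k,0}$ carries many symplectic forms that are invariant under $\mathbb R\times H_3(\mathbb R)$: with $\tau=dt$, $\alpha=dx$, $\beta=dy$, $\gamma=dz-\frac12(x\,dy-y\,dx)$, each of the forms $$a\,\tau\wedge\alpha+b\,\tau\wedge\beta+c\,\alpha\wedge\beta+e\,\alpha\wedge\gamma+f\,\beta\wedge\gamma\qquad(a,b,c,e,f\in\mathbb R)$$ on $\mathbb R\times H_3(\mathbb R)$ is the lift of exactly one $2$-form on $M_{k,0}$, and the $\mathbb R\times H_3(\mathbb R)$-invariant symplectic forms on $M_{k,0}$ are exactly those obtained in this way with $af-be\neq0$. 3. No symplectic form on $M_{k,0}$ is invariant under the oscillator group $G$. Moreover, $G$ admits no left-invariant symplectic form. 4. The natural maps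 $M_{k,0}\to M_{k,\pi}$ and $M_{k,0}\to M_{k,\pi/2}$ are smooth coverings (covering maps that are local diffeomorphisms), two-sheeted and four-sheeted respectively. The second Betti numbers satisfy $b_2(M_{k,\pi})=b_2(M_{k,\pi/2})=0$, and neither $M_{k,\pi}$ nor $M_{k,\pi/2}$ admits a symplectic form. -/

import Mathlib

open scoped Manifold ContDiff

/-! ### Differential forms, de Rham cohomology and symplectic forms on a manifold -/

noncomputable section

section Forms

variable (E : Type*) [NormedAddCommGroup E] [NormedSpace ℝ E]

/-- A (not necessarily continuous) differential `n`-form on a manifold `M` modelled on `E`: an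
alternating `n`-linear form on every tangent space. -/
def DForm (n : ℕ) (M : Type*) [TopologicalSpace M] [ChartedSpace E M] : Type _ :=
  ∀ x : M, TangentSpace 𝓘(ℝ, E) x [⋀^Fin n]→L[ℝ] ℝ

instance (n : ℕ) (M : Type*) [TopologicalSpace M] [ChartedSpace E M] :
    AddCommGroup (DForm E n M) :=
  inferInstanceAs (AddCommGroup (∀ x : M, TangentSpace 𝓘(ℝ, E) x [⋀^Fin n]→L[ℝ] ℝ))

instance (n : ℕ) (M : Type*) [TopologicalSpace M] [ChartedSpace E M] :
    Module ℝ (DForm E n M) :=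
  inferInstanceAs (Module ℝ (∀ x : M, TangentSpace 𝓘(ℝ, E) x [⋀^Fin n]→L[ℝ] ℝ))

variable {E} {n : ℕ}
variable {M : Type*} [TopologicalSpace M] [ChartedSpace E M]
variable {N : Type*} [TopologicalSpace N] [ChartedSpace E N]

/-- The pull-back `f^* σ` of a differential form along a differentiable map `f`. -/
def DForm.pullback (f : M → N) (σ : DForm E n N) : DForm E n M :=
  fun x => (σ (f x)).compContinuousLinearMap (mfderiv 𝓘(ℝ, E) 𝓘(ℝ, E) f x)

/-- The expression of `σ` in the preferred chart at `x₀`: its pull-back along the inverse of this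
chart, a form on (the target of the chart in) the vector space `E`. -/
def DForm.inChart (σ : DForm E n M) (x₀ : M) : E → E [⋀^Fin n]→L[ℝ] ℝ :=
  DForm.pullback (M := E) (chartAt E x₀).symm σ

/-- A form is smooth if its expressions in the charts are smooth. -/
def DForm.IsSmooth (σ : DForm E n M) : Prop :=
  ∀ x₀ : M, ContDiffOn ℝ ∞ (σ.inChart x₀) (chartAt E x₀).target

/-- The exterior derivative, computed at each point in the preferred chart at that point. -/
def DForm.d (σ : DForm E n M) : DForm E (n + 1) M :=
  fun x => (extDeriv (σ.inChart x) (chartAt E x x)).compContinuousLinearMap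
    (mfderiv 𝓘(ℝ, E) 𝓘(ℝ, E) (chartAt E x) x)

theorem DForm.inChart_add (σ η : DForm E n M) (x₀ : M) :
    (σ + η).inChart x₀ = σ.inChart x₀ + η.inChart x₀ := rfl

theorem DForm.inChart_smul (r : ℝ) (σ : DForm E n M) (x₀ : M) :
    (r • σ).inChart x₀ = r • σ.inChart x₀ := rfl

theorem DForm.isSmooth_zero : (0 : DForm E n M).IsSmooth := fun _ =>
  contDiffOn_const (c := (0 : E [⋀^Fin n]→L[ℝ] ℝ))

theorem DForm.IsSmooth.add {σ η : DForm E n M} (hσ : σ.IsSmooth) (hη : η.IsSmooth) :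
    (σ + η).IsSmooth := fun x₀ => (hσ x₀).add (hη x₀)

theorem DForm.IsSmooth.smul (r : ℝ) {σ : DForm E n M} (hσ : σ.IsSmooth) :
    (r • σ).IsSmooth := fun x₀ => (hσ x₀).const_smul r

theorem DForm.IsSmooth.differentiableAt_inChart {σ : DForm E n M} (hσ : σ.IsSmooth) (x : M) :
    DifferentiableAt ℝ (σ.inChart x) (chartAt E x x) :=
  ((hσ x).contDiffAt ((chartAt E x).open_target.mem_nhds (mem_chart_target E x))).differentiableAt
    (by simp)

theorem DForm.d_zero : (0 : DForm E n M).d = 0 := by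
  funext x
  have h : (0 : DForm E n M).inChart x = (0 : ℝ) • (0 : DForm E n M).inChart x := by
    rw [← DForm.inChart_smul, zero_smul]
  have h2 : extDeriv ((0 : DForm E n M).inChart x) (chartAt E x x) = 0 := by
    rw [h, extDeriv_smul, zero_smul]
  unfold DForm.d
  rw [h2]
  rfl

theorem DForm.d_add {σ η : DForm E n M} (hσ : σ.IsSmooth) (hη : η.IsSmooth) :
    (σ + η).d = σ.d + η.d := by
  funext x
  unfold DForm.d
  rw [DForm.inChart_add,
    extDeriv_add (hσ.differentiableAt_inChart x) (hη.differentiableAt_inChart x)]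
  rfl

theorem DForm.d_smul (r : ℝ) (σ : DForm E n M) : (r • σ).d = r • σ.d := by
  funext x
  unfold DForm.d
  rw [DForm.inChart_smul, extDeriv_smul]
  rfl

variable (E n M)

/-- The space of closed smooth `n`-forms. -/
def closedForms : Submodule ℝ (DForm E n M) where
  carrier := {σ | σ.IsSmooth ∧ σ.d = 0}
  zero_mem' := ⟨DForm.isSmooth_zero, DForm.d_zero⟩
  add_mem' := fun {a b} ha hb =>
    ⟨ha.1.add hb.1, by rw [DForm.d_add ha.1 hb.1, ha.2, hb.2, add_zero]⟩
  smul_mem' := fun r a ha => ⟨ha.1.smul r, by rw [DForm.d_smul, ha.2, smul_zero]⟩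

/-- The space of exact `n`-forms: differentials of smooth `(n-1)`-forms (only `0` if `n = 0`). -/
def exactForms : (n : ℕ) → Submodule ℝ (DForm E n M)
  | 0 => ⊥
  | n + 1 =>
    { carrier := {σ | ∃ η : DForm E n M, η.IsSmooth ∧ η.d = σ}
      zero_mem' := ⟨0, DForm.isSmooth_zero, DForm.d_zero⟩
      add_mem' := by
        rintro _ _ ⟨a, ha, rfl⟩ ⟨b, hb, rfl⟩
        exact ⟨a + b, ha.add hb, DForm.d_add ha hb⟩
      smul_mem' := by
        rintro r _ ⟨a, ha, rfl⟩
        exact ⟨r • a, ha.smul r, DForm.d_smul r a⟩ }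

/-- The de Rham cohomology space `H^n(M)`. -/
abbrev deRhamCohomology : Type _ :=
  closedForms E n M ⧸ (exactForms E M n).submoduleOf (closedForms E n M)

/-- The `n`-th Betti number `b_n(M) = dim H^n(M)`. -/
def bettiNumber : Cardinal := Module.rank ℝ (deRhamCohomology E n M)

variable {E n M}

/-- A symplectic form: a smooth closed nondegenerate `2`-form. -/
structure DForm.IsSymplectic (σ : DForm E 2 M) : Prop where
  smooth : σ.IsSmooth
  closed : σ.d = 0
  nondegenerate : ∀ (x : M) (v : TangentSpace 𝓘(ℝ, E) x),
    (∀ w : TangentSpace 𝓘(ℝ, E) x, σ x ![v, w] = 0) → v = 0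

/-- A form on a Lie group is left-invariant if it is preserved by all left translations. -/
def DForm.IsLeftInvariant {G : Type*} [TopologicalSpace G] [ChartedSpace E G] [Group G]
    (σ : DForm E n G) : Prop :=
  ∀ g : G, DForm.pullback (fun h : G => g * h) σ = σ

/-- A form on a manifold `M` covered by a Lie group `G` (through `π : G → M`) is invariant under
`G` if its lift to `G` is left-invariant, i.e. if it is induced by a left-invariant form. -/
def DForm.IsInvariantVia {G : Type*} [TopologicalSpace G] [ChartedSpace E G] [Group G]
    (π : G → M) (σ : DForm E n M) : Prop :=
  (DForm.pullback π σ).IsLeftInvariant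

end Forms

/-! ### The Heisenberg group, the oscillator group and the group `ℝ × H₃(ℝ)` -/

/-- `ℝ⁴`, with coordinates `(t, x, y, z)`. -/
abbrev R4 : Type := ℝ × ℝ × ℝ × ℝ

/-- The Heisenberg group `H₃(ℝ)`: the set `ℝ³` with
`(x,y,z)(x',y',z') = (x+x', y+y', z+z'+(xy'-x'y)/2)`. -/
@[ext] structure Heis where
  x : ℝ
  y : ℝ
  z : ℝ

namespace Heis

instance : Mul Heis :=
  ⟨fun v w => ⟨v.x + w.x, v.y + w.y, v.z + w.z + (v.x * w.y - w.x * v.y) / 2⟩⟩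

instance : One Heis := ⟨⟨0, 0, 0⟩⟩

instance : Inv Heis := ⟨fun v => ⟨-v.x, -v.y, -v.z⟩⟩

@[simp] theorem mul_x (v w : Heis) : (v * w).x = v.x + w.x := rfl
@[simp] theorem mul_y (v w : Heis) : (v * w).y = v.y + w.y := rfl
@[simp] theorem mul_z (v w : Heis) :
    (v * w).z = v.z + w.z + (v.x * w.y - w.x * v.y) / 2 := rfl
@[simp] theorem one_x : (1 : Heis).x = 0 := rfl
@[simp] theorem one_y : (1 : Heis).y = 0 := rfl
@[simp] theorem one_z : (1 : Heis).z = 0 := rfl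
@[simp] theorem inv_x (v : Heis) : (v⁻¹).x = -v.x := rfl
@[simp] theorem inv_y (v : Heis) : (v⁻¹).y = -v.y := rfl
@[simp] theorem inv_z (v : Heis) : (v⁻¹).z = -v.z := rfl

instance : Group Heis :=
  Group.ofLeftAxioms
    (fun a b c => by ext <;> simp only [mul_x, mul_y, mul_z] <;> ring)
    (fun a => by ext <;> simp)
    (fun a => by ext <;> simp [mul_comm])

/-- The automorphism `α(t)` of the Heisenberg group, with matrix
`(cos t, sin t, 0; -sin t, cos t, 0; 0, 0, 1)`. -/
def rot (t : ℝ) : Heis →* Heis where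
  toFun v := ⟨Real.cos t * v.x + Real.sin t * v.y, -Real.sin t * v.x + Real.cos t * v.y, v.z⟩
  map_one' := by ext <;> simp
  map_mul' v w := by
    ext
    · simp only [mul_x, mul_y]; ring
    · simp only [mul_x, mul_y]; ring
    · simp only [mul_z]
      linear_combination (-(v.x * w.y - w.x * v.y) / 2) * Real.sin_sq_add_cos_sq t

@[simp] theorem rot_x (t : ℝ) (v : Heis) :
    (rot t v).x = Real.cos t * v.x + Real.sin t * v.y := rfl
@[simp] theorem rot_y (t : ℝ) (v : Heis) :
    (rot t v).y = -Real.sin t * v.x + Real.cos t * v.y := rfl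
@[simp] theorem rot_z (t : ℝ) (v : Heis) : (rot t v).z = v.z := rfl

theorem rot_zero (v : Heis) : rot 0 v = v := by ext <;> simp

theorem rot_add (s t : ℝ) (v : Heis) : rot (s + t) v = rot s (rot t v) := by
  ext
  · simp only [rot_x, rot_y, Real.cos_add, Real.sin_add]; ring
  · simp only [rot_x, rot_y, Real.cos_add, Real.sin_add]; ring
  · rfl

/-- The lattice `Γ_k = ℤ × ℤ × (1/2k)ℤ` of the Heisenberg group. -/
def Gamma (k : ℕ+) : Subgroup Heis where
  carrier := {v | ∃ a b c : ℤ, v = ⟨a, b, c / (2 * (k : ℝ))⟩}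
  one_mem' := ⟨0, 0, 0, by ext <;> simp⟩
  mul_mem' := by
    rintro _ _ ⟨a, b, c, rfl⟩ ⟨a', b', c', rfl⟩
    have hk : ((k : ℕ) : ℝ) ≠ 0 := by exact_mod_cast k.ne_zero
    refine ⟨a + a', b + b', c + c' + k * (a * b' - a' * b), ?_⟩
    ext
    · simp
    · simp
    · simp only [mul_z]; push_cast; field_simp
  inv_mem' := by
    rintro _ ⟨a, b, c, rfl⟩
    exact ⟨-a, -b, -c, by ext <;> simp [neg_div]⟩

/-- A rotation by a multiple of a right angle preserves `Γ_k`. -/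
theorem rot_mem_Gamma {k : ℕ+} (m : ℤ) {v : Heis} (hv : v ∈ Gamma k) :
    rot (m * (Real.pi / 2)) v ∈ Gamma k := by
  have key : ∀ n : ℕ, ∀ ε : ℤ, ε = 1 ∨ ε = -1 → ∀ w ∈ Gamma k,
      rot (ε * n * (Real.pi / 2)) w ∈ Gamma k := by
    intro n ε hε
    induction n with
    | zero => intro w hw; simpa [rot_zero] using hw
    | succ n ih =>
      intro w hw
      have h1 : (ε : ℝ) * ((n + 1 : ℕ) : ℝ) * (Real.pi / 2)
          = ε * n * (Real.pi / 2) + ε * (Real.pi / 2) := by push_cast; ring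
      rw [h1, rot_add]
      apply ih
      obtain ⟨a, b, c, rfl⟩ := hw
      rcases hε with rfl | rfl
      · exact ⟨b, -a, c, by ext <;> simp⟩
      · exact ⟨-b, a, c, by ext <;> simp⟩
  rcases Int.natAbs_eq m with h | h
  · have := key m.natAbs 1 (Or.inl rfl) v hv
    rw [h]; push_cast at this ⊢; simpa using this
  · have := key m.natAbs (-1) (Or.inr rfl) v hv
    rw [h]; push_cast at this ⊢; simpa using this

end Heis

/-- The oscillator group `G = ℝ ⋉_α H₃(ℝ)`, i.e. `ℝ⁴` with `(t,v)(t',v') = (t+t', v · α(t)v')`. -/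
def Osc : Type := R4

namespace Osc

/-- The element `(t, v)`, for `t ∈ ℝ` and `v ∈ H₃(ℝ)`. -/
def mk (t : ℝ) (v : Heis) : Osc := ((t, v.x, v.y, v.z) : R4)

/-- The component in `ℝ`. -/
def t (p : Osc) : ℝ := (show R4 from p).1

/-- The component in `H₃(ℝ)`. -/
def v (p : Osc) : Heis :=
  ⟨(show R4 from p).2.1, (show R4 from p).2.2.1, (show R4 from p).2.2.2⟩

@[simp] theorem mk_t (t : ℝ) (v : Heis) : (mk t v).t = t := rfl
@[simp] theorem mk_v (t : ℝ) (v : Heis) : (mk t v).v = v := rfl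

theorem ext' {p q : Osc} (h₁ : p.t = q.t) (h₂ : p.v = q.v) : p = q :=
  Prod.ext h₁ (Prod.ext (congrArg Heis.x h₂) (Prod.ext (congrArg Heis.y h₂) (congrArg Heis.z h₂)))

instance : Mul Osc := ⟨fun p q => mk (p.t + q.t) (p.v * Heis.rot p.t q.v)⟩

instance : One Osc := ⟨mk 0 1⟩

instance : Inv Osc := ⟨fun p => mk (-p.t) (Heis.rot (-p.t) p.v⁻¹)⟩

@[simp] theorem mul_t (p q : Osc) : (p * q).t = p.t + q.t := rfl
@[simp] theorem mul_v (p q : Osc) : (p * q).v = p.v * Heis.rot p.t q.v := rfl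
@[simp] theorem one_t : (1 : Osc).t = 0 := rfl
@[simp] theorem one_v : (1 : Osc).v = 1 := rfl
@[simp] theorem inv_t (p : Osc) : (p⁻¹).t = -p.t := rfl
@[simp] theorem inv_v (p : Osc) : (p⁻¹).v = Heis.rot (-p.t) p.v⁻¹ := rfl

instance : Group Osc :=
  Group.ofLeftAxioms
    (fun a b c => ext' (by simp [add_assoc]) (by simp [Heis.rot_add, mul_assoc]))
    (fun a => ext' (by simp) (by simp [Heis.rot_zero]))
    (fun a => ext' (by simp) (by simp))

instance : TopologicalSpace Osc := inferInstanceAs (TopologicalSpace R4)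
instance : T2Space Osc := inferInstanceAs (T2Space R4)
instance : LocallyCompactSpace Osc := inferInstanceAs (LocallyCompactSpace R4)
instance : ChartedSpace R4 Osc := chartedSpaceSelf R4
instance : IsManifold 𝓘(ℝ, R4) ∞ Osc := inferInstanceAs (IsManifold 𝓘(ℝ, R4) ∞ R4)

end Osc

/-- The nilpotent group `ℝ × H₃(ℝ)` (direct product): `ℝ⁴` with `(t,v)(t',v') = (t+t', v · v')`. -/
def Nil : Type := R4

namespace Nil

/-- The element `(t, v)`, for `t ∈ ℝ` and `v ∈ H₃(ℝ)`. -/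
def mk (t : ℝ) (v : Heis) : Nil := ((t, v.x, v.y, v.z) : R4)

/-- The component in `ℝ`. -/
def t (p : Nil) : ℝ := (show R4 from p).1

/-- The component in `H₃(ℝ)`. -/
def v (p : Nil) : Heis :=
  ⟨(show R4 from p).2.1, (show R4 from p).2.2.1, (show R4 from p).2.2.2⟩

@[simp] theorem mk_t (t : ℝ) (v : Heis) : (mk t v).t = t := rfl
@[simp] theorem mk_v (t : ℝ) (v : Heis) : (mk t v).v = v := rfl

theorem ext' {p q : Nil} (h₁ : p.t = q.t) (h₂ : p.v = q.v) : p = q :=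
  Prod.ext h₁ (Prod.ext (congrArg Heis.x h₂) (Prod.ext (congrArg Heis.y h₂) (congrArg Heis.z h₂)))

instance : Mul Nil := ⟨fun p q => mk (p.t + q.t) (p.v * q.v)⟩

instance : One Nil := ⟨mk 0 1⟩

instance : Inv Nil := ⟨fun p => mk (-p.t) p.v⁻¹⟩

@[simp] theorem mul_t (p q : Nil) : (p * q).t = p.t + q.t := rfl
@[simp] theorem mul_v (p q : Nil) : (p * q).v = p.v * q.v := rfl
@[simp] theorem one_t : (1 : Nil).t = 0 := rfl
@[simp] theorem one_v : (1 : Nil).v = 1 := rfl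
@[simp] theorem inv_t (p : Nil) : (p⁻¹).t = -p.t := rfl
@[simp] theorem inv_v (p : Nil) : (p⁻¹).v = p.v⁻¹ := rfl

instance : Group Nil :=
  Group.ofLeftAxioms
    (fun a b c => ext' (by simp [add_assoc]) (by simp [mul_assoc]))
    (fun a => ext' (by simp) (by simp))
    (fun a => ext' (by simp) (by simp))

instance : TopologicalSpace Nil := inferInstanceAs (TopologicalSpace R4)
instance : T2Space Nil := inferInstanceAs (T2Space R4)
instance : LocallyCompactSpace Nil := inferInstanceAs (LocallyCompactSpace R4)
instance : ChartedSpace R4 Nil := chartedSpaceSelf R4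
instance : IsManifold 𝓘(ℝ, R4) ∞ Nil := inferInstanceAs (IsManifold 𝓘(ℝ, R4) ∞ R4)

end Nil

/-- The groups are Lie groups. -/
instance : LieGroup 𝓘(ℝ, R4) ∞ Osc where
  contMDiff_mul := by
    have h : ContDiff ℝ ∞ (fun p : R4 × R4 =>
        (show R4 from (show Osc from p.1) * (show Osc from p.2))) := by
      show ContDiff ℝ ∞ (fun p : R4 × R4 => ((p.1.1 + p.2.1,
        p.1.2.1 + (Real.cos p.1.1 * p.2.2.1 + Real.sin p.1.1 * p.2.2.2.1),
        p.1.2.2.1 + (-Real.sin p.1.1 * p.2.2.1 + Real.cos p.1.1 * p.2.2.2.1),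
        p.1.2.2.2 + p.2.2.2.2 +
          (p.1.2.1 * (-Real.sin p.1.1 * p.2.2.1 + Real.cos p.1.1 * p.2.2.2.1)
          - (Real.cos p.1.1 * p.2.2.1 + Real.sin p.1.1 * p.2.2.2.1) * p.1.2.2.1) / 2) : R4))
      fun_prop
    have h2 := h.contMDiff
    rw [modelWithCornersSelf_prod, ← chartedSpaceSelf_prod] at h2
    exact h2
  contMDiff_inv := by
    have h : ContDiff ℝ ∞ (E := R4) (F := R4) (fun p : R4 => (@Inv.inv Osc _ p : Osc)) := by
      show ContDiff ℝ ∞ (fun p : R4 => ((-p.1,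
        Real.cos (-p.1) * (-p.2.1) + Real.sin (-p.1) * (-p.2.2.1),
        -Real.sin (-p.1) * (-p.2.1) + Real.cos (-p.1) * (-p.2.2.1), -p.2.2.2) : R4))
      fun_prop
    exact h.contMDiff

instance : LieGroup 𝓘(ℝ, R4) ∞ Nil where
  contMDiff_mul := by
    have h : ContDiff ℝ ∞ (fun p : R4 × R4 =>
        (show R4 from (show Nil from p.1) * (show Nil from p.2))) := by
      show ContDiff ℝ ∞ (fun p : R4 × R4 => ((p.1.1 + p.2.1,
        p.1.2.1 + p.2.2.1, p.1.2.2.1 + p.2.2.2.1,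
        p.1.2.2.2 + p.2.2.2.2 + (p.1.2.1 * p.2.2.2.1 - p.2.2.1 * p.1.2.2.1) / 2) : R4))
      fun_prop
    have h2 := h.contMDiff
    rw [modelWithCornersSelf_prod, ← chartedSpaceSelf_prod] at h2
    exact h2
  contMDiff_inv := by
    have h : ContDiff ℝ ∞ (fun p : R4 => ((-p.1, -p.2.1, -p.2.2.1, -p.2.2.2) : R4)) := by
      fun_prop
    exact h.contMDiff

instance : IsTopologicalGroup Osc := topologicalGroup_of_lieGroup 𝓘(ℝ, R4) ∞
instance : IsTopologicalGroup Nil := topologicalGroup_of_lieGroup 𝓘(ℝ, R4) ∞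

/-! ### The lattices and their quotients -/

/-- The lattice `(qπ/2)ℤ ⋉ Γ_k` of the oscillator group. -/
def Osc.lattice (q k : ℕ+) : Subgroup Osc where
  carrier := {p | (∃ l : ℤ, p.t = l * (q * (Real.pi / 2))) ∧ p.v ∈ Heis.Gamma k}
  one_mem' := ⟨⟨0, by simp⟩, one_mem _⟩
  mul_mem' := by
    rintro p p' ⟨⟨l, hl⟩, hv⟩ ⟨⟨l', hl'⟩, hv'⟩
    refine ⟨⟨l + l', by rw [Osc.mul_t, hl, hl']; push_cast; ring⟩, ?_⟩
    rw [Osc.mul_v, hl]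
    refine mul_mem hv ?_
    have := Heis.rot_mem_Gamma (l * q) hv'
    push_cast at this
    rwa [mul_assoc] at this
  inv_mem' := by
    rintro p ⟨⟨l, hl⟩, hv⟩
    refine ⟨⟨-l, by rw [Osc.inv_t, hl]; push_cast; ring⟩, ?_⟩
    rw [Osc.inv_v, hl]
    have := Heis.rot_mem_Gamma (-l * q) (inv_mem hv)
    push_cast at this
    rwa [mul_assoc, neg_mul] at this

/-- The lattice `2πℤ × Γ_k` of `ℝ × H₃(ℝ)`. -/
def Nil.lattice (k : ℕ+) : Subgroup Nil where
  carrier := {p | (∃ l : ℤ, p.t = l * (2 * Real.pi)) ∧ p.v ∈ Heis.Gamma k}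
  one_mem' := ⟨⟨0, by simp⟩, one_mem _⟩
  mul_mem' := by
    rintro p p' ⟨⟨l, hl⟩, hv⟩ ⟨⟨l', hl'⟩, hv'⟩
    exact ⟨⟨l + l', by rw [Nil.mul_t, hl, hl']; push_cast; ring⟩, mul_mem hv hv'⟩
  inv_mem' := by
    rintro p ⟨⟨l, hl⟩, hv⟩
    exact ⟨⟨-l, by rw [Nil.inv_t, hl]; push_cast; ring⟩, inv_mem hv⟩

/-- The points of `ℝ⁴` with coordinates in `sℤ × ℤ × ℤ × (1/2k)ℤ` form a locally finite set. -/
theorem finite_grid_inter {K : Set R4} (hK : IsCompact K) {s : ℝ} (hs : 0 < s) (k : ℕ+) :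
    {p ∈ K | ∃ l a b c : ℤ, p = ((l * s, a, b, c / (2 * (k : ℝ))) : R4)}.Finite := by
  obtain ⟨R, hR⟩ := hK.isBounded.exists_norm_le
  have hk : (0 : ℝ) < 2 * (k : ℝ) := by
    have : (0 : ℝ) < ((k : ℕ) : ℝ) := by exact_mod_cast k.pos
    linarith
  have fin : ∀ r : ℝ, 0 < r → {n : ℤ | |(n : ℝ) * r| ≤ R}.Finite := by
    intro r hr
    refine (Set.finite_Icc (⌈-(R / r)⌉) (⌊R / r⌋)).subset fun n hn => ?_
    have hn' : |(n : ℝ)| * r ≤ R := by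
      have : |(n : ℝ) * r| ≤ R := hn
      rwa [abs_mul, abs_of_pos hr] at this
    have := abs_le.1 ((le_div_iff₀ hr).2 hn')
    exact ⟨Int.ceil_le.2 this.1, Int.le_floor.2 this.2⟩
  refine ((((fin s hs).prod ((fin 1 one_pos).prod ((fin 1 one_pos).prod
    (fin (1 / (2 * (k : ℝ))) (by positivity))))).image
    (fun n : ℤ × ℤ × ℤ × ℤ => ((n.1 * s, n.2.1, n.2.2.1, n.2.2.2 / (2 * (k : ℝ))) : R4)))).subset ?_
  rintro _ ⟨hp, l, a, b, c, rfl⟩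
  have h := hR _ hp
  simp only [Prod.norm_def, sup_le_iff, Real.norm_eq_abs] at h
  refine ⟨(l, a, b, c), ?_, rfl⟩
  simp only [Set.mem_prod, Set.mem_ofPred_eq, mul_one, mul_one_div]
  exact h

instance (q k : ℕ+) : ProperlyDiscontinuousSMul (Osc.lattice q k) Osc := by
  refine Subgroup.properlyDiscontinuousSMul_of_tendsto_cofinite _ ?_
  rw [Filter.tendsto_def]
  intro S hS
  obtain ⟨K, hK, hKS⟩ := Filter.mem_cocompact.1 hS
  have hs : (0 : ℝ) < q * (Real.pi / 2) := by
    have : (0 : ℝ) < ((q : ℕ) : ℝ) := by exact_mod_cast q.pos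
    positivity
  refine Filter.mem_cofinite.2 (Set.Finite.of_finite_image
    ((finite_grid_inter (K := K) hK hs k).subset ?_) Subtype.val_injective.injOn)
  rintro _ ⟨p, hp, rfl⟩
  obtain ⟨p, ⟨l, hl⟩, a, b, c, hv⟩ := p
  refine ⟨by_contra fun h => hp (hKS h), l, a, b, c, ?_⟩
  exact Osc.ext' (q := Osc.mk (l * (q * (Real.pi / 2))) ⟨a, b, c / (2 * (k : ℝ))⟩) hl hv

instance (k : ℕ+) : ProperlyDiscontinuousSMul (Nil.lattice k) Nil := by
  refine Subgroup.properlyDiscontinuousSMul_of_tendsto_cofinite _ ?_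
  rw [Filter.tendsto_def]
  intro S hS
  obtain ⟨K, hK, hKS⟩ := Filter.mem_cocompact.1 hS
  have hs : (0 : ℝ) < 2 * Real.pi := by positivity
  refine Filter.mem_cofinite.2 (Set.Finite.of_finite_image
    ((finite_grid_inter (K := K) hK hs k).subset ?_) Subtype.val_injective.injOn)
  rintro _ ⟨p, hp, rfl⟩
  obtain ⟨p, ⟨l, hl⟩, a, b, c, hv⟩ := p
  refine ⟨by_contra fun h => hp (hKS h), l, a, b, c, ?_⟩
  exact Nil.ext' (q := Nil.mk (l * (2 * Real.pi)) ⟨a, b, c / (2 * (k : ℝ))⟩) hl hv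

/-- The quotient of a manifold by a free, properly discontinuous, smooth action is a manifold. -/
theorem isManifold_quotient {E : Type*} [NormedAddCommGroup E] [NormedSpace ℝ E]
    {M : Type*} [TopologicalSpace M] [ChartedSpace E M] [IsManifold 𝓘(ℝ, E) ∞ M]
    [T2Space M] [LocallyCompactSpace M] {Γ : Type*} [Group Γ] [MulAction Γ M]
    [ProperlyDiscontinuousSMul Γ M] [ContinuousConstSMul Γ M] [IsCancelSMul Γ M]
    (hΓ : ∀ g : Γ, ContMDiff 𝓘(ℝ, E) 𝓘(ℝ, E) ∞ (fun p : M => g • p)) :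
    IsManifold 𝓘(ℝ, E) ∞ (MulAction.orbitRel.Quotient Γ M) := by
  apply isManifold_of_contDiffOn
  rintro _ _ ⟨a, rfl⟩ ⟨b, rfl⟩
  generalize_proofs hf ha
  generalize ha.choose a = a'
  generalize ha.choose b = b'
  have hsymm := hf.localInverseAt_symm b'
  have hsymma := hf.localInverseAt_symm a'
  generalize hf.localInverseAt a' = ea at *
  generalize hf.localInverseAt b' = eb at *
  have hcont : Continuous (Quotient.mk (MulAction.orbitRel Γ M)) := hf.continuous
  intro y hy
  obtain ⟨hy, -⟩ := hy
  simp only [modelWithCornersSelf_coe_symm, Set.preimage_id, OpenPartialHomeomorph.trans_source,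
    OpenPartialHomeomorph.symm_source,
    OpenPartialHomeomorph.coe_trans, OpenPartialHomeomorph.trans_symm_eq_symm_trans_symm,
    Set.mem_inter_iff, Set.mem_preimage, Function.comp_apply, hsymma] at hy
  obtain ⟨⟨hy1, hy2⟩, hy3, hy4⟩ := hy
  set p := (chartAt E a').symm y with hp
  have hq : Quotient.mk (MulAction.orbitRel Γ M) (eb (Quotient.mk _ p)) = Quotient.mk _ p := by
    rw [← congrFun hsymm]; exact eb.left_inv hy3
  obtain ⟨g, hg⟩ : ∃ g : Γ, g • p = eb (Quotient.mk _ p) := Quotient.exact hq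
  have hev : ∀ᶠ p' in nhds p, eb (Quotient.mk _ p') = g • p' := by
    have h1 : ∀ᶠ p' in nhds p, g • p' ∈ eb.target := by
      refine (continuous_const_smul g).continuousAt.eventually_mem (eb.open_target.mem_nhds ?_)
      rw [hg]; exact eb.map_source hy3
    filter_upwards [h1] with p' h1'
    have h3 : Quotient.mk (MulAction.orbitRel Γ M) p' = Quotient.mk _ (g • p') :=
      (Quotient.sound ⟨g, rfl⟩ : Quotient.mk (MulAction.orbitRel Γ M) (g • p') = _).symm
    rw [h3, ← congrFun hsymm]
    exact eb.right_inv h1'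
  have hev2 : ∀ᶠ y' in nhds y,
      eb (Quotient.mk _ ((chartAt E a').symm y')) = g • ((chartAt E a').symm y') :=
    ((chartAt E a').continuousAt_symm hy1).eventually hev
  have hsm : ContDiffAt ℝ ∞ (fun y' => chartAt E b' (g • ((chartAt E a').symm y'))) y := by
    rw [← contMDiffAt_iff_contDiffAt]
    have h1 : ContMDiffAt 𝓘(ℝ, E) 𝓘(ℝ, E) ∞ (chartAt E a').symm y :=
      (contMDiffOn_chart_symm y hy1).contMDiffAt ((chartAt E a').open_target.mem_nhds hy1)
    have h2 : ContMDiffAt 𝓘(ℝ, E) 𝓘(ℝ, E) ∞ (chartAt E b') (g • p) := by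
      rw [hg]
      exact (contMDiffOn_chart _ hy4).contMDiffAt ((chartAt E b').open_source.mem_nhds hy4)
    exact ContMDiffAt.comp y h2 (ContMDiffAt.comp y (hΓ g).contMDiffAt h1)
  refine (hsm.congr_of_eventuallyEq ?_).contDiffWithinAt
  filter_upwards [hev2] with y' hy'
  simp [hsymma, ← hy']

/-- The quotient of `G` by the action of the lattice `(qπ/2)ℤ ⋉ Γ_k` by left translations, with the
quotient topology and the manifold structure for which `G → M` is a local diffeomorphism. -/
abbrev Solv (q k : ℕ+) : Type := MulAction.orbitRel.Quotient (Osc.lattice q k) Osc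

/-- `M_{k,0}`, the quotient by `Λ_{k,0} = 2πℤ ⋉ Γ_k`. -/
abbrev MZero (k : ℕ+) : Type := Solv 4 k

/-- `M_{k,π}`, the quotient by `Λ_{k,π} = πℤ ⋉ Γ_k`. -/
abbrev MPi (k : ℕ+) : Type := Solv 2 k

/-- `M_{k,π/2}`, the quotient by `Λ_{k,π/2} = (π/2)ℤ ⋉ Γ_k`. -/
abbrev MPiHalf (k : ℕ+) : Type := Solv 1 k

/-- The Kodaira–Thurston manifold, the quotient of `ℝ × H₃(ℝ)` by `2πℤ × Γ_k` acting by left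
translations, i.e. `S¹ × (Γ_k \ H₃(ℝ))`. -/
abbrev KodairaThurston (k : ℕ+) : Type := MulAction.orbitRel.Quotient (Nil.lattice k) Nil

/-- The covering `G → M`. -/
def Solv.proj (q k : ℕ+) (p : Osc) : Solv q k := Quotient.mk _ p

/-- The covering of the Kodaira–Thurston manifold by `ℝ × H₃(ℝ)`. -/
def KodairaThurston.proj (k : ℕ+) (p : Nil) : KodairaThurston k := Quotient.mk _ p

/-- The covering `ℝ × H₃(ℝ) → M_{k,0}`, `(t, v) ↦ Λ_{k,0} (t, v)`. -/
def MZero.nilProj (k : ℕ+) (p : Nil) : MZero k := Solv.proj 4 k (Osc.mk p.t p.v)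

instance (q k : ℕ+) : IsManifold 𝓘(ℝ, R4) ∞ (Solv q k) :=
  isManifold_quotient fun g => contMDiff_mul_left (I := 𝓘(ℝ, R4)) (a := (g : Osc))

instance (k : ℕ+) : IsManifold 𝓘(ℝ, R4) ∞ (KodairaThurston k) :=
  isManifold_quotient fun g => contMDiff_mul_left (I := 𝓘(ℝ, R4)) (a := (g : Nil))

/-- Each quotient of the oscillator group by a lattice of the family is compact. -/
instance (q k : ℕ+) : CompactSpace (Solv q k) := by
  have hq : (0 : ℝ) < q * (Real.pi / 2) := by
    have : (0 : ℝ) < ((q : ℕ) : ℝ) := by exact_mod_cast q.pos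
    positivity
  have hk : (0 : ℝ) < 2 * (k : ℝ) := by
    have : (0 : ℝ) < ((k : ℕ) : ℝ) := by exact_mod_cast k.pos
    linarith
  have hK : IsCompact (Set.Icc (0 : R4) (q * (Real.pi / 2), 1, 1, 1 / (2 * (k : ℝ)))) :=
    isCompact_Icc
  have hc : Continuous (Solv.proj q k) := continuous_quotient_mk'
  refine ⟨?_⟩
  convert (IsCompact.image (X := Osc) hK hc) using 1
  refine (Set.eq_univ_of_forall fun m => ?_).symm
  induction m using Quotient.inductionOn with | _ p =>
  -- reduce the coordinates one after the other
  set s : ℝ := q * (Real.pi / 2)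
  let l : ℤ := -⌊p.t / s⌋
  let g₁ : Osc := Osc.mk (l * s) 1
  let p₁ : Osc := g₁ * p
  let g₂ : Osc := Osc.mk 0 ⟨(-⌊p₁.v.x⌋ : ℤ), (-⌊p₁.v.y⌋ : ℤ), 0⟩
  let p₂ : Osc := g₂ * p₁
  let g₃ : Osc := Osc.mk 0 ⟨0, 0, (-⌊p₂.v.z * (2 * (k : ℝ))⌋ : ℤ) / (2 * (k : ℝ))⟩
  have h₁ : g₁ ∈ Osc.lattice q k := ⟨⟨l, rfl⟩, one_mem _⟩
  have h₂ : g₂ ∈ Osc.lattice q k := ⟨⟨0, by simp [g₂]⟩, -⌊p₁.v.x⌋, -⌊p₁.v.y⌋, 0, by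
    simp only [g₂, Osc.mk_v]; ext <;> simp⟩
  have h₃ : g₃ ∈ Osc.lattice q k := ⟨⟨0, by simp [g₃]⟩, 0, 0, -⌊p₂.v.z * (2 * (k : ℝ))⌋, by
    simp only [g₃, Osc.mk_v]; ext <;> simp⟩
  have ht : (g₃ * p₂).t = Int.fract (p.t / s) * s := by
    simp only [g₃, p₂, g₂, p₁, g₁, l, Osc.mul_t, Osc.mk_t, Int.fract]
    push_cast; field_simp; ring
  have hx : (g₃ * p₂).v.x = Int.fract p₁.v.x := by
    simp only [g₃, p₂, g₂, Osc.mul_v, Osc.mk_t, Osc.mk_v, Heis.rot_zero, Heis.mul_x, Int.fract]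
    push_cast; ring
  have hy : (g₃ * p₂).v.y = Int.fract p₁.v.y := by
    simp only [g₃, p₂, g₂, Osc.mul_v, Osc.mk_t, Osc.mk_v, Heis.rot_zero, Heis.mul_y, Int.fract]
    push_cast; ring
  have hz : (g₃ * p₂).v.z = Int.fract (p₂.v.z * (2 * (k : ℝ))) / (2 * (k : ℝ)) := by
    simp only [g₃, Osc.mul_v, Osc.mk_t, Osc.mk_v, Heis.rot_zero, Heis.mul_z, Int.fract]
    push_cast; field_simp; ring
  refine ⟨g₃ * p₂, ⟨⟨?_, ?_, ?_, ?_⟩, ?_, ?_, ?_, ?_⟩, Quotient.sound ⟨⟨g₃ * (g₂ * g₁),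
    mul_mem h₃ (mul_mem h₂ h₁)⟩, ?_⟩⟩
  · exact (mul_nonneg (Int.fract_nonneg _) hq.le).trans ht.ge
  · exact (Int.fract_nonneg _).trans hx.ge
  · exact (Int.fract_nonneg _).trans hy.ge
  · exact (div_nonneg (Int.fract_nonneg _) hk.le).trans hz.ge
  · exact ht.le.trans (mul_le_of_le_one_left hq.le (Int.fract_lt_one _).le)
  · exact hx.le.trans ((Int.fract_lt_one _).le)
  · exact hy.le.trans ((Int.fract_lt_one _).le)
  · exact hz.le.trans (div_le_div_of_nonneg_right (Int.fract_lt_one _).le hk.le)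
  · show g₃ * (g₂ * g₁) * p = g₃ * (g₂ * (g₁ * p))
    simp only [mul_assoc]

/-- The values at `p`, on the tangent vectors `u, w`, of the left-invariant `2`-form
`a τ∧α + b τ∧β + c α∧β + e α∧γ + f β∧γ` on `ℝ × H₃(ℝ)`, where
`τ = dt, α = dx, β = dy, γ = dz - (x dy - y dx)/2` is the standard left-invariant coframe. -/
def nilTwoForm (a b c e f : ℝ) (p : Nil) (u w : R4) : ℝ :=
  let τ : R4 → ℝ := fun u => u.1
  let α : R4 → ℝ := fun u => u.2.1
  let β : R4 → ℝ := fun u => u.2.2.1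
  let γ : R4 → ℝ := fun u => u.2.2.2 - (p.v.x * u.2.2.1 - p.v.y * u.2.1) / 2
  a * (τ u * α w - τ w * α u) + b * (τ u * β w - τ w * β u) + c * (α u * β w - α w * β u)
    + e * (α u * γ w - α w * γ u) + f * (β u * γ w - β w * γ u)

end

/-! For angles in 2πℤ the rotation α is trivial, so an element of Λ_{k,0} translates ℝ⁴ in the same
way whether it is multiplied in G or in ℝ × H₃(ℝ). The two quotients therefore have the same orbits
(`MZero.nilProj_eq_iff`), and M_{k,0} carries two notions of invariance. A form on a quotient is
studied through its lift, a form on ℝ⁴ that is periodic under the lattice; `Solv.lift_injective`,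
`Solv.exists_lift_eq`, `Solv.lift_d` and `Solv.lift_nondegenerate` make this faithful. On ℝ⁴ a
2-form is described by its six coefficients in the frame T, X, Y, Z, left-invariant on ℝ × H₃(ℝ),
with [X, Y] = Z as the only nonzero bracket; it is nondegenerate exactly where its Pfaffian does not
vanish (`FormR4.nondegenerate_iff`).

Under invariance by ℝ × H₃(ℝ) the coefficients are constant, closedness kills the one of τ∧γ, and
the Pfaffian is af - be. Under invariance by G the coefficients rotate with t; closedness then
forces the coefficients of τ∧γ, α∧γ and β∧γ to vanish at the origin, and the Pfaffian with them
(`pfaffian_eq_zero_of_invariant`).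

For the Betti numbers, every closed 2-form on M_{k,0} is cohomologous to A τ∧α + B τ∧β + E α∧γ + F
β∧γ with constant A, B, E, F (`FormR4.exists_primitive`). This is elementary: along a period, a
periodic function is its mean plus the derivative of a periodic function, and a periodic function
that is affine along its period is constant there. `SplittingOperators` records these two facts for
the directions Z, Y, X, T, and the rest is algebra. The rotation by π changes the sign of the four
remaining forms. So if the form comes from M_{k,π}, averaging the primitive over the translation by
π (`FormR4.meanShift`) cancels them, and the form is exact; one more averaging settles M_{k,π/2}.

Finally, if ξ = dη on M_{k,0}, then d(η∧ξ) = ξ∧ξ is twice the Pfaffian times the volume form. A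
divergence on M_{k,0} cannot have a strict sign (`exists_divergence_nonpos`), so the Pfaffian
vanishes somewhere (`FormR4.exists_pfaffian_eq_zero`) and ξ is not symplectic. -/

open scoped Manifold ContDiff

set_option linter.unusedSectionVars false

noncomputable section

/-! ### Smooth structure of a quotient by a properly discontinuous action. -/

section Quotient

open MulAction

variable {E : Type*} [NormedAddCommGroup E] [NormedSpace ℝ E]
  {M : Type*} [TopologicalSpace M] [ChartedSpace E M] [IsManifold 𝓘(ℝ, E) ∞ M]
  [T2Space M] [LocallyCompactSpace M] {Γ : Type*} [Group Γ] [MulAction Γ M]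
  [ProperlyDiscontinuousSMul Γ M] [ContinuousConstSMul Γ M] [IsCancelSMul Γ M]

/-- The preferred chart of a quotient manifold is a section of the projection followed by a
chart. -/
theorem exists_chartAt_quotient (m : orbitRel.Quotient Γ M) :
    ∃ (s : OpenPartialHomeomorph (orbitRel.Quotient Γ M) M) (a : M),
      ⇑s.symm = Quotient.mk (orbitRel Γ M) ∧ chartAt E m = s.trans (chartAt E a) :=
  ⟨_, _, IsLocalHomeomorph.localInverseAt_symm _ _, rfl⟩

/-- A local section of the projection agrees, along the projection, with a translation. -/
theorem section_quotient_eventuallyEq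
    {s : OpenPartialHomeomorph (orbitRel.Quotient Γ M) M}
    (hs : ⇑s.symm = Quotient.mk (orbitRel Γ M)) {p : M}
    (hp : Quotient.mk (orbitRel Γ M) p ∈ s.source) :
    ∃ g : Γ, ∀ᶠ p' in nhds p, s (Quotient.mk _ p') = g • p' := by
  obtain ⟨g, hg⟩ : ∃ g : Γ, g • p = s (Quotient.mk _ p) :=
    Quotient.exact (s := orbitRel Γ M)
      (show Quotient.mk _ (s (Quotient.mk _ p)) = Quotient.mk _ p from
        (congrFun hs _).symm.trans (s.left_inv hp))
  refine ⟨g, ?_⟩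
  -- Near p the point g • p' stays in the image of the section, where s inverts the projection, and
  -- the projection does not distinguish p' from g • p'.
  have h1 : ∀ᶠ p' in nhds p, g • p' ∈ s.target := by
    refine (continuous_const_smul g).continuousAt.eventually_mem (s.open_target.mem_nhds ?_)
    rw [hg]; exact s.map_source hp
  filter_upwards [h1] with p' h1'
  have h3 : Quotient.mk (orbitRel Γ M) p' = Quotient.mk _ (g • p') :=
    (Quotient.sound ⟨g, rfl⟩ : Quotient.mk (orbitRel Γ M) (g • p') = _).symm
  rw [h3, ← congrFun hs]
  exact s.right_inv h1'

variable [hQ : IsManifold 𝓘(ℝ, E) ∞ (orbitRel.Quotient Γ M)]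

/-- The projection onto a quotient manifold is smooth. -/
theorem contMDiff_quotient_mk
    (hΓ : ∀ g : Γ, ContMDiff 𝓘(ℝ, E) 𝓘(ℝ, E) ∞ (fun p : M => g • p)) :
    ContMDiff 𝓘(ℝ, E) 𝓘(ℝ, E) ∞ (Quotient.mk (orbitRel Γ M)) := by
  intro p
  set m : orbitRel.Quotient Γ M := Quotient.mk _ p with hm
  obtain ⟨s, a, hs, hc⟩ := exists_chartAt_quotient (E := E) m
  have hmem := mem_chart_source E m
  have hmem' := hmem
  rw [hc, OpenPartialHomeomorph.trans_source] at hmem'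
  obtain ⟨g, hg⟩ := section_quotient_eventuallyEq hs (p := p) hmem'.1
  have hgp : s m = g • p := hg.self_of_nhds
  have h1 : ContMDiffAt 𝓘(ℝ, E) 𝓘(ℝ, E) ∞ (chartAt E a) (g • p) := by
    have : g • p ∈ (chartAt E a).source := by rw [← hgp]; exact hmem'.2
    exact (contMDiffOn_chart _ this).contMDiffAt ((chartAt E a).open_source.mem_nhds this)
  have htgt : chartAt E a (g • p) ∈ (chartAt E m).target := by
    rw [← hgp]
    have := (chartAt E m).map_source hmem
    rwa [hc] at this ⊢
  have h2 : ContMDiffAt 𝓘(ℝ, E) 𝓘(ℝ, E) ∞ (chartAt E m).symm (chartAt E a (g • p)) :=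
    (contMDiffOn_chart_symm _ htgt).contMDiffAt ((chartAt E m).open_target.mem_nhds htgt)
  have h3 := ContMDiffAt.comp p h2 (ContMDiffAt.comp p h1 (hΓ g).contMDiffAt)
  refine h3.congr_of_eventuallyEq ?_
  have h4 : ∀ᶠ p' in nhds p, g • p' ∈ (chartAt E a).source :=
    (continuous_const_smul g).continuousAt.eventually_mem
      ((chartAt E a).open_source.mem_nhds (by rw [← hgp]; exact hmem'.2))
  filter_upwards [h4] with p' hp'
  simp only [Function.comp_apply, hc, OpenPartialHomeomorph.coe_trans_symm, hs,
    (chartAt E a).left_inv hp']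
  exact (Quotient.sound ⟨g, rfl⟩ : Quotient.mk (orbitRel Γ M) (g • p') = _).symm

/-- A local section of the projection onto a quotient manifold is smooth. -/
theorem contMDiffOn_section_quotient
    (hΓ : ∀ g : Γ, ContMDiff 𝓘(ℝ, E) 𝓘(ℝ, E) ∞ (fun p : M => g • p))
    {s : OpenPartialHomeomorph (orbitRel.Quotient Γ M) M}
    (hs : ⇑s.symm = Quotient.mk (orbitRel Γ M)) :
    ContMDiffOn 𝓘(ℝ, E) 𝓘(ℝ, E) ∞ s s.source := by
  intro m hm
  refine ContMDiffAt.contMDiffWithinAt ?_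
  obtain ⟨s', a, hs', hc⟩ := exists_chartAt_quotient (E := E) m
  have hmem := mem_chart_source E m
  have hmem' := hmem
  rw [hc, OpenPartialHomeomorph.trans_source] at hmem'
  have hpm : Quotient.mk (orbitRel Γ M) (s m) = m := by
    rw [← congrFun hs]; exact s.left_inv hm
  obtain ⟨g, hg⟩ := section_quotient_eventuallyEq hs' (p := s m) (by rw [hpm]; exact hmem'.1)
  have htgt : chartAt E m m ∈ (chartAt E a).target := by
    rw [hc]; exact (chartAt E a).map_source hmem'.2
  have h1 : ContMDiffAt 𝓘(ℝ, E) 𝓘(ℝ, E) ∞ (chartAt E m) m :=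
    (contMDiffOn_chart _ hmem).contMDiffAt ((chartAt E m).open_source.mem_nhds hmem)
  have h2 : ContMDiffAt 𝓘(ℝ, E) 𝓘(ℝ, E) ∞ (chartAt E a).symm (chartAt E m m) :=
    (contMDiffOn_chart_symm _ htgt).contMDiffAt ((chartAt E a).open_target.mem_nhds htgt)
  have h3 := ContMDiffAt.comp m ((hΓ g⁻¹) _) (ContMDiffAt.comp m h2 h1)
  refine h3.congr_of_eventuallyEq ?_
  filter_upwards [(s.continuousAt hm).eventually hg, s.open_source.mem_nhds hm,
    (chartAt E m).open_source.mem_nhds hmem] with m' h4 h5 h6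
  rw [hc, OpenPartialHomeomorph.trans_source] at h6
  have h7 : Quotient.mk (orbitRel Γ M) (s m') = m' := by
    rw [← congrFun hs]; exact s.left_inv h5
  rw [h7] at h4
  simp only [Function.comp_apply, hc, OpenPartialHomeomorph.coe_trans]
  rw [(chartAt E a).left_inv h6.2, h4, inv_smul_smul]

/-- The projection onto a quotient manifold is a local diffeomorphism. -/
theorem isLocalDiffeomorph_quotient_mk
    (hΓ : ∀ g : Γ, ContMDiff 𝓘(ℝ, E) 𝓘(ℝ, E) ∞ (fun p : M => g • p)) :
    IsLocalDiffeomorph 𝓘(ℝ, E) 𝓘(ℝ, E) ∞ (Quotient.mk (orbitRel Γ M)) := by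
  intro p
  have hl : IsLocalHomeomorph (Quotient.mk (orbitRel Γ M)) :=
    isQuotientCoveringMap_quotientMk_of_properlyDiscontinuousSMul.isCoveringMap.isLocalHomeomorph
  obtain ⟨e, hp, he⟩ := hl p
  exact ⟨⟨e.toPartialEquiv, e.open_source, e.open_target,
    by
      refine (contMDiff_quotient_mk hΓ).contMDiffOn.congr fun x _ => ?_
      exact (congrFun he x).symm,
    contMDiffOn_section_quotient hΓ (s := e.symm) (by rw [OpenPartialHomeomorph.symm_symm, he])⟩,
    hp, fun x _ => congrFun he x⟩

end Quotient

/-! ### Local diffeomorphisms descend along surjective local diffeomorphisms. -/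

section Descent

variable {E : Type*} [NormedAddCommGroup E] [NormedSpace ℝ E]
  {M N P : Type*} [TopologicalSpace M] [ChartedSpace E M] [TopologicalSpace N] [ChartedSpace E N]
  [TopologicalSpace P] [ChartedSpace E P]

/-- A map whose composition with a surjective local diffeomorphism is a local diffeomorphism is a
local diffeomorphism. -/
theorem IsLocalDiffeomorph.of_comp_surjective {f : M → N} {h : N → P}
    (hf : IsLocalDiffeomorph 𝓘(ℝ, E) 𝓘(ℝ, E) ∞ f) (hfs : Function.Surjective f)
    (hhf : IsLocalDiffeomorph 𝓘(ℝ, E) 𝓘(ℝ, E) ∞ (h ∘ f)) :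
    IsLocalDiffeomorph 𝓘(ℝ, E) 𝓘(ℝ, E) ∞ h := by
  intro n
  obtain ⟨m, rfl⟩ := hfs n
  obtain ⟨φ, hm, hφ⟩ := hf m
  obtain ⟨ψ, hm', hψ⟩ := hhf m
  -- Locally h is (h ∘ f) composed with a local inverse of f.
  refine ⟨φ.symm.trans ψ, ?_, ?_⟩
  · refine ⟨?_, ?_⟩
    · change f m ∈ φ.target
      rw [hφ hm]; exact φ.map_source hm
    · change φ.toPartialEquiv.symm (f m) ∈ ψ.source
      rw [hφ hm]
      have : φ.toPartialEquiv.symm (φ.toPartialEquiv m) = m := φ.left_inv hm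
      exact (congrArg (· ∈ ψ.source) this).mpr hm'
  · rintro x ⟨hx1, hx2⟩
    have hx1' : x ∈ φ.target := hx1
    change h x = ψ.toPartialEquiv (φ.toPartialEquiv.symm x)
    have h1 := hψ hx2
    have h2 : f (φ.toPartialEquiv.symm x) = x := by
      rw [hφ (φ.map_target hx1')]; exact φ.right_inv hx1'
    have h3 : h (f (φ.toPartialEquiv.symm x)) = ψ.toPartialEquiv (φ.toPartialEquiv.symm x) := h1
    rw [← h3, h2]

end Descent

/-! ### The diffeomorphism with the Kodaira–Thurston manifold and the finite coverings. -/

section Coverings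

open MulAction

theorem Solv.proj_surjective (q k : ℕ+) : Function.Surjective (Solv.proj q k) :=
  Quotient.mk_surjective

theorem Solv.proj_eq_iff {q k : ℕ+} {p p' : Osc} :
    Solv.proj q k p = Solv.proj q k p' ↔ ∃ g ∈ Osc.lattice q k, g * p' = p := by
  constructor
  · intro h
    obtain ⟨⟨g, hg⟩, h⟩ := Quotient.exact (s := orbitRel (Osc.lattice q k) Osc) h
    exact ⟨g, hg, h⟩
  · rintro ⟨g, hg, rfl⟩
    exact Quotient.sound ⟨⟨g, hg⟩, rfl⟩

theorem Solv.proj_mul {q k : ℕ+} {g : Osc} (hg : g ∈ Osc.lattice q k) (p : Osc) :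
    Solv.proj q k (g * p) = Solv.proj q k p :=
  Solv.proj_eq_iff.2 ⟨g, hg, rfl⟩

theorem KodairaThurston.proj_eq_iff {k : ℕ+} {p p' : Nil} :
    KodairaThurston.proj k p = KodairaThurston.proj k p' ↔
      ∃ g ∈ Nil.lattice k, g * p' = p := by
  constructor
  · intro h
    obtain ⟨⟨g, hg⟩, h⟩ := Quotient.exact (s := orbitRel (Nil.lattice k) Nil) h
    exact ⟨g, hg, h⟩
  · rintro ⟨g, hg, rfl⟩
    exact Quotient.sound ⟨⟨g, hg⟩, rfl⟩

theorem Solv.isLocalDiffeomorph_proj (q k : ℕ+) :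
    IsLocalDiffeomorph 𝓘(ℝ, R4) 𝓘(ℝ, R4) ∞ (Solv.proj q k) :=
  isLocalDiffeomorph_quotient_mk fun g => contMDiff_mul_left (I := 𝓘(ℝ, R4)) (a := (g : Osc))

theorem KodairaThurston.isLocalDiffeomorph_proj (k : ℕ+) :
    IsLocalDiffeomorph 𝓘(ℝ, R4) 𝓘(ℝ, R4) ∞ (KodairaThurston.proj k) :=
  isLocalDiffeomorph_quotient_mk fun g => contMDiff_mul_left (I := 𝓘(ℝ, R4)) (a := (g : Nil))

/-- Both groups have the same underlying manifold ℝ⁴, and on it the two projections to M_{k,0} agree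
by definition. -/
theorem MZero.isLocalDiffeomorph_nilProj (k : ℕ+) :
    IsLocalDiffeomorph 𝓘(ℝ, R4) 𝓘(ℝ, R4) ∞ (MZero.nilProj k) :=
  Solv.isLocalDiffeomorph_proj 4 k

theorem Heis.rot_int_mul_two_pi (l : ℤ) (v : Heis) : Heis.rot (l * (2 * Real.pi)) v = v := by
  have hc : Real.cos (l * (2 * Real.pi)) = 1 := Real.cos_int_mul_two_pi l
  have hs : Real.sin (l * (2 * Real.pi)) = 0 := by
    have := Real.sin_int_mul_pi (l * 2)
    push_cast at this
    rwa [mul_assoc] at this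
  ext <;> simp [hc, hs]

theorem Osc.four_mul_half_pi : (((4 : ℕ+) : ℕ) : ℝ) * (Real.pi / 2) = 2 * Real.pi := by
  norm_num; ring

/-- Elements of `Osc.lattice 4 k` have t in 2πℤ, where the rotation is trivial, so they multiply by
the rule of the direct product and the orbits of the two lattices coincide. -/
theorem MZero.nilProj_eq_iff {k : ℕ+} {p p' : Nil} :
    MZero.nilProj k p = MZero.nilProj k p' ↔ ∃ g ∈ Nil.lattice k, g * p' = p := by
  rw [MZero.nilProj, MZero.nilProj, Solv.proj_eq_iff]
  constructor
  · rintro ⟨g, ⟨⟨l, hl⟩, hv⟩, h⟩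
    rw [Osc.four_mul_half_pi] at hl
    refine ⟨Nil.mk g.t g.v, ⟨⟨l, hl⟩, hv⟩, Nil.ext' ?_ ?_⟩
    · simpa using congrArg Osc.t h
    · simpa [hl, Heis.rot_int_mul_two_pi] using congrArg Osc.v h
  · rintro ⟨g, ⟨⟨l, hl⟩, hv⟩, rfl⟩
    refine ⟨Osc.mk g.t g.v, ⟨⟨l, hl.trans (by rw [Osc.four_mul_half_pi])⟩, hv⟩,
      Osc.ext' (by simp) ?_⟩
    simp [hl, Heis.rot_int_mul_two_pi]

/-- The Kodaira–Thurston manifold is diffeomorphic to `M_{k,0}`. -/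
theorem exists_diffeomorph_kodairaThurston (k : ℕ+) :
    ∃ Ψ : KodairaThurston k ≃ₘ⟮𝓘(ℝ, R4), 𝓘(ℝ, R4)⟯ MZero k,
      ∀ p : Nil, Ψ (KodairaThurston.proj k p) = MZero.nilProj k p := by
  let F : KodairaThurston k → MZero k := Quotient.lift (MZero.nilProj k) fun p p' h =>
    MZero.nilProj_eq_iff.2 (KodairaThurston.proj_eq_iff.1 (Quotient.sound h))
  have hF : ∀ p, F (KodairaThurston.proj k p) = MZero.nilProj k p := fun _ => rfl
  have hsurj : Function.Surjective (KodairaThurston.proj k) := Quotient.mk_surjective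
  have hloc : IsLocalDiffeomorph 𝓘(ℝ, R4) 𝓘(ℝ, R4) ∞ F :=
    (KodairaThurston.isLocalDiffeomorph_proj k).of_comp_surjective hsurj
      (MZero.isLocalDiffeomorph_nilProj k)
  have hbij : Function.Bijective F := by
    constructor
    · intro m m' h
      obtain ⟨p, rfl⟩ := hsurj m
      obtain ⟨p', rfl⟩ := hsurj m'
      exact KodairaThurston.proj_eq_iff.2 (MZero.nilProj_eq_iff.1 h)
    · intro m
      obtain ⟨p, rfl⟩ := Solv.proj_surjective 4 k m
      exact ⟨KodairaThurston.proj k (Nil.mk p.t p.v), rfl⟩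
  exact ⟨hloc.diffeomorphOfBijective hbij, fun p => hF p⟩

instance (q k : ℕ+) : T2Space (Solv q k) :=
  t2Space_of_properlyDiscontinuousSMul_of_t2Space

theorem Osc.lattice_mul_le (q n k : ℕ+) : Osc.lattice (q * n) k ≤ Osc.lattice q k := by
  rintro p ⟨⟨l, hl⟩, hv⟩
  exact ⟨⟨l * (n : ℕ), by rw [hl]; push_cast; ring⟩, hv⟩

/-- The translation by `q π / 2` in the factor `ℝ` of the oscillator group. -/
def Osc.shift (q : ℕ) : Osc := Osc.mk (q * (Real.pi / 2)) 1

theorem Osc.shift_mem_lattice (q k : ℕ+) (j : ℕ) : Osc.shift (j * q) ∈ Osc.lattice q k :=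
  ⟨⟨j, by simp [Osc.shift, mul_assoc]⟩, one_mem _⟩

/-- As qπ/2 is nonzero, l is determined by p; membership in the coarser lattice thus becomes a
divisibility, which is how cosets are counted. -/
theorem Osc.mem_lattice_mul_iff {q n k : ℕ+} {p : Osc} {l : ℤ}
    (hl : p.t = l * (q * (Real.pi / 2))) (hv : p.v ∈ Heis.Gamma k) :
    p ∈ Osc.lattice (q * n) k ↔ ((n : ℕ) : ℤ) ∣ l := by
  have hq : (q : ℝ) * (Real.pi / 2) ≠ 0 := by
    have : (0 : ℝ) < ((q : ℕ) : ℝ) := by exact_mod_cast q.pos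
    have := Real.pi_pos
    positivity
  constructor
  · rintro ⟨⟨l', hl'⟩, -⟩
    refine ⟨l', ?_⟩
    have h : (l : ℝ) * (q * (Real.pi / 2)) = ((n : ℕ) * l') * (q * (Real.pi / 2)) := by
      rw [← hl, hl']; push_cast; ring
    exact_mod_cast mul_right_cancel₀ hq h
  · rintro ⟨l', rfl⟩
    exact ⟨⟨l', by rw [hl]; push_cast; ring⟩, hv⟩

/-- If `Λ ≤ Λ'` are lattices of the family, the covering `Λ \ G → Λ' \ G` has `[Λ' : Λ]` sheets. -/
theorem exists_covering_solv (q n k : ℕ+) :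
    ∃ P : Solv (q * n) k → Solv q k, (∀ g : Osc, P (Solv.proj (q * n) k g) = Solv.proj q k g) ∧
      IsCoveringMap P ∧ IsLocalDiffeomorph 𝓘(ℝ, R4) 𝓘(ℝ, R4) ∞ P ∧
      ∀ m : Solv q k, (P ⁻¹' {m}).ncard = n := by
  let P : Solv (q * n) k → Solv q k := Quotient.lift (Solv.proj q k) fun p p' h => by
    obtain ⟨g, hg, hgp⟩ := Solv.proj_eq_iff.1
      (show Solv.proj (q * n) k p = Solv.proj (q * n) k p' from Quotient.sound h)
    exact Solv.proj_eq_iff.2 ⟨g, Osc.lattice_mul_le q n k hg, hgp⟩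
  have hP : ∀ g : Osc, P (Solv.proj (q * n) k g) = Solv.proj q k g := fun _ => rfl
  have hloc : IsLocalDiffeomorph 𝓘(ℝ, R4) 𝓘(ℝ, R4) ∞ P :=
    (Solv.isLocalDiffeomorph_proj (q * n) k).of_comp_surjective (Solv.proj_surjective _ k)
      (Solv.isLocalDiffeomorph_proj q k)
  -- Compactness and the Hausdorff property turn the local homeomorphism into a covering map.
  refine ⟨P, hP, isLocalHomeomorph_iff_isCoveringMap.1 hloc.isLocalHomeomorph, hloc, fun m => ?_⟩
  obtain ⟨p, rfl⟩ := Solv.proj_surjective q k m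
  -- The translations by jqπ/2 with 0 ≤ j < n represent the cosets of the smaller lattice, so they
  -- enumerate the fibre over the class of p.
  let F : Fin n → Solv (q * n) k := fun j => Solv.proj (q * n) k (Osc.shift (j * q) * p)
  have hinj : Function.Injective F := by
    intro i j hij
    obtain ⟨g, hg, hgp⟩ := Solv.proj_eq_iff.1 hij
    rw [← mul_assoc] at hgp
    have hgs := mul_right_cancel hgp
    have hg' : g = Osc.shift (i * q) * (Osc.shift (j * q))⁻¹ := by rw [← hgs]; group
    have ht : g.t = ((i : ℤ) - (j : ℤ) : ℤ) * ((q : ℕ) * (Real.pi / 2)) := by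
      rw [hg']; simp [Osc.shift]; ring
    have hdvd := (Osc.mem_lattice_mul_iff ht hg.2).1 hg
    have h0 := Int.eq_zero_of_abs_lt_dvd hdvd (by
      have := i.2; have := j.2; rw [abs_lt]; omega)
    exact Fin.ext (by omega)
  have himg : P ⁻¹' {Solv.proj q k p} = Set.range F := by
    ext m
    constructor
    · intro hm
      obtain ⟨p', rfl⟩ := Solv.proj_surjective (q * n) k m
      obtain ⟨g, hg, rfl⟩ := Solv.proj_eq_iff.1 (show Solv.proj q k p' = Solv.proj q k p from hm)
      obtain ⟨l, hl⟩ := hg.1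
      have hn : (0 : ℤ) < (n : ℕ) := by exact_mod_cast n.pos
      refine ⟨⟨(l % (n : ℕ)).toNat, by
        have := Int.emod_lt_of_pos l hn; have := Int.emod_nonneg l hn.ne'; omega⟩, ?_⟩
      set j := (l % (n : ℕ)).toNat with hj
      have hj' : (j : ℤ) = l % (n : ℕ) := Int.toNat_of_nonneg (Int.emod_nonneg l hn.ne')
      refine Solv.proj_eq_iff.2 ⟨Osc.shift (j * q) * g⁻¹, ?_, by
        rw [mul_assoc, inv_mul_cancel_left]⟩
      refine (Osc.mem_lattice_mul_iff (l := (j : ℤ) - l) ?_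
        (mul_mem (Osc.shift_mem_lattice q k j) (inv_mem hg)).2).2 ?_
      · simp only [Osc.mul_t, Osc.inv_t, hl, Osc.shift, Osc.mk_t]; push_cast; ring
      · rw [hj']
        exact ⟨-(l / (n : ℕ)), by linear_combination Int.emod_add_mul_ediv l (n : ℕ)⟩
    · rintro ⟨j, rfl⟩
      exact Solv.proj_mul (Osc.shift_mem_lattice q k j) p
  rw [himg, ← Set.image_univ, Set.ncard_image_of_injective _ hinj, Set.ncard_univ, Nat.card_fin]

end Coverings

/-! ### Forms on the quotients as periodic forms on ℝ⁴. -/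

section Lifts

/-- The linear part of the left translation by `(t, x, y, z)`, where `c = cos t` and `s = sin t`
for the oscillator group, `c = 1` and `s = 0` for `ℝ × H₃(ℝ)`. -/
def translationLin (c s x y : ℝ) : R4 →L[ℝ] R4 :=
  LinearMap.toContinuousLinearMap
    { toFun := fun u => (u.1, c * u.2.1 + s * u.2.2.1, -s * u.2.1 + c * u.2.2.1,
        u.2.2.2 + (x * (-s * u.2.1 + c * u.2.2.1) - (c * u.2.1 + s * u.2.2.1) * y) / 2)
      map_add' := fun u w => by ext <;> simp <;> ring
      map_smul' := fun r u => by ext <;> simp <;> ring }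

@[simp] theorem translationLin_apply (c s x y : ℝ) (u : R4) :
    translationLin c s x y u = (u.1, c * u.2.1 + s * u.2.2.1, -s * u.2.1 + c * u.2.2.1,
        u.2.2.2 + (x * (-s * u.2.1 + c * u.2.2.1) - (c * u.2.1 + s * u.2.2.1) * y) / 2) := rfl

/-- The differential of the left translation by `g` in the oscillator group. -/
def Osc.lin (g : Osc) : R4 →L[ℝ] R4 := translationLin (Real.cos g.t) (Real.sin g.t) g.v.x g.v.y

/-- The differential of the left translation by `g` in `ℝ × H₃(ℝ)`. -/
def Nil.lin (g : Nil) : R4 →L[ℝ] R4 := translationLin 1 0 g.v.x g.v.y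

/-- The left translation by an element of the oscillator group, as a self-map of `ℝ⁴`. -/
def Osc.act (g : Osc) (p : R4) : R4 := @HMul.hMul Osc Osc Osc instHMul g p

/-- The left translation by an element of `ℝ × H₃(ℝ)`, as a self-map of `ℝ⁴`. -/
def Nil.act (g : Nil) (p : R4) : R4 := @HMul.hMul Nil Nil Nil instHMul g p

/-- The coordinates of an element of the oscillator group. -/
def Osc.coord (g : Osc) : R4 := g

/-- The coordinates of an element of `ℝ × H₃(ℝ)`. -/
def Nil.coord (g : Nil) : R4 := g

theorem Osc.act_eq (g : Osc) (p : R4) : g.act p = g.lin p + g.coord := by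
  obtain ⟨t, x, y, z⟩ := g
  obtain ⟨t', x', y', z'⟩ := p
  refine Prod.ext ?_ (Prod.ext ?_ (Prod.ext ?_ ?_))
  · exact add_comm _ _
  · exact add_comm _ _
  · exact add_comm _ _
  · change z + z' + _ = (z' + _) + z
    rw [add_comm z z', add_right_comm]; rfl

theorem Nil.act_eq (g : Nil) (p : R4) : g.act p = g.lin p + g.coord := by
  obtain ⟨t, x, y, z⟩ := g
  obtain ⟨t', x', y', z'⟩ := p
  refine Prod.ext ?_ (Prod.ext ?_ (Prod.ext ?_ ?_))
  · exact add_comm _ _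
  · change x + x' = (1 * x' + 0 * y') + x; ring
  · change y + y' = (-0 * x' + 1 * y') + y; ring
  · change z + z' + (x * y' - x' * y) / 2 =
      (z' + (x * (-0 * x' + 1 * y') - (1 * x' + 0 * y') * y) / 2) + z
    ring

theorem Osc.act_mul (g h : Osc) (p : R4) : (g * h).act p = g.act (h.act p) := mul_assoc g h p

theorem Osc.hasFDerivAt_act (g : Osc) (p : R4) : HasFDerivAt g.act g.lin p := by
  rw [funext g.act_eq]
  exact g.lin.hasFDerivAt.add_const g.coord

theorem Nil.hasFDerivAt_act (g : Nil) (p : R4) : HasFDerivAt g.act g.lin p := by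
  rw [funext g.act_eq]
  exact g.lin.hasFDerivAt.add_const g.coord

theorem Osc.contDiff_act (g : Osc) : ContDiff ℝ ∞ g.act := by
  rw [funext g.act_eq]
  exact g.lin.contDiff.add contDiff_const

theorem Osc.hasMFDerivAt_mul_left (g p : Osc) :
    HasMFDerivAt 𝓘(ℝ, R4) 𝓘(ℝ, R4) (fun h : Osc => g * h) p g.lin :=
  (Osc.hasFDerivAt_act g p).hasMFDerivAt

theorem Nil.hasMFDerivAt_mul_left (g p : Nil) :
    HasMFDerivAt 𝓘(ℝ, R4) 𝓘(ℝ, R4) (fun h : Nil => g * h) p g.lin :=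
  (Nil.hasFDerivAt_act g p).hasMFDerivAt

variable {n : ℕ} {q k : ℕ+}

/-- A differential form on the vector space `ℝ⁴`. -/
abbrev FormR4 (n : ℕ) : Type := R4 → R4 [⋀^Fin n]→L[ℝ] ℝ

/-- The pull-back of a form on `ℝ⁴` by a left translation of the oscillator group. -/
def FormR4.translate (g : Osc) (ξ : FormR4 n) : FormR4 n :=
  fun p => (ξ (g.act p)).compContinuousLinearMap g.lin

theorem FormR4.translate_eq_pullback (g : Osc) (ξ : FormR4 n) :
    ξ.translate g = DForm.pullback (E := R4) (M := Osc) (N := Osc) (fun h : Osc => g * h) ξ := by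
  funext p
  unfold DForm.pullback
  rw [(Osc.hasMFDerivAt_mul_left g p).mfderiv]
  rfl

theorem Osc.lin_mul (g h : Osc) : (g * h).lin = g.lin ∘L h.lin := by
  have h1 := Osc.hasFDerivAt_act (g * h) 0
  rw [show (g * h).act = g.act ∘ h.act from funext (Osc.act_mul g h)] at h1
  exact h1.unique ((g.hasFDerivAt_act _).comp 0 (h.hasFDerivAt_act 0))

theorem FormR4.translate_mul (g h : Osc) (ξ : FormR4 n) :
    ξ.translate (g * h) = (ξ.translate g).translate h := by
  funext p
  unfold FormR4.translate
  rw [Osc.lin_mul, Osc.act_mul]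
  rfl

theorem FormR4.translate_add (g : Osc) (ξ η : FormR4 n) :
    (ξ + η).translate g = ξ.translate g + η.translate g := rfl

theorem FormR4.translate_smul (g : Osc) (r : ℝ) (ξ : FormR4 n) :
    (r • ξ).translate g = r • ξ.translate g := rfl

theorem FormR4.contDiff_translate (g : Osc) {ξ : FormR4 n} (hξ : ContDiff ℝ ∞ ξ) :
    ContDiff ℝ ∞ (ξ.translate g) :=
  (ContinuousAlternatingMap.compContinuousLinearMapCLM (F := ℝ) (ι := Fin n) g.lin).contDiff.comp
    (hξ.comp g.contDiff_act)

theorem FormR4.contDiffAt_translate (g : Osc) {ξ : FormR4 n} {p : R4}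
    (hξ : ContDiffAt ℝ ∞ ξ (g.act p)) :
    ContDiffAt ℝ ∞ (ξ.translate g) p :=
  (ContinuousAlternatingMap.compContinuousLinearMapCLM (F := ℝ) (ι := Fin n)
    g.lin).contDiff.contDiffAt.comp p
    (ContDiffAt.comp p hξ g.contDiff_act.contDiffAt)

theorem FormR4.extDeriv_translate (g : Osc) {ξ : FormR4 n} (hξ : Differentiable ℝ ξ) :
    extDeriv (ξ.translate g) = FormR4.translate g (extDeriv ξ) := by
  funext p
  have h := extDeriv_pullback (x := p)
    (f := g.act) (r := ∞) (hξ _)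
    g.contDiff_act.contDiffAt (by
      rw [minSmoothness_of_isRCLikeNormedField]
      exact WithTop.coe_le_coe.2 (le_top : (2 : ℕ∞) ≤ ⊤))
  simp only [fun p => (Osc.hasFDerivAt_act g p).fderiv] at h
  exact h

/-- A form on `ℝ⁴` is invariant under the lattice `(qπ/2)ℤ ⋉ Γ_k`. -/
def FormR4.IsPeriodic (q k : ℕ+) (ξ : FormR4 n) : Prop :=
  ∀ g ∈ Osc.lattice q k, ξ.translate g = ξ

/-- The lift to `ℝ⁴` of a form on a quotient of the oscillator group. -/
def Solv.lift (σ : DForm R4 n (Solv q k)) : FormR4 n :=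
  DForm.pullback (M := Osc) (Solv.proj q k) σ

/-- The value of a form at a point of a manifold modelled on `ℝ⁴`, as a form on `ℝ⁴`. -/
def DForm.eval {M : Type*} [TopologicalSpace M] [ChartedSpace R4 M] (σ : DForm R4 n M) (m : M) :
    R4 [⋀^Fin n]→L[ℝ] ℝ := σ m

/-- The differential of the projection onto a quotient of the oscillator group. -/
def Solv.projDeriv (q k : ℕ+) (p : R4) : R4 →L[ℝ] R4 :=
  mfderiv 𝓘(ℝ, R4) 𝓘(ℝ, R4) (Solv.proj q k) p

theorem Solv.lift_apply (σ : DForm R4 n (Solv q k)) (p : R4) :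
    Solv.lift σ p =
      (σ.eval (Solv.proj q k p)).compContinuousLinearMap (Solv.projDeriv q k p) := rfl

/-- The chart of G is the identity of ℝ⁴, so nothing but the projection remains of the inverse
chart, whatever m is. -/
theorem Solv.chartAt_symm (m : Solv q k) : ⇑(chartAt R4 m).symm = Solv.proj q k := by
  obtain ⟨s, a, hs, hc⟩ := exists_chartAt_quotient (E := R4) m
  rw [hc, OpenPartialHomeomorph.coe_trans_symm, hs]
  rfl

/-- All local expressions of σ are one globally defined form on ℝ⁴; this is what reduces smoothness
and d on the quotient to calculus on ℝ⁴. -/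
theorem Solv.inChart_eq_lift (σ : DForm R4 n (Solv q k)) (m : Solv q k) :
    σ.inChart m = Solv.lift σ := by
  unfold DForm.inChart
  rw [Solv.chartAt_symm]
  rfl

/-- The preferred chart at `m` is, along the projection, a translation by the lattice. -/
theorem Solv.chartAt_proj_eventuallyEq (p : Osc) :
    ∃ g ∈ Osc.lattice q k, ∀ᶠ p' in nhds p,
      chartAt R4 (Solv.proj q k p) (Solv.proj q k p') = Osc.act g p' := by
  obtain ⟨s, a, hs, hc⟩ := exists_chartAt_quotient (E := R4) (Solv.proj q k p)
  have hmem := mem_chart_source R4 (Solv.proj q k p)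
  rw [hc, OpenPartialHomeomorph.trans_source] at hmem
  obtain ⟨⟨g, hg⟩, h⟩ := section_quotient_eventuallyEq hs (p := p) hmem.1
  refine ⟨g, hg, ?_⟩
  filter_upwards [h] with p' hp'
  rw [hc]
  exact hp'

theorem Solv.mdifferentiable_proj : MDifferentiable 𝓘(ℝ, R4) 𝓘(ℝ, R4) (Solv.proj q k) :=
  (Solv.isLocalDiffeomorph_proj q k).mdifferentiable (by simp)

theorem Solv.mfderiv_chartAt_comp {p g : Osc}
    (h : ∀ᶠ p' in nhds p,
      chartAt R4 (Solv.proj q k p) (Solv.proj q k p') = Osc.act g p') :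
    (mfderiv 𝓘(ℝ, R4) 𝓘(ℝ, R4) (chartAt R4 (Solv.proj q k p)) (Solv.proj q k p)).comp
      (mfderiv 𝓘(ℝ, R4) 𝓘(ℝ, R4) (Solv.proj q k) p) = g.lin := by
  have h1 : MDifferentiableAt 𝓘(ℝ, R4) 𝓘(ℝ, R4) (chartAt R4 (Solv.proj q k p))
      (Solv.proj q k p) :=
    mdifferentiableAt_atlas (chart_mem_atlas R4 _) (mem_chart_source R4 _)
  rw [← mfderiv_comp p h1 (Solv.mdifferentiable_proj p)]
  have h2 : (chartAt R4 (Solv.proj q k p) ∘ Solv.proj q k) =ᶠ[nhds p]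
      (fun p' : Osc => Osc.act g p') := h
  rw [h2.mfderiv_eq]
  exact (Osc.hasMFDerivAt_mul_left g p).mfderiv

theorem Solv.lift_isPeriodic (σ : DForm R4 n (Solv q k)) : (Solv.lift σ).IsPeriodic q k := by
  intro g hg
  funext p
  have h : Solv.proj q k = Solv.proj q k ∘ (fun h : Osc => g * h) :=
    funext fun p => (Solv.proj_mul hg p).symm
  have h1 : Solv.projDeriv q k p = (Solv.projDeriv q k (g.act p)).comp g.lin := by
    unfold Solv.projDeriv
    conv_lhs => rw [h]
    exact ((Solv.mdifferentiable_proj (g.act p : Osc)).hasMFDerivAt.comp (show Osc from p)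
      (Osc.hasMFDerivAt_mul_left g p)).mfderiv
  have h2 : σ.eval (Solv.proj q k (g.act p)) = σ.eval (Solv.proj q k p) :=
    congrArg σ.eval (Solv.proj_mul hg p)
  rw [FormR4.translate, Solv.lift_apply, Solv.lift_apply, h1, h2]
  rfl

/-- The differential of the projection is invertible. -/
theorem Solv.exists_equiv_projDeriv (p : R4) : ∃ e : R4 ≃L[ℝ] R4,
    Solv.projDeriv q k p = e :=
  ⟨(Solv.isLocalDiffeomorph_proj q k p).mfderivToContinuousLinearEquiv (by simp), rfl⟩

/-- The projection is onto and its differential is invertible everywhere, so the pull-back loses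
nothing. -/
theorem Solv.lift_injective : Function.Injective (Solv.lift (n := n) (q := q) (k := k)) := by
  intro σ σ' h
  funext m
  obtain ⟨p, rfl⟩ : ∃ p : R4, Solv.proj q k p = m := Solv.proj_surjective q k m
  obtain ⟨e, he⟩ := Solv.exists_equiv_projDeriv (q := q) (k := k) p
  have h1 := congrFun h p
  rw [Solv.lift_apply, Solv.lift_apply, he] at h1
  change σ.eval _ = σ'.eval _
  ext v
  have h2 := DFunLike.congr_fun h1 (fun i => e.symm (v i))
  simpa [Function.comp_def] using h2

/-- The forms on `ℝ⁴` that are invariant under the lattice descend to the quotient. -/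
theorem Solv.exists_lift_eq {ξ : FormR4 n} (hξ : FormR4.IsPeriodic q k ξ) :
    ∃ σ : DForm R4 n (Solv q k), Solv.lift σ = ξ := by
  -- Only the preferred chart at m is used. Its composition with the projection is, near a given p
  -- over m, a translation by the lattice, which ξ does not see.
  let σ : DForm R4 n (Solv q k) := fun m => (ξ (chartAt R4 m m)).compContinuousLinearMap
    (mfderiv 𝓘(ℝ, R4) 𝓘(ℝ, R4) (chartAt R4 m) m)
  refine ⟨σ, ?_⟩
  funext p
  obtain ⟨g, hg, h⟩ := Solv.chartAt_proj_eventuallyEq (q := q) (k := k) p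
  have h1 := Solv.mfderiv_chartAt_comp h
  have h2 : chartAt R4 (Solv.proj q k p) (Solv.proj q k p) = g.act p := h.self_of_nhds
  conv_rhs => rw [← hξ g hg]
  unfold FormR4.translate
  rw [← h1, ← h2]
  rfl

/-- The chart gives smoothness at some lattice translate of p only; periodicity of the lift carries
it back to p. -/
theorem Solv.contDiff_lift {σ : DForm R4 n (Solv q k)} (hσ : σ.IsSmooth) :
    ContDiff ℝ ∞ (Solv.lift σ) := by
  refine contDiff_iff_contDiffAt.2 fun p => ?_
  obtain ⟨g, hg, h⟩ := Solv.chartAt_proj_eventuallyEq (q := q) (k := k) p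
  have h2 : chartAt R4 (Solv.proj q k p) (Solv.proj q k p) = g.act p := h.self_of_nhds
  have h3 := hσ (Solv.proj q k p)
  rw [Solv.inChart_eq_lift] at h3
  have h4 := h3.contDiffAt ((chartAt R4 (Solv.proj q k p)).open_target.mem_nhds
    (mem_chart_target R4 (Solv.proj q k p)))
  rw [h2] at h4
  rw [← Solv.lift_isPeriodic σ g hg]
  exact FormR4.contDiffAt_translate g h4

theorem Solv.isSmooth_of_contDiff_lift {σ : DForm R4 n (Solv q k)}
    (hσ : ContDiff ℝ ∞ (Solv.lift σ)) : σ.IsSmooth := by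
  intro m
  rw [Solv.inChart_eq_lift]
  exact hσ.contDiffOn

/-- The chart computes the derivative at a lattice translate of p; `extDeriv` commutes with
translations and the lift is periodic, so the value at p comes out. -/
theorem Solv.lift_d {σ : DForm R4 n (Solv q k)} (hσ : ContDiff ℝ ∞ (Solv.lift σ)) :
    Solv.lift σ.d = extDeriv (Solv.lift σ) := by
  funext p
  obtain ⟨g, hg, h⟩ := Solv.chartAt_proj_eventuallyEq (q := q) (k := k) p
  have h1 := Solv.mfderiv_chartAt_comp h
  have h2 : chartAt R4 (Solv.proj q k p) (Solv.proj q k p) = g.act p := h.self_of_nhds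
  have h3 : Solv.lift σ.d p = FormR4.translate g (extDeriv (Solv.lift σ)) p := by
    unfold FormR4.translate
    rw [← h1, ← h2, ← Solv.inChart_eq_lift σ (Solv.proj q k p)]
    rfl
  rw [h3, ← FormR4.extDeriv_translate g (hσ.differentiable (by simp)),
    Solv.lift_isPeriodic σ g hg]

theorem Solv.lift_nondegenerate {σ : DForm R4 2 (Solv q k)} :
    (∀ (x : Solv q k) (v : TangentSpace 𝓘(ℝ, R4) x),
      (∀ w : TangentSpace 𝓘(ℝ, R4) x, σ x ![v, w] = 0) → v = 0) ↔
    ∀ p v : R4, (∀ w : R4, Solv.lift σ p ![v, w] = 0) → v = 0 := by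
  have key : ∀ (p : R4) (e : R4 ≃L[ℝ] R4), Solv.projDeriv q k p = e → ∀ v w : R4,
      Solv.lift σ p ![v, w] = σ.eval (Solv.proj q k p) ![e v, e w] := by
    intro p e he v w
    rw [Solv.lift_apply, he, ContinuousAlternatingMap.compContinuousLinearMap_apply]
    congr 1
    funext i
    fin_cases i <;> rfl
  constructor
  · intro h p v hv
    obtain ⟨e, he⟩ := Solv.exists_equiv_projDeriv (q := q) (k := k) p
    refine e.map_eq_zero_iff.1 (h (Solv.proj q k p) (e v) fun w => ?_)
    have h1 := hv (e.symm w)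
    rw [key p e he, e.apply_symm_apply w] at h1
    exact h1
  · intro h m v hv
    obtain ⟨p, rfl⟩ := Solv.proj_surjective q k m
    obtain ⟨e, he⟩ := Solv.exists_equiv_projDeriv (q := q) (k := k) p
    refine e.symm.map_eq_zero_iff.1 (h p (e.symm v) fun w => ?_)
    rw [key p e he, e.apply_symm_apply v]
    exact hv (e w)

end Lifts

/-! ### Cartan's formulas and the frame T, X, Y, Z. -/

section Frame

open VectorField

section ExtDeriv

variable {E F : Type*} [NormedAddCommGroup E] [NormedSpace ℝ E]
  [NormedAddCommGroup F] [NormedSpace ℝ F]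

/-- Cartan's formula for the exterior derivative of a `2`-form. -/
theorem extDeriv_two_apply_vectorField {ξ : E → E [⋀^Fin 2]→L[ℝ] F} {A B C : E → E} {x : E}
    (hξ : DifferentiableAt ℝ ξ x) (hA : DifferentiableAt ℝ A x) (hB : DifferentiableAt ℝ B x)
    (hC : DifferentiableAt ℝ C x) :
    extDeriv ξ x ![A x, B x, C x] =
      fderiv ℝ (fun p => ξ p ![B p, C p]) x (A x) - fderiv ℝ (fun p => ξ p ![A p, C p]) x (B x)
        + fderiv ℝ (fun p => ξ p ![A p, B p]) x (C x) - ξ x ![lieBracket ℝ A B x, C x]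
        + ξ x ![lieBracket ℝ A C x, B x] - ξ x ![lieBracket ℝ B C x, A x] := by
  have h := extDeriv_apply_vectorField (V := ![A, B, C]) hξ (by
    intro i; fin_cases i <;> assumption)
  have e0 : ∀ p, (fun i => (![A, B, C] : Fin 3 → E → E) i p) = ![A p, B p, C p] := by
    intro p; funext i; fin_cases i <;> rfl
  simp only [e0] at h
  rw [h]
  have r0 : ∀ a b c : E, (0 : Fin 3).removeNth ![a, b, c] = ![b, c] := by
    intro a b c; funext i; fin_cases i <;> rfl
  have r1 : ∀ a b c : E, (1 : Fin 3).removeNth ![a, b, c] = ![a, c] := by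
    intro a b c; funext i; fin_cases i <;> rfl
  have r2 : ∀ a b c : E, (2 : Fin 3).removeNth ![a, b, c] = ![a, b] := by
    intro a b c; funext i; fin_cases i <;> rfl
  have s0 : ∀ a b : E, (0 : Fin 2).removeNth ![a, b] = ![b] := by
    intro a b; funext i; fin_cases i; rfl
  have s1 : ∀ a b : E, (1 : Fin 2).removeNth ![a, b] = ![a] := by
    intro a b; funext i; fin_cases i; rfl
  have t1 : Finset.Ici (1 : Fin 2) = {1} := by decide
  rw [Fin.sum_univ_three, Fin.sum_univ_two]
  simp [r0, r1, r2, s0, s1, Fin.sum_univ_two, t1]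
  abel

/-- Cartan's formula for the exterior derivative of a `1`-form. -/
theorem extDeriv_one_apply_vectorField {η : E → E [⋀^Fin 1]→L[ℝ] F} {A B : E → E} {x : E}
    (hη : DifferentiableAt ℝ η x) (hA : DifferentiableAt ℝ A x) (hB : DifferentiableAt ℝ B x) :
    extDeriv η x ![A x, B x] =
      fderiv ℝ (fun p => η p ![B p]) x (A x) - fderiv ℝ (fun p => η p ![A p]) x (B x)
        - η x ![lieBracket ℝ A B x] := by
  have h := extDeriv_apply_vectorField (V := ![A, B]) hη (by
    intro i; fin_cases i <;> assumption)
  have e0 : ∀ p, (fun i => (![A, B] : Fin 2 → E → E) i p) = ![A p, B p] := by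
    intro p; funext i; fin_cases i <;> rfl
  simp only [e0] at h
  rw [h]
  have s0 : ∀ a b : E, (0 : Fin 2).removeNth ![a, b] = ![b] := by
    intro a b; funext i; fin_cases i; rfl
  have s1 : ∀ a b : E, (1 : Fin 2).removeNth ![a, b] = ![a] := by
    intro a b; funext i; fin_cases i; rfl
  have s2 : ∀ a : E, (0 : Fin 1).removeNth ![a] = ![] := by
    intro a; funext i; exact i.elim0
  rw [Fin.sum_univ_two]
  simp [s0, s1, s2]
  abel

end ExtDeriv

/-- The invariant vector field `∂/∂t`. -/
def fieldT (_ : R4) : R4 := (1, 0, 0, 0)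

/-- The vector field `∂/∂x - (y/2) ∂/∂z`, left-invariant on `ℝ × H₃(ℝ)`. -/
def fieldX (p : R4) : R4 := (0, 1, 0, -p.2.2.1 / 2)

/-- The vector field `∂/∂y + (x/2) ∂/∂z`, left-invariant on `ℝ × H₃(ℝ)`. -/
def fieldY (p : R4) : R4 := (0, 0, 1, p.2.1 / 2)

/-- The invariant vector field `∂/∂z`. -/
def fieldZ (_ : R4) : R4 := (0, 0, 0, 1)

/-- The coordinate `dz - (x dy - y dx)/2` of a tangent vector at `p`. -/
def formGamma (p u : R4) : ℝ := u.2.2.2 - (p.2.1 * u.2.2.1 - p.2.2.1 * u.2.1) / 2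

theorem eq_frame_combination (p u : R4) :
    u = u.1 • fieldT p + u.2.1 • fieldX p + u.2.2.1 • fieldY p + formGamma p u • fieldZ p := by
  ext <;> simp [fieldT, fieldX, fieldY, fieldZ, formGamma]
  ring

/-- The coordinate form `dt`. -/
def coordT : R4 →L[ℝ] ℝ := ContinuousLinearMap.fst ℝ ℝ (ℝ × ℝ × ℝ)

/-- The coordinate form `dx`. -/
def coordX : R4 →L[ℝ] ℝ :=
  ContinuousLinearMap.fst ℝ ℝ (ℝ × ℝ) ∘L ContinuousLinearMap.snd ℝ ℝ (ℝ × ℝ × ℝ)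

/-- The coordinate form `dy`. -/
def coordY : R4 →L[ℝ] ℝ :=
  ContinuousLinearMap.fst ℝ ℝ ℝ ∘L ContinuousLinearMap.snd ℝ ℝ (ℝ × ℝ) ∘L
    ContinuousLinearMap.snd ℝ ℝ (ℝ × ℝ × ℝ)

/-- The coordinate form `dz`. -/
def coordZ : R4 →L[ℝ] ℝ :=
  ContinuousLinearMap.snd ℝ ℝ ℝ ∘L ContinuousLinearMap.snd ℝ ℝ (ℝ × ℝ) ∘L
    ContinuousLinearMap.snd ℝ ℝ (ℝ × ℝ × ℝ)

@[simp] theorem coordT_apply (u : R4) : coordT u = u.1 := rfl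
@[simp] theorem coordX_apply (u : R4) : coordX u = u.2.1 := rfl
@[simp] theorem coordY_apply (u : R4) : coordY u = u.2.2.1 := rfl
@[simp] theorem coordZ_apply (u : R4) : coordZ u = u.2.2.2 := rfl

theorem hasFDerivAt_fieldX (p : R4) :
    HasFDerivAt fieldX (coordY.smulRight ((0, 0, 0, -1 / 2) : R4)) p := by
  have h : fieldX = fun p => coordY.smulRight ((0, 0, 0, -1 / 2) : R4) p + (0, 1, 0, 0) := by
    funext p; ext <;> simp [fieldX]; ring
  rw [h]
  exact (ContinuousLinearMap.hasFDerivAt (coordY.smulRight ((0, 0, 0, -1 / 2) : R4))).add_const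
    ((0, 1, 0, 0) : R4)

theorem hasFDerivAt_fieldY (p : R4) :
    HasFDerivAt fieldY (coordX.smulRight ((0, 0, 0, 1 / 2) : R4)) p := by
  have h : fieldY = fun p => coordX.smulRight ((0, 0, 0, 1 / 2) : R4) p + (0, 0, 1, 0) := by
    funext p; ext <;> simp [fieldY]; ring
  rw [h]
  exact (ContinuousLinearMap.hasFDerivAt (coordX.smulRight ((0, 0, 0, 1 / 2) : R4))).add_const
    ((0, 0, 1, 0) : R4)

theorem hasFDerivAt_fieldT (p : R4) : HasFDerivAt fieldT (0 : R4 →L[ℝ] R4) p :=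
  hasFDerivAt_const _ _

theorem hasFDerivAt_fieldZ (p : R4) : HasFDerivAt fieldZ (0 : R4 →L[ℝ] R4) p :=
  hasFDerivAt_const _ _

/-- The only nonzero bracket of the frame. It yields the undifferentiated summands in
`FormR4.coeff_equations` and `FormR4.coeff_extDeriv_ofCoeff`, that is, dγ = -α∧β. -/
theorem lieBracket_fieldX_fieldY (p : R4) : lieBracket ℝ fieldX fieldY p = fieldZ p := by
  rw [lieBracket, (hasFDerivAt_fieldX p).fderiv, (hasFDerivAt_fieldY p).fderiv]
  ext <;> simp [fieldX, fieldY, fieldZ]; norm_num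

theorem lieBracket_fieldT_fieldX (p : R4) : lieBracket ℝ fieldT fieldX p = 0 := by
  rw [lieBracket, (hasFDerivAt_fieldX p).fderiv, (hasFDerivAt_fieldT p).fderiv]
  ext <;> simp [fieldT]

theorem lieBracket_fieldT_fieldY (p : R4) : lieBracket ℝ fieldT fieldY p = 0 := by
  rw [lieBracket, (hasFDerivAt_fieldY p).fderiv, (hasFDerivAt_fieldT p).fderiv]
  ext <;> simp [fieldT]

theorem lieBracket_fieldT_fieldZ (p : R4) : lieBracket ℝ fieldT fieldZ p = 0 := by
  rw [lieBracket, (hasFDerivAt_fieldZ p).fderiv, (hasFDerivAt_fieldT p).fderiv]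
  simp

theorem lieBracket_fieldX_fieldZ (p : R4) : lieBracket ℝ fieldX fieldZ p = 0 := by
  rw [lieBracket, (hasFDerivAt_fieldZ p).fderiv, (hasFDerivAt_fieldX p).fderiv]
  ext <;> simp [fieldZ]

theorem lieBracket_fieldY_fieldZ (p : R4) : lieBracket ℝ fieldY fieldZ p = 0 := by
  rw [lieBracket, (hasFDerivAt_fieldZ p).fderiv, (hasFDerivAt_fieldY p).fderiv]
  ext <;> simp [fieldZ]

/-- The derivative of a function along a vector field. -/
def derivAlong (U : R4 → R4) (f : R4 → ℝ) : R4 → ℝ := fun p => fderiv ℝ f p (U p)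

/-- The function `p ↦ ξ_p (U_p, W_p)`. -/
def FormR4.coeff (ξ : FormR4 2) (U W : R4 → R4) : R4 → ℝ := fun p => ξ p ![U p, W p]

theorem contDiff_fieldT : ContDiff ℝ ∞ fieldT := contDiff_const

theorem contDiff_fieldZ : ContDiff ℝ ∞ fieldZ := contDiff_const

theorem contDiff_fieldX : ContDiff ℝ ∞ fieldX := by unfold fieldX; fun_prop

theorem contDiff_fieldY : ContDiff ℝ ∞ fieldY := by unfold fieldY; fun_prop

theorem ContDiff.derivAlong {f : R4 → ℝ} (hf : ContDiff ℝ ∞ f) {U : R4 → R4}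
    (hU : ContDiff ℝ ∞ U) : ContDiff ℝ ∞ (derivAlong U f) :=
  (hf.fderiv_right (m := ∞) (by simp)).clm_apply hU

/-- Symmetry of the second derivative of f cancels the second-order terms. -/
theorem derivAlong_derivAlong_sub {f : R4 → ℝ} (hf : ContDiff ℝ ∞ f) {U W : R4 → R4}
    (hU : ContDiff ℝ ∞ U) (hW : ContDiff ℝ ∞ W) :
    derivAlong U (derivAlong W f) - derivAlong W (derivAlong U f) =
      derivAlong (lieBracket ℝ U W) f := by
  funext p
  refine (fderiv_apply_lieBracket (n := ∞) hf.contDiffAt ?_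
    (hW.differentiable (by simp) p) (hU.differentiable (by simp) p)).symm
  rw [minSmoothness_of_isRCLikeNormedField]
  exact WithTop.coe_le_coe.2 (le_top : (2 : ℕ∞) ≤ ⊤)

end Frame

/-! ### Coefficients of forms in the frame, closedness and translations. -/

section Coefficients

open VectorField

section Alternating

variable {E : Type*} [NormedAddCommGroup E] [NormedSpace ℝ E] (θ : E [⋀^Fin 2]→L[ℝ] ℝ)

theorem alternating_two_self (u : E) : θ ![u, u] = 0 :=
  θ.map_eq_zero_of_eq ![u, u] (i := 0) (j := 1) rfl (by decide)

theorem alternating_two_add_left (u u' w : E) : θ ![u + u', w] = θ ![u, w] + θ ![u', w] :=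
  θ.toMultilinearMap.cons_add ![w] u u'

theorem alternating_two_smul_left (r : ℝ) (u w : E) : θ ![r • u, w] = r * θ ![u, w] :=
  θ.toMultilinearMap.cons_smul ![w] r u

theorem alternating_two_swap (u w : E) : θ ![w, u] = -θ ![u, w] := by
  have h := alternating_two_self θ (u + w)
  have h2 : ∀ a b c : E, θ ![a, b + c] = θ ![a, b] + θ ![a, c] := by
    intro a b c
    have := θ.toMultilinearMap.map_update_add ![a, 0] 1 b c
    have e : ∀ d : E, Function.update ![a, (0 : E)] 1 d = ![a, d] := by
      intro d; funext i; fin_cases i <;> rfl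
    rw [e, e, e] at this
    exact this
  rw [alternating_two_add_left, h2, h2, alternating_two_self, alternating_two_self] at h
  linarith

theorem alternating_two_add_right (u w w' : E) : θ ![u, w + w'] = θ ![u, w] + θ ![u, w'] := by
  rw [alternating_two_swap, alternating_two_add_left, alternating_two_swap θ u w,
    alternating_two_swap θ u w']; ring

theorem alternating_two_smul_right (r : ℝ) (u w : E) : θ ![u, r • w] = r * θ ![u, w] := by
  rw [alternating_two_swap, alternating_two_smul_left, alternating_two_swap θ u w]; ring

theorem alternating_two_zero_left (w : E) : θ ![0, w] = 0 := by
  simpa using alternating_two_smul_left θ 0 0 w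

end Alternating

/-- The expression of a `2`-form in the frame `∂t, X, Y, Z`. -/
theorem alternating_two_apply_frame (θ : R4 [⋀^Fin 2]→L[ℝ] ℝ) (p u w : R4) :
    θ ![u, w] = θ ![fieldT p, fieldX p] * (u.1 * w.2.1 - w.1 * u.2.1)
      + θ ![fieldT p, fieldY p] * (u.1 * w.2.2.1 - w.1 * u.2.2.1)
      + θ ![fieldT p, fieldZ p] * (u.1 * formGamma p w - w.1 * formGamma p u)
      + θ ![fieldX p, fieldY p] * (u.2.1 * w.2.2.1 - w.2.1 * u.2.2.1)
      + θ ![fieldX p, fieldZ p] * (u.2.1 * formGamma p w - w.2.1 * formGamma p u)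
      + θ ![fieldY p, fieldZ p] * (u.2.2.1 * formGamma p w - w.2.2.1 * formGamma p u) := by
  conv_lhs => rw [eq_frame_combination p u, eq_frame_combination p w]
  simp only [alternating_two_add_left, alternating_two_add_right, alternating_two_smul_left,
    alternating_two_smul_right, alternating_two_self]
  rw [alternating_two_swap θ (fieldT p) (fieldX p), alternating_two_swap θ (fieldT p) (fieldY p),
    alternating_two_swap θ (fieldT p) (fieldZ p), alternating_two_swap θ (fieldX p) (fieldY p),
    alternating_two_swap θ (fieldX p) (fieldZ p), alternating_two_swap θ (fieldY p) (fieldZ p)]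
  ring

/-- Two `2`-forms with the same coefficients in the frame `∂t, X, Y, Z` are equal. -/
theorem FormR4.ext_coeff {ξ ζ : FormR4 2} (hTX : ξ.coeff fieldT fieldX = ζ.coeff fieldT fieldX)
    (hTY : ξ.coeff fieldT fieldY = ζ.coeff fieldT fieldY)
    (hTZ : ξ.coeff fieldT fieldZ = ζ.coeff fieldT fieldZ)
    (hXY : ξ.coeff fieldX fieldY = ζ.coeff fieldX fieldY)
    (hXZ : ξ.coeff fieldX fieldZ = ζ.coeff fieldX fieldZ)
    (hYZ : ξ.coeff fieldY fieldZ = ζ.coeff fieldY fieldZ) : ξ = ζ := by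
  funext p
  ext v
  have e : v = ![v 0, v 1] := by funext i; fin_cases i <;> rfl
  rw [e, alternating_two_apply_frame (ξ p) p, alternating_two_apply_frame (ζ p) p]
  have h1 := congrFun hTX p
  have h2 := congrFun hTY p
  have h3 := congrFun hTZ p
  have h4 := congrFun hXY p
  have h5 := congrFun hXZ p
  have h6 := congrFun hYZ p
  simp only [FormR4.coeff] at h1 h2 h3 h4 h5 h6
  rw [h1, h2, h3, h4, h5, h6]

theorem FormR4.contDiff_coeff {ξ : FormR4 2} (hξ : ContDiff ℝ ∞ ξ) {U W : R4 → R4}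
    (hU : ContDiff ℝ ∞ U) (hW : ContDiff ℝ ∞ W) : ContDiff ℝ ∞ (ξ.coeff U W) := by
  have hc : ∀ u w : R4, ContDiff ℝ ∞ fun p => ξ p ![u, w] := fun u w =>
    ((ContinuousMultilinearMap.apply ℝ (fun _ : Fin 2 => R4) ℝ ![u, w]).comp
      (ContinuousAlternatingMap.toContinuousMultilinearMapCLM ℝ)).contDiff.comp hξ
  -- In the frame at the origin, which is the standard basis, the coefficient is a sum of products
  -- of evaluations of ξ at fixed vectors with polynomials in the components of U and W.
  have h : ξ.coeff U W = fun p => _ :=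
    funext fun p => alternating_two_apply_frame (ξ p) 0 (U p) (W p)
  rw [h]
  unfold formGamma
  have h1 := hc (fieldT 0) (fieldX 0)
  have h2 := hc (fieldT 0) (fieldY 0)
  have h3 := hc (fieldT 0) (fieldZ 0)
  have h4 := hc (fieldX 0) (fieldY 0)
  have h5 := hc (fieldX 0) (fieldZ 0)
  have h6 := hc (fieldY 0) (fieldZ 0)
  refine (((((h1.mul ?_).add (h2.mul ?_)).add (h3.mul ?_)).add (h4.mul ?_)).add
    (h5.mul ?_)).add (h6.mul ?_) <;> clear h1 h2 h3 h4 h5 h6 h hc hξ <;> fun_prop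

/-- The equations satisfied by the coefficients of a closed `2`-form. -/
theorem FormR4.coeff_equations {ξ : FormR4 2} (hξ : ContDiff ℝ ∞ ξ) (hd : extDeriv ξ = 0) :
    derivAlong fieldT (ξ.coeff fieldX fieldY) - derivAlong fieldX (ξ.coeff fieldT fieldY)
        + derivAlong fieldY (ξ.coeff fieldT fieldX) + ξ.coeff fieldT fieldZ = 0 ∧
    derivAlong fieldT (ξ.coeff fieldX fieldZ) - derivAlong fieldX (ξ.coeff fieldT fieldZ)
        + derivAlong fieldZ (ξ.coeff fieldT fieldX) = 0 ∧
    derivAlong fieldT (ξ.coeff fieldY fieldZ) - derivAlong fieldY (ξ.coeff fieldT fieldZ)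
        + derivAlong fieldZ (ξ.coeff fieldT fieldY) = 0 ∧
    derivAlong fieldX (ξ.coeff fieldY fieldZ) - derivAlong fieldY (ξ.coeff fieldX fieldZ)
        + derivAlong fieldZ (ξ.coeff fieldX fieldY) = 0 := by
  have hξ' : ∀ p, DifferentiableAt ℝ ξ p := fun p => hξ.differentiable (by simp) p
  have hT := fun p => (hasFDerivAt_fieldT p).differentiableAt
  have hX := fun p => (hasFDerivAt_fieldX p).differentiableAt
  have hY := fun p => (hasFDerivAt_fieldY p).differentiableAt
  have hZ := fun p => (hasFDerivAt_fieldZ p).differentiableAt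
  have hd' : ∀ p v, extDeriv ξ p v = 0 := fun p v => by rw [hd]; rfl
  refine ⟨?_, ?_, ?_, ?_⟩ <;> funext p
  · have h := extDeriv_two_apply_vectorField (hξ' p) (hT p) (hX p) (hY p)
    -- The surviving bracket term is -ξ(Z, T) = ξ(T, Z).
    rw [hd', lieBracket_fieldT_fieldX, lieBracket_fieldT_fieldY, lieBracket_fieldX_fieldY,
      alternating_two_zero_left, alternating_two_zero_left, alternating_two_swap] at h
    unfold derivAlong FormR4.coeff
    simp only [Pi.add_apply, Pi.sub_apply, Pi.zero_apply]
    linarith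
  · have h := extDeriv_two_apply_vectorField (hξ' p) (hT p) (hX p) (hZ p)
    rw [hd', lieBracket_fieldT_fieldX, lieBracket_fieldT_fieldZ, lieBracket_fieldX_fieldZ,
      alternating_two_zero_left, alternating_two_zero_left, alternating_two_zero_left] at h
    unfold derivAlong FormR4.coeff
    simp only [Pi.add_apply, Pi.sub_apply, Pi.zero_apply]
    linarith
  · have h := extDeriv_two_apply_vectorField (hξ' p) (hT p) (hY p) (hZ p)
    rw [hd', lieBracket_fieldT_fieldY, lieBracket_fieldT_fieldZ, lieBracket_fieldY_fieldZ,
      alternating_two_zero_left, alternating_two_zero_left, alternating_two_zero_left] at h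
    unfold derivAlong FormR4.coeff
    simp only [Pi.add_apply, Pi.sub_apply, Pi.zero_apply]
    linarith
  · have h := extDeriv_two_apply_vectorField (hξ' p) (hX p) (hY p) (hZ p)
    rw [hd', lieBracket_fieldX_fieldY, lieBracket_fieldX_fieldZ, lieBracket_fieldY_fieldZ,
      alternating_two_zero_left, alternating_two_zero_left] at h
    have h' : ξ p ![fieldZ p, fieldZ p] = 0 := alternating_two_self _ _
    rw [h'] at h
    unfold derivAlong FormR4.coeff
    simp only [Pi.add_apply, Pi.sub_apply, Pi.zero_apply]
    linarith

/-- The `1`-form `ηt dt + ηx dx + ηy dy + ηz (dz - (x dy - y dx)/2)`. -/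
def FormR4.ofCoeff (ηt ηx ηy ηz : R4 → ℝ) : FormR4 1 := fun p =>
  ContinuousAlternatingMap.ofSubsingletonLIE (𝕜 := ℝ) (ι := Fin 1) (0 : Fin 1)
    (ηt p • coordT + ηx p • coordX + ηy p • coordY
      + ηz p • (coordZ - (p.2.1 / 2) • coordY + (p.2.2.1 / 2) • coordX))

theorem FormR4.ofCoeff_apply (ηt ηx ηy ηz : R4 → ℝ) (p u : R4) :
    FormR4.ofCoeff ηt ηx ηy ηz p ![u] =
      ηt p * u.1 + ηx p * u.2.1 + ηy p * u.2.2.1 + ηz p * formGamma p u := by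
  simp [FormR4.ofCoeff, formGamma]
  ring

theorem FormR4.contDiff_ofCoeff {ηt ηx ηy ηz : R4 → ℝ} (ht : ContDiff ℝ ∞ ηt)
    (hx : ContDiff ℝ ∞ ηx) (hy : ContDiff ℝ ∞ ηy) (hz : ContDiff ℝ ∞ ηz) :
    ContDiff ℝ ∞ (FormR4.ofCoeff ηt ηx ηy ηz) := by
  refine (LinearIsometryEquiv.contDiff _).comp ?_
  fun_prop

/-- The coefficients of the exterior derivative of a `1`-form. -/
theorem FormR4.coeff_extDeriv_ofCoeff {ηt ηx ηy ηz : R4 → ℝ} (ht : ContDiff ℝ ∞ ηt)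
    (hx : ContDiff ℝ ∞ ηx) (hy : ContDiff ℝ ∞ ηy) (hz : ContDiff ℝ ∞ ηz) :
    FormR4.coeff (extDeriv (FormR4.ofCoeff ηt ηx ηy ηz)) fieldT fieldX =
      derivAlong fieldT ηx - derivAlong fieldX ηt ∧
    FormR4.coeff (extDeriv (FormR4.ofCoeff ηt ηx ηy ηz)) fieldT fieldY =
      derivAlong fieldT ηy - derivAlong fieldY ηt ∧
    FormR4.coeff (extDeriv (FormR4.ofCoeff ηt ηx ηy ηz)) fieldT fieldZ =
      derivAlong fieldT ηz - derivAlong fieldZ ηt ∧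
    FormR4.coeff (extDeriv (FormR4.ofCoeff ηt ηx ηy ηz)) fieldX fieldY =
      derivAlong fieldX ηy - derivAlong fieldY ηx - ηz ∧
    FormR4.coeff (extDeriv (FormR4.ofCoeff ηt ηx ηy ηz)) fieldX fieldZ =
      derivAlong fieldX ηz - derivAlong fieldZ ηx ∧
    FormR4.coeff (extDeriv (FormR4.ofCoeff ηt ηx ηy ηz)) fieldY fieldZ =
      derivAlong fieldY ηz - derivAlong fieldZ ηy := by
  have hη : ∀ p, DifferentiableAt ℝ (FormR4.ofCoeff ηt ηx ηy ηz) p := fun p =>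
    (FormR4.contDiff_ofCoeff ht hx hy hz).differentiable (by simp) p
  have hT := fun p => (hasFDerivAt_fieldT p).differentiableAt
  have hX := fun p => (hasFDerivAt_fieldX p).differentiableAt
  have hY := fun p => (hasFDerivAt_fieldY p).differentiableAt
  have hZ := fun p => (hasFDerivAt_fieldZ p).differentiableAt
  have aT : ∀ p, FormR4.ofCoeff ηt ηx ηy ηz p ![fieldT p] = ηt p := fun p => by
    simp [FormR4.ofCoeff_apply, fieldT, formGamma]
  have aX : ∀ p, FormR4.ofCoeff ηt ηx ηy ηz p ![fieldX p] = ηx p := fun p => by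
    simp [FormR4.ofCoeff_apply, fieldX, formGamma]
  have aY : ∀ p, FormR4.ofCoeff ηt ηx ηy ηz p ![fieldY p] = ηy p := fun p => by
    simp [FormR4.ofCoeff_apply, fieldY, formGamma]
  have aZ : ∀ p, FormR4.ofCoeff ηt ηx ηy ηz p ![fieldZ p] = ηz p := fun p => by
    simp [FormR4.ofCoeff_apply, fieldZ, formGamma]
  have a0 : ∀ p, FormR4.ofCoeff ηt ηx ηy ηz p ![0] = 0 := fun p => by
    simp [FormR4.ofCoeff_apply, formGamma]
  refine ⟨?_, ?_, ?_, ?_, ?_, ?_⟩ <;> funext p <;>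
    simp only [FormR4.coeff, Pi.sub_apply, derivAlong]
  · rw [extDeriv_one_apply_vectorField (hη p) (hT p) (hX p), lieBracket_fieldT_fieldX]
    simp only [aT, aX, a0, sub_zero]
  · rw [extDeriv_one_apply_vectorField (hη p) (hT p) (hY p), lieBracket_fieldT_fieldY]
    simp only [aT, aY, a0, sub_zero]
  · rw [extDeriv_one_apply_vectorField (hη p) (hT p) (hZ p), lieBracket_fieldT_fieldZ]
    simp only [aT, aZ, a0, sub_zero]
  · rw [extDeriv_one_apply_vectorField (hη p) (hX p) (hY p), lieBracket_fieldX_fieldY]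
    simp only [aX, aY, aZ]
  · rw [extDeriv_one_apply_vectorField (hη p) (hX p) (hZ p), lieBracket_fieldX_fieldZ]
    simp only [aX, aZ, a0, sub_zero]
  · rw [extDeriv_one_apply_vectorField (hη p) (hY p) (hZ p), lieBracket_fieldY_fieldZ]
    simp only [aY, aZ, a0, sub_zero]

theorem Osc.act_x (g : Osc) (p : R4) :
    (g.act p).2.1 = g.v.x + (Real.cos g.t * p.2.1 + Real.sin g.t * p.2.2.1) := rfl

theorem Osc.act_y (g : Osc) (p : R4) :
    (g.act p).2.2.1 = g.v.y + (-Real.sin g.t * p.2.1 + Real.cos g.t * p.2.2.1) := rfl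

theorem Osc.lin_fieldT (g : Osc) (p : R4) : g.lin (fieldT p) = fieldT (g.act p) := by
  ext <;> simp [Osc.lin, fieldT]

theorem Osc.lin_fieldZ (g : Osc) (p : R4) : g.lin (fieldZ p) = fieldZ (g.act p) := by
  ext <;> simp [Osc.lin, fieldZ]

/-- X and Y are left-invariant for the direct product but not for G, whose translations turn them by
the angle g.t; only angles in 2πℤ leave them fixed. -/
theorem Osc.lin_fieldX (g : Osc) (p : R4) : g.lin (fieldX p) =
    Real.cos g.t • fieldX (g.act p) + (-Real.sin g.t) • fieldY (g.act p) := by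
  have h := Real.sin_sq_add_cos_sq g.t
  ext <;> simp [Osc.lin, fieldX, fieldY, Osc.act_x, Osc.act_y]
  linear_combination (p.2.2.1 / 2) * h

theorem Osc.lin_fieldY (g : Osc) (p : R4) : g.lin (fieldY p) =
    Real.sin g.t • fieldX (g.act p) + Real.cos g.t • fieldY (g.act p) := by
  have h := Real.sin_sq_add_cos_sq g.t
  ext <;> simp [Osc.lin, fieldX, fieldY, Osc.act_x, Osc.act_y]
  linear_combination (-p.2.1 / 2) * h

/-- Rotations preserve x dy - y dx, so γ is left-invariant for G as well. -/
theorem Osc.formGamma_act (g : Osc) (p u : R4) :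
    formGamma (g.act p) (g.lin u) = formGamma p u := by
  have h := Real.sin_sq_add_cos_sq g.t
  simp [Osc.lin, formGamma, Osc.act_x, Osc.act_y]
  linear_combination (-(p.2.1 * u.2.2.1 - p.2.2.1 * u.2.1) / 2) * h

theorem Nil.act_x (g : Nil) (p : R4) : (g.act p).2.1 = g.v.x + p.2.1 := rfl

theorem Nil.act_y (g : Nil) (p : R4) : (g.act p).2.2.1 = g.v.y + p.2.2.1 := rfl

theorem Nil.lin_fieldT (g : Nil) (p : R4) : g.lin (fieldT p) = fieldT (g.act p) := by
  ext <;> simp [Nil.lin, fieldT]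

theorem Nil.lin_fieldZ (g : Nil) (p : R4) : g.lin (fieldZ p) = fieldZ (g.act p) := by
  ext <;> simp [Nil.lin, fieldZ]

theorem Nil.lin_fieldX (g : Nil) (p : R4) : g.lin (fieldX p) = fieldX (g.act p) := by
  ext <;> simp [Nil.lin, fieldX, Nil.act_y]
  ring

theorem Nil.lin_fieldY (g : Nil) (p : R4) : g.lin (fieldY p) = fieldY (g.act p) := by
  ext <;> simp [Nil.lin, fieldY, Nil.act_x]
  ring

theorem alternating_comp_two_apply {E : Type*} [NormedAddCommGroup E] [NormedSpace ℝ E]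
    (θ : E [⋀^Fin 2]→L[ℝ] ℝ) (A : E →L[ℝ] E) (u w : E) :
    θ.compContinuousLinearMap A ![u, w] = θ ![A u, A w] := by
  rw [ContinuousAlternatingMap.compContinuousLinearMap_apply]
  congr 1
  funext i
  fin_cases i <;> rfl

/-- The coefficients of the translate of a `2`-form. -/
theorem FormR4.coeff_translate (g : Osc) (ξ : FormR4 2) (p : R4) :
    (ξ.translate g).coeff fieldT fieldX p =
      Real.cos g.t * ξ.coeff fieldT fieldX (g.act p)
        - Real.sin g.t * ξ.coeff fieldT fieldY (g.act p) ∧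
    (ξ.translate g).coeff fieldT fieldY p =
      Real.sin g.t * ξ.coeff fieldT fieldX (g.act p)
        + Real.cos g.t * ξ.coeff fieldT fieldY (g.act p) ∧
    (ξ.translate g).coeff fieldT fieldZ p = ξ.coeff fieldT fieldZ (g.act p) ∧
    (ξ.translate g).coeff fieldX fieldY p = ξ.coeff fieldX fieldY (g.act p) ∧
    (ξ.translate g).coeff fieldX fieldZ p =
      Real.cos g.t * ξ.coeff fieldX fieldZ (g.act p)
        - Real.sin g.t * ξ.coeff fieldY fieldZ (g.act p) ∧
    (ξ.translate g).coeff fieldY fieldZ p =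
      Real.sin g.t * ξ.coeff fieldX fieldZ (g.act p)
        + Real.cos g.t * ξ.coeff fieldY fieldZ (g.act p) := by
  have h := Real.sin_sq_add_cos_sq g.t
  simp only [FormR4.coeff, FormR4.translate, alternating_comp_two_apply, Osc.lin_fieldT,
    Osc.lin_fieldX, Osc.lin_fieldY, Osc.lin_fieldZ, alternating_two_add_left,
    alternating_two_add_right, alternating_two_smul_left, alternating_two_smul_right,
    alternating_two_self, alternating_two_swap (ξ (g.act p)) (fieldX (g.act p)) (fieldY (g.act p))]
  refine ⟨by ring, trivial, trivial, ?_, by ring, trivial⟩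
  linear_combination (ξ (g.act p) ![fieldX (g.act p), fieldY (g.act p)]) * h

end Coefficients

/-! ### Averages of smooth functions along segments. -/

section Averages

open MeasureTheory intervalIntegral

variable {E : Type} [NormedAddCommGroup E] [NormedSpace ℝ E] [FiniteDimensional ℝ E]
  {F : Type} [NormedAddCommGroup F] [NormedSpace ℝ F]

/-- The weighted average of `f` over the segment from `p` to `p + w`. -/
def segmentAverage (φ : ℝ → ℝ) (w : E) (f : E → F) (p : E) : F :=
  ∫ s in (0 : ℝ)..1, φ s • f (p + s • w)

/-- Differentiation under the integral sign. The dominating constant bounds the integrand's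
derivative on a closed unit ball times [0, 1], compact because the dimension is finite. -/
theorem hasFDerivAt_segmentAverage {φ : ℝ → ℝ} (hφ : Continuous φ) (w : E) {f : E → F}
    (hf : ContDiff ℝ 1 f) (p : E) :
    HasFDerivAt (segmentAverage φ w f) (segmentAverage φ w (fderiv ℝ f) p) p := by
  have hf' : Continuous (fderiv ℝ f) := hf.continuous_fderiv one_ne_zero
  have hcont : Continuous fun x : E × ℝ => φ x.2 • fderiv ℝ f (x.1 + x.2 • w) := by fun_prop
  have hK : IsCompact (Metric.closedBall p 1 ×ˢ Set.Icc (0 : ℝ) 1) :=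
    (isCompact_closedBall p 1).prod isCompact_Icc
  obtain ⟨C, hC⟩ := hK.exists_bound_of_continuousOn hcont.continuousOn
  refine hasFDerivAt_integral_of_dominated_of_fderiv_le
    (F := fun x s => φ s • f (x + s • w)) (F' := fun x s => φ s • fderiv ℝ f (x + s • w))
    (bound := fun _ => C) (Metric.ball_mem_nhds p one_pos) ?_ ?_ ?_ ?_ ?_ ?_
  · refine Filter.Eventually.of_forall fun x => Continuous.aestronglyMeasurable ?_
    have := hf.continuous
    fun_prop
  · refine Continuous.intervalIntegrable ?_ _ _
    have := hf.continuous
    fun_prop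
  · exact Continuous.aestronglyMeasurable (by fun_prop)
  · refine Filter.Eventually.of_forall fun s hs x hx => ?_
    rw [Set.uIoc_of_le zero_le_one] at hs
    exact hC (x, s) ⟨Metric.ball_subset_closedBall hx, hs.1.le, hs.2⟩
  · exact intervalIntegrable_const
  · refine Filter.Eventually.of_forall fun s _ x _ => ?_
    have h1 := (hf.differentiable one_ne_zero (x + s • w)).hasFDerivAt
    have h2 := h1.comp x ((hasFDerivAt_id x).add_const (s • w))
    exact (h2.congr_fderiv (by simp)).const_smul (φ s)

/-- The derivative of an average is the average of the derivative, again an average but with values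
in another space; hence the induction has to generalize the target. -/
theorem contDiff_segmentAverage {φ : ℝ → ℝ} (hφ : Continuous φ) (w : E) {f : E → F}
    (hf : ContDiff ℝ ∞ f) : ContDiff ℝ ∞ (segmentAverage φ w f) := by
  rw [contDiff_infty]
  intro n
  induction n generalizing F with
  | zero =>
    exact contDiff_zero.2 (Differentiable.continuous (𝕜 := ℝ) fun p =>
      (hasFDerivAt_segmentAverage hφ w (hf.of_le (by simp)) p).differentiableAt)
  | succ n ih =>
    have h := hasFDerivAt_segmentAverage hφ w (hf.of_le (m := 1) (by simp))
    refine contDiff_succ_iff_hasFDerivAt.2 ⟨_, ih (hf.fderiv_right (m := ∞) (by simp)), h⟩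

end Averages

/-! ### Functions on M_{k,0}: means, primitives and invariant derivatives. -/

section PeriodicFunctions

open MeasureTheory intervalIntegral

section General

variable {E : Type} [NormedAddCommGroup E] [NormedSpace ℝ E]

theorem hasDerivAt_along_line {f : E → ℝ} (hf : ContDiff ℝ ∞ f) (p w : E) (s : ℝ) :
    HasDerivAt (fun s : ℝ => f (p + s • w)) (fderiv ℝ f (p + s • w) w) s := by
  have h1 := (hf.differentiable (by simp) (p + s • w)).hasFDerivAt
  have h2 : HasDerivAt (fun s : ℝ => p + s • w) w s := by
    simpa using ((hasDerivAt_id s).smul_const w).const_add p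
  exact h1.comp_hasDerivAt s h2

theorem continuous_fderiv_along_line {f : E → ℝ} (hf : ContDiff ℝ ∞ f) (p w v : E) :
    Continuous fun s : ℝ => fderiv ℝ f (p + s • w) v := by
  have := hf.continuous_fderiv (by simp)
  fun_prop

/-- A function with vanishing derivative in a direction is invariant in this direction. -/
theorem apply_add_smul_of_fderiv_eq_zero {f : E → ℝ} (hf : ContDiff ℝ ∞ f) {w : E}
    (h : ∀ p, fderiv ℝ f p w = 0) (p : E) (s : ℝ) : f (p + s • w) = f p := by
  have := is_const_of_deriv_eq_zero (f := fun s : ℝ => f (p + s • w))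
    (fun s => (hasDerivAt_along_line hf p w s).differentiableAt)
    (fun s => by rw [(hasDerivAt_along_line hf p w s).deriv, h]) s 0
  simpa using this

/-- A periodic function that is affine in the direction of the period is constant in it. -/
theorem fderiv_apply_eq_zero_of_periodic {f : E → ℝ} (hf : ContDiff ℝ ∞ f) {w : E}
    (hper : ∀ p, f (p + w) = f p) (h : ∀ p, fderiv ℝ (fun p => fderiv ℝ f p w) p w = 0) (p : E) :
    fderiv ℝ f p w = 0 := by
  have hf' : ContDiff ℝ ∞ fun p => fderiv ℝ f p w :=
    (hf.fderiv_right (m := ∞) (by simp)).clm_apply contDiff_const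
  -- The derivative along w is constant on the line through p, and its integral over one period is f
  -- (p + w) - f p = 0.
  have h1 := fun s => apply_add_smul_of_fderiv_eq_zero hf' h p s
  have h2 := integral_eq_sub_of_hasDerivAt (a := 0) (b := 1)
    (fun s _ => hasDerivAt_along_line hf p w s)
    ((continuous_fderiv_along_line hf p w w).intervalIntegrable _ _)
  simp only [h1] at h2
  simpa [hper] using h2

theorem segmentAverage_one_pos (w : E) {f : E → ℝ} (hf : Continuous f) (h : ∀ p, 0 < f p) (p : E) :
    0 < segmentAverage (fun _ => 1) w f p := by
  unfold segmentAverage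
  simp only [one_smul]
  refine intervalIntegral_pos_of_pos (Continuous.intervalIntegrable (by fun_prop) _ _)
    (fun s => h _) one_pos

variable [FiniteDimensional ℝ E]

theorem fderiv_segmentAverage_apply {φ : ℝ → ℝ} (hφ : Continuous φ) (w : E) {f : E → ℝ}
    (hf : ContDiff ℝ ∞ f) (p v : E) :
    fderiv ℝ (segmentAverage φ w f) p v = segmentAverage φ w (fun p => fderiv ℝ f p v) p := by
  rw [(hasFDerivAt_segmentAverage hφ w (hf.of_le (by simp)) p).fderiv]
  unfold segmentAverage
  have hc := hf.continuous_fderiv (by simp)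
  rw [ContinuousLinearMap.intervalIntegral_apply
    (Continuous.intervalIntegrable (by fun_prop) _ _)]
  rfl

/-- The average of the derivative along the segment is f (p + w) - f p. -/
theorem fderiv_segmentAverage_one_apply_self (w : E) {f : E → ℝ}
    (hf : ContDiff ℝ ∞ f) (hper : ∀ p, f (p + w) = f p) (p : E) :
    fderiv ℝ (segmentAverage (fun _ => 1) w f) p w = 0 := by
  rw [fderiv_segmentAverage_apply continuous_const w hf]
  unfold segmentAverage
  simp only [one_smul]
  rw [integral_eq_sub_of_hasDerivAt (fun s _ => hasDerivAt_along_line hf p w s)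
    ((continuous_fderiv_along_line hf p w w).intervalIntegrable _ _)]
  simp [hper]

/-- A periodic function is the sum of its average and of the derivative of a periodic function. -/
theorem eq_segmentAverage_add_fderiv (w : E) {f : E → ℝ}
    (hf : ContDiff ℝ ∞ f) (hper : ∀ p, f (p + w) = f p) (p : E) :
    f p = segmentAverage (fun _ => 1) w f p
      + fderiv ℝ (segmentAverage (fun s => s) w f) p w := by
  rw [fderiv_segmentAverage_apply (φ := fun s => s) continuous_id w hf]
  unfold segmentAverage
  simp only [smul_eq_mul]
  -- Integration by parts with the weight s: the boundary term is f (p + w) = f p, and the remaining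
  -- integral is the plain average.
  have h := integral_mul_deriv_eq_deriv_mul (a := 0) (b := 1) (u := fun s : ℝ => s)
    (u' := fun _ => 1) (fun s _ => hasDerivAt_id s)
    (fun s _ => hasDerivAt_along_line hf p w s) (continuous_const.intervalIntegrable _ _)
    ((continuous_fderiv_along_line hf p w w).intervalIntegrable _ _)
  rw [h]
  simp [hper]

end General

variable {k : ℕ+}

theorem cos_eq_one_of_mem_lattice {g : Osc} (hg : g ∈ Osc.lattice 4 k) : Real.cos g.t = 1 := by
  obtain ⟨⟨l, hl⟩, -⟩ := hg
  rw [hl, Osc.four_mul_half_pi, Real.cos_int_mul_two_pi]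

theorem sin_eq_zero_of_mem_lattice {g : Osc} (hg : g ∈ Osc.lattice 4 k) : Real.sin g.t = 0 := by
  have h := Real.sin_sq_add_cos_sq g.t
  rw [cos_eq_one_of_mem_lattice hg] at h
  nlinarith

variable (k) in
/-- The smooth functions on `M_{k,0}`, as functions on `ℝ⁴`. -/
def periodicFunctions : Submodule ℝ (R4 → ℝ) where
  carrier := {f | ContDiff ℝ ∞ f ∧ ∀ g ∈ Osc.lattice 4 k, ∀ p, f (g.act p) = f p}
  zero_mem' := ⟨contDiff_const, fun _ _ _ => rfl⟩
  add_mem' := fun ha hb => ⟨ha.1.add hb.1, fun g hg p => by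
    simp only [Pi.add_apply, ha.2 g hg, hb.2 g hg]⟩
  smul_mem' := fun r a ha => ⟨contDiff_const.smul ha.1, fun g hg p => by
    simp only [Pi.smul_apply, ha.2 g hg]⟩

theorem apply_act_of_mem {f : R4 → ℝ} (hf : f ∈ periodicFunctions k) {g : Osc}
    (hg : g ∈ Osc.lattice 4 k) (p : R4) : f (g.act p) = f p := hf.2 g hg p

theorem mul_mem_periodicFunctions {f h : R4 → ℝ} (hf : f ∈ periodicFunctions k)
    (hh : h ∈ periodicFunctions k) : f * h ∈ periodicFunctions k :=
  ⟨hf.1.mul hh.1, fun g hg p => by simp only [Pi.mul_apply, hf.2 g hg, hh.2 g hg]⟩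

theorem derivAlong_mem_periodicFunctions {f : R4 → ℝ} (hf : f ∈ periodicFunctions k)
    {U : R4 → R4} (hU : ContDiff ℝ ∞ U)
    (hinv : ∀ g ∈ Osc.lattice 4 k, ∀ p, g.lin (U p) = U (g.act p)) :
    derivAlong U f ∈ periodicFunctions k := by
  refine ⟨hf.1.derivAlong hU, fun g hg p => ?_⟩
  have h1 : f ∘ g.act = f := funext (hf.2 g hg)
  have h2 := (hf.1.differentiable (by simp) (g.act p)).hasFDerivAt.comp p (g.hasFDerivAt_act p)
  rw [h1] at h2
  unfold derivAlong
  rw [h2.fderiv, ← hinv g hg]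
  rfl

theorem derivAlong_add' {f h : R4 → ℝ} (hf : ContDiff ℝ ∞ f) (hh : ContDiff ℝ ∞ h)
    (U : R4 → R4) : derivAlong U (f + h) = derivAlong U f + derivAlong U h := by
  funext p
  simp only [derivAlong, Pi.add_apply]
  rw [fderiv_add (hf.differentiable (by simp) p) (hh.differentiable (by simp) p)]
  rfl

theorem derivAlong_smul' (r : ℝ) {f : R4 → ℝ} (hf : ContDiff ℝ ∞ f)
    (U : R4 → R4) : derivAlong U (r • f) = r • derivAlong U f := by
  funext p
  simp only [derivAlong, Pi.smul_apply]
  rw [fderiv_const_smul (hf.differentiable (by simp) p)]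
  rfl

theorem derivAlong_mul {f h : R4 → ℝ} (hf : ContDiff ℝ ∞ f) (hh : ContDiff ℝ ∞ h)
    (U : R4 → R4) : derivAlong U (f * h) = derivAlong U f * h + f * derivAlong U h := by
  funext p
  simp only [derivAlong, Pi.add_apply, Pi.mul_apply]
  rw [fderiv_mul (hf.differentiable (by simp) p) (hh.differentiable (by simp) p)]
  simp
  ring

variable (k) in
/-- The derivative along an invariant vector field, as an operator on the smooth functions on
`M_{k,0}`. -/
def derivOp (U : R4 → R4) (hU : ContDiff ℝ ∞ U)
    (hinv : ∀ g ∈ Osc.lattice 4 k, ∀ p, g.lin (U p) = U (g.act p)) :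
    periodicFunctions k →ₗ[ℝ] periodicFunctions k where
  toFun f := ⟨derivAlong U f, derivAlong_mem_periodicFunctions f.2 hU hinv⟩
  map_add' f h := Subtype.ext (derivAlong_add' f.2.1 h.2.1 U)
  map_smul' r f := Subtype.ext (derivAlong_smul' r f.2.1 U)

theorem lin_fieldX_of_mem_lattice {g : Osc} (hg : g ∈ Osc.lattice 4 k) (p : R4) :
    g.lin (fieldX p) = fieldX (g.act p) := by
  rw [Osc.lin_fieldX, cos_eq_one_of_mem_lattice hg, sin_eq_zero_of_mem_lattice hg]
  simp

theorem lin_fieldY_of_mem_lattice {g : Osc} (hg : g ∈ Osc.lattice 4 k) (p : R4) :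
    g.lin (fieldY p) = fieldY (g.act p) := by
  rw [Osc.lin_fieldY, cos_eq_one_of_mem_lattice hg, sin_eq_zero_of_mem_lattice hg]
  simp

variable (k) in
/-- The derivative `∂/∂t` on the smooth functions on `M_{k,0}`. -/
def opT : periodicFunctions k →ₗ[ℝ] periodicFunctions k :=
  derivOp k fieldT contDiff_fieldT fun g _ => Osc.lin_fieldT g

variable (k) in
/-- The derivative along `X` on the smooth functions on `M_{k,0}`. -/
def opX : periodicFunctions k →ₗ[ℝ] periodicFunctions k :=
  derivOp k fieldX contDiff_fieldX fun _ hg => lin_fieldX_of_mem_lattice hg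

variable (k) in
/-- The derivative along `Y` on the smooth functions on `M_{k,0}`. -/
def opY : periodicFunctions k →ₗ[ℝ] periodicFunctions k :=
  derivOp k fieldY contDiff_fieldY fun _ hg => lin_fieldY_of_mem_lattice hg

variable (k) in
/-- The derivative `∂/∂z` on the smooth functions on `M_{k,0}`. -/
def opZ : periodicFunctions k →ₗ[ℝ] periodicFunctions k :=
  derivOp k fieldZ contDiff_fieldZ fun g _ => Osc.lin_fieldZ g

/-- A smooth function on `M_{k,0}` decomposes into its average along the segments of direction `u`
and a derivative in this direction, provided that translating in the direction `u` respects it. -/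
theorem exists_eq_add_fderiv {f : R4 → ℝ} (hf : f ∈ periodicFunctions k) {u : R4}
    (hper : ∀ p, f (p + u) = f p)
    (hcomm : ∀ g ∈ Osc.lattice 4 k, ∀ (p : R4) (s : ℝ), f (g.act p + s • u) = f (p + s • u)) :
    ∃ a ∈ periodicFunctions k, ∃ b ∈ periodicFunctions k,
      (∀ p, f p = a p + fderiv ℝ b p u) ∧ (∀ p, fderiv ℝ a p u = 0) ∧
      ∀ v, (∀ p, fderiv ℝ f p v = 0) → ∀ p, fderiv ℝ a p v = 0 ∧ fderiv ℝ b p v = 0 := by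
  -- Both weights are needed: 1 gives the mean a, and s gives the primitive b.
  have hmem : ∀ φ : ℝ → ℝ, Continuous φ → segmentAverage φ u f ∈ periodicFunctions k :=
    fun φ hφ => ⟨contDiff_segmentAverage hφ u hf.1, fun g hg p => by
      simp only [segmentAverage, hcomm g hg]⟩
  have hv : ∀ φ : ℝ → ℝ, Continuous φ → ∀ v, (∀ p, fderiv ℝ f p v = 0) →
      ∀ p, fderiv ℝ (segmentAverage φ u f) p v = 0 := by
    intro φ hφ v h p
    rw [fderiv_segmentAverage_apply hφ u hf.1]
    simp [segmentAverage, h]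
  exact ⟨_, hmem _ continuous_const, _, hmem _ continuous_id,
    eq_segmentAverage_add_fderiv u hf.1 hper, fderiv_segmentAverage_one_apply_self u hf.1 hper,
    fun v h p => ⟨hv _ continuous_const v h p, hv _ continuous_id v h p⟩⟩

end PeriodicFunctions

/-! ### The algebra of second cohomology, for abstract operators. -/

section DegreeTwo

variable {V : Type*} [AddCommGroup V] [Module ℝ V]

/-- Commuting operators on the joint kernel of which elements split, successively in the directions
`Z, Y, X, T`, into an invariant element and a derivative, as the left-invariant vector fields of
`ℝ × H₃(ℝ)` on the smooth functions on a compact quotient. -/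
structure SplittingOperators (T X Y Z : V →ₗ[ℝ] V) : Prop where
  TX : ∀ f, T (X f) = X (T f)
  TY : ∀ f, T (Y f) = Y (T f)
  TZ : ∀ f, T (Z f) = Z (T f)
  XZ : ∀ f, X (Z f) = Z (X f)
  YZ : ∀ f, Y (Z f) = Z (Y f)
  XY : ∀ f, X (Y f) - Y (X f) = Z f
  splitZ : ∀ f, ∃ g h, f = g + Z h ∧ Z g = 0
  splitY : ∀ f, Z f = 0 → ∃ g h, f = g + Y h ∧ Z g = 0 ∧ Y g = 0 ∧ Z h = 0
  splitX : ∀ f, Z f = 0 → Y f = 0 →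
    ∃ g h, f = g + X h ∧ Z g = 0 ∧ Y g = 0 ∧ X g = 0 ∧ Z h = 0 ∧ Y h = 0
  splitT : ∀ f, Z f = 0 → Y f = 0 → X f = 0 →
    ∃ g h, f = g + T h ∧ Z g = 0 ∧ Y g = 0 ∧ X g = 0 ∧ T g = 0 ∧ Z h = 0 ∧ Y h = 0 ∧ X h = 0
  nilZ : ∀ f, Z (Z f) = 0 → Z f = 0
  nilY : ∀ f, Z f = 0 → Y (Y f) = 0 → Y f = 0
  nilX : ∀ f, Z f = 0 → Y f = 0 → X (X f) = 0 → X f = 0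
  nilT : ∀ f, Z f = 0 → Y f = 0 → X f = 0 → T (T f) = 0 → T f = 0

/-- An element is constant if all the operators vanish on it. -/
def IsConstant (T X Y Z : V →ₗ[ℝ] V) (f : V) : Prop := Z f = 0 ∧ Y f = 0 ∧ X f = 0 ∧ T f = 0

namespace SplittingOperators

variable {T X Y Z : V →ₗ[ℝ] V}

theorem XY_comm (S : SplittingOperators T X Y Z) {f : V} (hf : Z f = 0) : X (Y f) = Y (X f) := by
  rw [← sub_eq_zero, S.XY, hf]

theorem Z_T (S : SplittingOperators T X Y Z) {f : V} (hf : Z f = 0) : Z (T f) = 0 := by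
  rw [← S.TZ, hf, map_zero]

theorem Z_X (S : SplittingOperators T X Y Z) {f : V} (hf : Z f = 0) : Z (X f) = 0 := by
  rw [← S.XZ, hf, map_zero]

theorem Z_Y (S : SplittingOperators T X Y Z) {f : V} (hf : Z f = 0) : Z (Y f) = 0 := by
  rw [← S.YZ, hf, map_zero]

theorem Y_T (S : SplittingOperators T X Y Z) {f : V} (hf : Y f = 0) : Y (T f) = 0 := by
  rw [← S.TY, hf, map_zero]

theorem X_T (S : SplittingOperators T X Y Z) {f : V} (hf : X f = 0) : X (T f) = 0 := by
  rw [← S.TX, hf, map_zero]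

theorem Y_X (S : SplittingOperators T X Y Z) {f : V} (hZ : Z f = 0) (hf : Y f = 0) :
    Y (X f) = 0 := by
  rw [← S.XY_comm hZ, hf, map_zero]

/-- A closed `1`-form on the torus is, up to constants, exact. -/
theorem exists_primitive_one (S : SplittingOperators T X Y Z) {c e f : V}
    (hc : Z c = 0) (he : Z e = 0) (hf : Z f = 0)
    (h₁ : T e = X c) (h₂ : T f = Y c) (h₃ : X f = Y e) :
    ∃ h C E F, Z h = 0 ∧ IsConstant T X Y Z C ∧ IsConstant T X Y Z E ∧ IsConstant T X Y Z F ∧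
      c = C + T h ∧ e = E + X h ∧ f = F + Y h := by
  -- Subtracting the differential of g leaves a Y-component that is constant along Y. The other
  -- components change by T g and X g, and the closedness equations persist.
  obtain ⟨F, g, rfl, hFZ, hFY, hgZ⟩ := S.splitY f hf
  obtain ⟨c, rfl⟩ : ∃ c', c = c' + T g := ⟨_, (sub_add_cancel _ _).symm⟩
  obtain ⟨e, rfl⟩ : ∃ e', e = e' + X g := ⟨_, (sub_add_cancel _ _).symm⟩
  rw [map_add, S.Z_T hgZ, add_zero] at hc
  rw [map_add, S.Z_X hgZ, add_zero] at he
  simp only [map_add, S.TX, S.TY, S.XY_comm hgZ, add_left_inj] at h₁ h₂ h₃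
  -- Applying Y to T F = Y c gives Y (Y c) = 0. The same argument, repeated with X, leaves only
  -- constants and a primitive.
  have hcY : Y c = 0 := S.nilY _ hc (by rw [← h₂, S.Y_T hFY])
  have heY : Y e = 0 := S.nilY _ he (by rw [← h₃, S.Y_X hFZ hFY])
  rw [hcY] at h₂
  rw [heY] at h₃
  obtain ⟨E, g', rfl, hEZ, hEY, hEX, hgZ', hgY'⟩ := S.splitX e he heY
  obtain ⟨c, rfl⟩ : ∃ c', c = c' + T g' := ⟨_, (sub_add_cancel _ _).symm⟩
  rw [map_add, S.Z_T hgZ', add_zero] at hc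
  rw [map_add, S.Y_T hgY', add_zero] at hcY
  simp only [map_add, S.TX, add_left_inj] at h₁
  have hcX : X c = 0 := S.nilX _ hc hcY (by rw [← h₁, S.X_T hEX])
  rw [hcX] at h₁
  obtain ⟨C, g'', rfl, hCZ, hCY, hCX, hCT, hgZ'', hgY'', hgX''⟩ := S.splitT c hc hcY hcX
  refine ⟨g'' + g' + g, C, E, F, by simp [hgZ, hgZ', hgZ''], ⟨hCZ, hCY, hCX, hCT⟩,
    ⟨hEZ, hEY, hEX, h₁⟩, ⟨hFZ, hFY, h₃, h₂⟩, ?_, ?_, ?_⟩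
  · simp only [map_add]; abel
  · simp only [map_add, hgX'']; abel
  · simp only [map_add, hgY'', hgY']; abel

/-- A closed `2`-form on the torus is, up to constants, exact. -/
theorem exists_primitive_two (S : SplittingOperators T X Y Z) {a b d C : V}
    (ha : Z a = 0) (hb : Z b = 0) (hd : Z d = 0)
    (hC : IsConstant T X Y Z C) (h : T d - X b + Y a + C = 0) :
    C = 0 ∧ ∃ ηt ηx ηy A B D, Z ηt = 0 ∧ Z ηx = 0 ∧ Z ηy = 0 ∧
      IsConstant T X Y Z A ∧ IsConstant T X Y Z B ∧ IsConstant T X Y Z D ∧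
      a = A + (T ηx - X ηt) ∧ b = B + (T ηy - Y ηt) ∧ d = D + (X ηy - Y ηx) := by
  obtain ⟨hCZ, hCY, hCX, hCT⟩ := hC
  -- The Y-derivatives in b and d come from a 1-form with components -g on dt and -g' on dx;
  -- removing its differential changes a by X g - T g'.
  obtain ⟨b, g, rfl, hbZ, hbY, hgZ⟩ := S.splitY b hb
  obtain ⟨d, g', rfl, hdZ, hdY, hgZ'⟩ := S.splitY d hd
  obtain ⟨a, rfl⟩ : ∃ a', a = a' + (X g - T g') := ⟨_, (sub_add_cancel _ _).symm⟩
  rw [map_add, map_sub, S.Z_T hgZ', S.Z_X hgZ, sub_zero, add_zero] at ha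
  replace h : T d - X b + Y a + C = 0 := by
    simp only [map_add, map_sub, S.TY, S.XY_comm hgZ] at h
    rw [← h]; abel
  have haY : Y a = 0 := S.nilY _ ha (by
    have := congrArg Y h
    simpa [S.Y_T hdY, S.Y_X hbZ hbY, hCY] using this)
  rw [haY, add_zero] at h
  obtain ⟨d, u, rfl, hdZ', hdY', hdX', huZ, huY⟩ := S.splitX d hdZ hdY
  obtain ⟨b, rfl⟩ : ∃ b', b = b' + T u := ⟨_, (sub_add_cancel _ _).symm⟩
  rw [map_add, S.Z_T huZ, add_zero] at hbZ
  rw [map_add, S.Y_T huY, add_zero] at hbY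
  replace h : T d - X b + C = 0 := by
    simp only [map_add, S.TX] at h
    rw [← h]; abel
  have hbX : X b = 0 := S.nilX _ hbZ hbY (by
    have := congrArg X h
    simpa [S.X_T hdX', hCX] using this)
  rw [hbX, sub_zero] at h
  -- At this point T d = -C with C constant, so T (T d) = 0; hence T d vanishes and C with it.
  have hdT : T d = 0 := S.nilT _ hdZ' hdY' hdX' (by
    have := congrArg T h
    simpa [hCT] using this)
  rw [hdT, zero_add] at h
  obtain ⟨B, v, rfl, hBZ, hBY, hBX, hBT, hvZ, hvY, hvX⟩ := S.splitT b hbZ hbY hbX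
  obtain ⟨a, w, rfl, haZ, haY', haX, hwZ, hwY⟩ := S.splitX a ha haY
  obtain ⟨A, w', rfl, hAZ, hAY, hAX, hAT, hwZ', hwY', hwX'⟩ := S.splitT a haZ haY' haX
  refine ⟨h, -g - w, w' - g', u + v, A, B, d, by simp [hgZ, hwZ], by simp [hgZ', hwZ'],
    by simp [huZ, hvZ], ⟨hAZ, hAY, hAX, hAT⟩, ⟨hBZ, hBY, hBX, hBT⟩, ⟨hdZ', hdY', hdX', hdT⟩,
    ?_, ?_, ?_⟩
  · simp only [map_sub, map_neg]; abel
  · simp only [map_add, map_sub, map_neg, hwY]; abel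
  · simp only [map_add, map_sub, hvX, hwY']; abel

/-- A closed `2`-form on the Kodaira–Thurston manifold is, up to constant coefficients, exact. -/
theorem exists_primitive (S : SplittingOperators T X Y Z) {a b c d e f : V}
    (h₁ : T d - X b + Y a + c = 0) (h₂ : T e - X c + Z a = 0) (h₃ : T f - Y c + Z b = 0)
    (h₄ : X f - Y e + Z d = 0) :
    ∃ ηt ηx ηy ηz A B E F, IsConstant T X Y Z A ∧ IsConstant T X Y Z B ∧
      IsConstant T X Y Z E ∧ IsConstant T X Y Z F ∧
      a = A + (T ηx - X ηt) ∧ b = B + (T ηy - Y ηt) ∧ c = T ηz - Z ηt ∧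
      d = X ηy - Y ηx - ηz ∧ e = E + (X ηz - Z ηx) ∧ f = F + (Y ηz - Z ηy) := by
  -- Subtracting the differential of -gc τ - ge α - gf β leaves c, e and f invariant under Z.
  obtain ⟨c, gc, rfl, hc⟩ := S.splitZ c
  obtain ⟨e, ge, rfl, he⟩ := S.splitZ e
  obtain ⟨f, gf, rfl, hf⟩ := S.splitZ f
  obtain ⟨a, rfl⟩ : ∃ a', a = a' + (X gc - T ge) := ⟨_, (sub_add_cancel _ _).symm⟩
  obtain ⟨b, rfl⟩ : ∃ b', b = b' + (Y gc - T gf) := ⟨_, (sub_add_cancel _ _).symm⟩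
  obtain ⟨d, rfl⟩ : ∃ d', d = d' + (Y ge - X gf) := ⟨_, (sub_add_cancel _ _).symm⟩
  simp only [map_add, map_sub] at h₁ h₂ h₃ h₄
  replace h₁ : T d - X b + Y a + c = 0 := by rw [← h₁, S.TY, S.TX, ← S.XY]; abel
  replace h₂ : T e - X c + Z a = 0 := by rw [← h₂, S.TZ, S.XZ]; abel
  replace h₃ : T f - Y c + Z b = 0 := by rw [← h₃, S.TZ, S.YZ]; abel
  replace h₄ : X f - Y e + Z d = 0 := by rw [← h₄, S.XZ, S.YZ]; abel
  -- Applying Z to the remaining equation leaves Z (Z a) = 0; likewise for b and d.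
  have ha : Z a = 0 := S.nilZ _ (by
    have := congrArg Z h₂
    simpa [S.Z_T he, S.Z_X hc] using this)
  have hb : Z b = 0 := S.nilZ _ (by
    have := congrArg Z h₃
    simpa [S.Z_T hf, S.Z_Y hc] using this)
  have hd : Z d = 0 := S.nilZ _ (by
    have := congrArg Z h₄
    simpa [S.Z_X hf, S.Z_Y he] using this)
  rw [ha, add_zero, sub_eq_zero] at h₂
  rw [hb, add_zero, sub_eq_zero] at h₃
  rw [hd, add_zero, sub_eq_zero] at h₄
  -- Pairing with Z in the second slot has become a closed 1-form (c, e, f) on the torus of t, x, y;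
  -- its primitive h will be the γ-component.
  obtain ⟨h, C, E, F, hZ, hC, hE, hF, rfl, rfl, rfl⟩ := S.exists_primitive_one hc he hf h₂ h₃ h₄
  -- Passing to d + h absorbs the T h contained in c. What remains is a 2-form on the torus whose
  -- differential is the constant -C, and this forces C = 0: no multiple of τ∧γ survives.
  obtain ⟨rfl, ηt, ηx, ηy, A, B, D, ht, hx, hy, hA, hB, hD, rfl, rfl, hd'⟩ :=
    S.exists_primitive_two (d := d + h) ha hb (by rw [map_add, hd, hZ, add_zero]) hC (by
      rw [← h₁, map_add]; abel)
  obtain rfl := eq_sub_of_add_eq hd'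
  obtain ⟨hDZ, hDY, hDX, hDT⟩ := hD
  -- Because dγ = -α∧β, the constant D is absorbed by the γ-component, so α∧β does not survive
  -- either.
  refine ⟨ηt - gc, ηx - ge, ηy - gf, h - D, A, B, E, F, hA, hB, hE, hF, ?_, ?_, ?_, ?_, ?_, ?_⟩
  · simp only [map_sub]; abel
  · simp only [map_sub]; abel
  · simp only [map_sub, ht, hDT]; abel
  · simp only [map_sub]; abel
  · simp only [map_sub, hx, hDX]; abel
  · simp only [map_sub, hy, hDY]; abel

end SplittingOperators

end DegreeTwo

/-! ### The invariant derivatives on M_{k,0} are splitting operators. -/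

section Operators

open VectorField

variable {k : ℕ+}

theorem fieldX_eq (p : R4) : fieldX p = (0, 1, 0, 0) + (-p.2.2.1 / 2) • fieldZ p := by
  ext <;> simp [fieldX, fieldZ]

theorem fieldY_eq (p : R4) : fieldY p = (0, 0, 1, 0) + (p.2.1 / 2) • fieldZ p := by
  ext <;> simp [fieldY, fieldZ]

theorem fieldT_eq_smul (p : R4) :
    fieldT p = (2 * Real.pi)⁻¹ • ((2 * Real.pi, 0, 0, 0) : R4) := by
  have := Real.pi_ne_zero
  ext <;> simp [fieldT]; field_simp

theorem opZ_eq_zero_iff {f : periodicFunctions k} :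
    opZ k f = 0 ↔ ∀ p, fderiv ℝ (f : R4 → ℝ) p (0, 0, 0, 1) = 0 :=
  ⟨fun h p => congrFun (congrArg Subtype.val h) p, fun h => Subtype.ext (funext h)⟩

theorem opT_eq_zero_iff {f : periodicFunctions k} :
    opT k f = 0 ↔ ∀ p, fderiv ℝ (f : R4 → ℝ) p (2 * Real.pi, 0, 0, 0) = 0 := by
  have hpi : (2 * Real.pi)⁻¹ ≠ 0 := by have := Real.pi_pos; positivity
  have h : ∀ p, (opT k f : R4 → ℝ) p =
      (2 * Real.pi)⁻¹ * fderiv ℝ (f : R4 → ℝ) p (2 * Real.pi, 0, 0, 0) := fun p => by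
    change fderiv ℝ (f : R4 → ℝ) p (fieldT p) = _
    rw [fieldT_eq_smul, map_smul, smul_eq_mul]
  refine ⟨fun h0 p => ?_, fun h0 => Subtype.ext (funext fun p => ?_)⟩
  · have h1 := h p
    rw [h0] at h1
    exact (mul_eq_zero.1 h1.symm).resolve_left hpi
  · rw [h, h0, mul_zero]; rfl

theorem opX_apply {f : periodicFunctions k} (hf : opZ k f = 0) (p : R4) :
    (opX k f : R4 → ℝ) p = fderiv ℝ (f : R4 → ℝ) p (0, 1, 0, 0) := by
  change fderiv ℝ (f : R4 → ℝ) p (fieldX p) = _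
  rw [fieldX_eq, map_add, map_smul]
  have : fderiv ℝ (f : R4 → ℝ) p (fieldZ p) = 0 := opZ_eq_zero_iff.1 hf p
  rw [this, smul_zero, add_zero]

theorem opY_apply {f : periodicFunctions k} (hf : opZ k f = 0) (p : R4) :
    (opY k f : R4 → ℝ) p = fderiv ℝ (f : R4 → ℝ) p (0, 0, 1, 0) := by
  change fderiv ℝ (f : R4 → ℝ) p (fieldY p) = _
  rw [fieldY_eq, map_add, map_smul]
  have : fderiv ℝ (f : R4 → ℝ) p (fieldZ p) = 0 := opZ_eq_zero_iff.1 hf p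
  rw [this, smul_zero, add_zero]

theorem opX_eq_zero_iff {f : periodicFunctions k} (hf : opZ k f = 0) :
    opX k f = 0 ↔ ∀ p, fderiv ℝ (f : R4 → ℝ) p (0, 1, 0, 0) = 0 :=
  ⟨fun h p => by rw [← opX_apply hf p, h]; rfl,
    fun h => Subtype.ext (funext fun p => by rw [opX_apply hf, h]; rfl)⟩

theorem opY_eq_zero_iff {f : periodicFunctions k} (hf : opZ k f = 0) :
    opY k f = 0 ↔ ∀ p, fderiv ℝ (f : R4 → ℝ) p (0, 0, 1, 0) = 0 :=
  ⟨fun h p => by rw [← opY_apply hf p, h]; rfl,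
    fun h => Subtype.ext (funext fun p => by rw [opY_apply hf, h]; rfl)⟩

theorem opT_apply (f : periodicFunctions k) (p : R4) :
    (opT k f : R4 → ℝ) p = (2 * Real.pi)⁻¹ * fderiv ℝ (f : R4 → ℝ) p (2 * Real.pi, 0, 0, 0) := by
  change fderiv ℝ (f : R4 → ℝ) p (fieldT p) = _
  rw [fieldT_eq_smul, map_smul, smul_eq_mul]

theorem Osc.coord_mk (t : ℝ) (v : Heis) : (Osc.mk t v).coord = (t, v.x, v.y, v.z) := rfl

theorem Osc.act_add_smul (g : Osc) (p u : R4) (s : ℝ) :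
    g.act (p + s • u) = g.act p + s • g.lin u := by
  rw [Osc.act_eq, Osc.act_eq, map_add, map_smul, add_right_comm]

theorem lin_fieldZ_dir (g : Osc) : g.lin (0, 0, 0, 1) = ((0, 0, 0, 1) : R4) :=
  Osc.lin_fieldZ g 0

theorem lin_dirT (g : Osc) (r : ℝ) : g.lin (r, 0, 0, 0) = ((r, 0, 0, 0) : R4) := by
  ext <;> simp [Osc.lin]

theorem lin_dirX {g : Osc} (hg : g ∈ Osc.lattice 4 k) :
    ∃ c : ℝ, g.lin (0, 1, 0, 0) = ((0, 1, 0, 0) + c • (0, 0, 0, 1) : R4) :=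
  ⟨-g.v.y / 2, by
    ext <;> simp [Osc.lin, cos_eq_one_of_mem_lattice hg, sin_eq_zero_of_mem_lattice hg]⟩

theorem lin_dirY {g : Osc} (hg : g ∈ Osc.lattice 4 k) :
    ∃ c : ℝ, g.lin (0, 0, 1, 0) = ((0, 0, 1, 0) + c • (0, 0, 0, 1) : R4) :=
  ⟨g.v.x / 2, by
    ext <;> simp [Osc.lin, cos_eq_one_of_mem_lattice hg, sin_eq_zero_of_mem_lattice hg]⟩

theorem mk_mem_lattice (q k : ℕ+) (a b c : ℤ) : Osc.mk 0 ⟨a, b, c⟩ ∈ Osc.lattice q k := by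
  have hk : ((k : ℕ) : ℝ) ≠ 0 := by exact_mod_cast k.ne_zero
  refine ⟨⟨0, by simp⟩, a, b, 2 * k * c, ?_⟩
  rw [Osc.mk_v]
  ext
  · rfl
  · rfl
  · push_cast; field_simp

theorem two_pi_mem_lattice (k : ℕ+) : Osc.mk (2 * Real.pi) 1 ∈ Osc.lattice 4 k :=
  ⟨⟨1, by rw [Osc.four_mul_half_pi]; simp⟩, one_mem _⟩

theorem periodic_dirZ {f : R4 → ℝ} (hf : f ∈ periodicFunctions k) (p : R4) :
    f (p + (0, 0, 0, 1)) = f p := by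
  rw [← apply_act_of_mem hf (mk_mem_lattice 4 k 0 0 1) p, Osc.act_eq]
  congr 1
  ext <;> simp [Osc.lin, Osc.coord_mk]

theorem periodic_dirT {f : R4 → ℝ} (hf : f ∈ periodicFunctions k) (p : R4) :
    f (p + (2 * Real.pi, 0, 0, 0)) = f p := by
  rw [← apply_act_of_mem hf (two_pi_mem_lattice k) p, Osc.act_eq]
  congr 1
  ext <;> simp [Osc.lin, Osc.coord_mk]

/-- The lattice translation by (0, 1, 0, 0) also moves z by y/2, which is harmless once f does not
depend on z. -/
theorem periodic_dirX {f : R4 → ℝ} (hf : f ∈ periodicFunctions k)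
    (hZ : ∀ p, fderiv ℝ f p (0, 0, 0, 1) = 0) (p : R4) : f (p + (0, 1, 0, 0)) = f p := by
  rw [← apply_act_of_mem hf (mk_mem_lattice 4 k 1 0 0) p, Osc.act_eq,
    ← apply_add_smul_of_fderiv_eq_zero hf.1 hZ _ (p.2.2.1 / 2)]
  congr 1
  ext <;> simp [Osc.lin, Osc.coord_mk]

theorem periodic_dirY {f : R4 → ℝ} (hf : f ∈ periodicFunctions k)
    (hZ : ∀ p, fderiv ℝ f p (0, 0, 0, 1) = 0) (p : R4) : f (p + (0, 0, 1, 0)) = f p := by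
  rw [← apply_act_of_mem hf (mk_mem_lattice 4 k 0 1 0) p, Osc.act_eq,
    ← apply_add_smul_of_fderiv_eq_zero hf.1 hZ _ (-p.2.1 / 2)]
  congr 1
  ext <;> simp [Osc.lin, Osc.coord_mk]

theorem apply_act_add_smul {f : R4 → ℝ} (hf : f ∈ periodicFunctions k)
    {g : Osc} (hg : g ∈ Osc.lattice 4 k) {u : R4} (hu : g.lin u = u) (p : R4) (s : ℝ) :
    f (g.act p + s • u) = f (p + s • u) := by
  rw [← apply_act_of_mem hf hg (p + s • u), Osc.act_add_smul, hu]

/-- The translation changes u by a vertical vector only, and f is constant along it. Averages in the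
direction u therefore stay periodic. -/
theorem apply_act_add_smul_of_fderiv_eq_zero {f : R4 → ℝ} (hf : f ∈ periodicFunctions k)
    (hZ : ∀ p, fderiv ℝ f p (0, 0, 0, 1) = 0) {g : Osc} (hg : g ∈ Osc.lattice 4 k) {u : R4}
    (hu : ∃ c : ℝ, g.lin u = u + c • (0, 0, 0, 1)) (p : R4) (s : ℝ) :
    f (g.act p + s • u) = f (p + s • u) := by
  obtain ⟨c, hc⟩ := hu
  rw [← apply_act_of_mem hf hg (p + s • u), Osc.act_add_smul, hc, smul_add, ← add_assoc, smul_smul,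
    apply_add_smul_of_fderiv_eq_zero hf.1 hZ]

theorem derivAlong_comm {f : R4 → ℝ} (hf : ContDiff ℝ ∞ f) {U W : R4 → R4}
    (hU : ContDiff ℝ ∞ U) (hW : ContDiff ℝ ∞ W) (h : ∀ p, lieBracket ℝ U W p = 0) :
    derivAlong U (derivAlong W f) = derivAlong W (derivAlong U f) := by
  rw [← sub_eq_zero, derivAlong_derivAlong_sub hf hU hW]
  funext p
  simp [derivAlong, h]

/-- Commutation comes from the brackets, splitting from averages over one period, and the `nil`
fields from periodicity. The direction Z has to come first: only for functions independent of z are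
the coordinate directions x and y periods, and do X and Y reduce to ∂/∂x and ∂/∂y. -/
theorem splittingOperators (k : ℕ+) : SplittingOperators (opT k) (opX k) (opY k) (opZ k) where
  TX f := Subtype.ext (derivAlong_comm f.2.1 contDiff_fieldT contDiff_fieldX
    lieBracket_fieldT_fieldX)
  TY f := Subtype.ext (derivAlong_comm f.2.1 contDiff_fieldT contDiff_fieldY
    lieBracket_fieldT_fieldY)
  TZ f := Subtype.ext (derivAlong_comm f.2.1 contDiff_fieldT contDiff_fieldZ
    lieBracket_fieldT_fieldZ)
  XZ f := Subtype.ext (derivAlong_comm f.2.1 contDiff_fieldX contDiff_fieldZ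
    lieBracket_fieldX_fieldZ)
  YZ f := Subtype.ext (derivAlong_comm f.2.1 contDiff_fieldY contDiff_fieldZ
    lieBracket_fieldY_fieldZ)
  XY f := Subtype.ext ((derivAlong_derivAlong_sub f.2.1 contDiff_fieldX contDiff_fieldY).trans
    (congrArg (derivAlong · _) (funext lieBracket_fieldX_fieldY)))
  splitZ f := by
    obtain ⟨a, ha, b, hb, hab, h0, -⟩ := exists_eq_add_fderiv f.2 (periodic_dirZ f.2)
      fun g hg => apply_act_add_smul f.2 hg (lin_fieldZ_dir g)
    exact ⟨⟨a, ha⟩, ⟨b, hb⟩, Subtype.ext (funext hab), opZ_eq_zero_iff.2 h0⟩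
  splitY f hZ := by
    have hZ' := opZ_eq_zero_iff.1 hZ
    obtain ⟨a, ha, b, hb, hab, h0, hk⟩ := exists_eq_add_fderiv f.2 (periodic_dirY f.2 hZ')
      fun g hg => apply_act_add_smul_of_fderiv_eq_zero f.2 hZ' hg (lin_dirY hg)
    have haZ : opZ k ⟨a, ha⟩ = 0 := opZ_eq_zero_iff.2 fun p => (hk _ hZ' p).1
    have hbZ : opZ k ⟨b, hb⟩ = 0 := opZ_eq_zero_iff.2 fun p => (hk _ hZ' p).2
    refine ⟨⟨a, ha⟩, ⟨b, hb⟩, Subtype.ext (funext fun p => ?_), haZ,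
      (opY_eq_zero_iff haZ).2 h0, hbZ⟩
    exact (hab p).trans (congrArg (a p + ·) (opY_apply hbZ p).symm)
  splitX f hZ hY := by
    have hZ' := opZ_eq_zero_iff.1 hZ
    have hY' := (opY_eq_zero_iff hZ).1 hY
    obtain ⟨a, ha, b, hb, hab, h0, hk⟩ := exists_eq_add_fderiv f.2 (periodic_dirX f.2 hZ')
      fun g hg => apply_act_add_smul_of_fderiv_eq_zero f.2 hZ' hg (lin_dirX hg)
    have haZ : opZ k ⟨a, ha⟩ = 0 := opZ_eq_zero_iff.2 fun p => (hk _ hZ' p).1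
    have hbZ : opZ k ⟨b, hb⟩ = 0 := opZ_eq_zero_iff.2 fun p => (hk _ hZ' p).2
    refine ⟨⟨a, ha⟩, ⟨b, hb⟩, Subtype.ext (funext fun p => ?_), haZ,
      (opY_eq_zero_iff haZ).2 fun p => (hk _ hY' p).1, (opX_eq_zero_iff haZ).2 h0, hbZ,
      (opY_eq_zero_iff hbZ).2 fun p => (hk _ hY' p).2⟩
    exact (hab p).trans (congrArg (a p + ·) (opX_apply hbZ p).symm)
  splitT f hZ hY hX := by
    have hZ' := opZ_eq_zero_iff.1 hZ
    have hY' := (opY_eq_zero_iff hZ).1 hY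
    have hX' := (opX_eq_zero_iff hZ).1 hX
    obtain ⟨a, ha, b, hb, hab, h0, hk⟩ := exists_eq_add_fderiv f.2 (periodic_dirT f.2)
      fun g hg => apply_act_add_smul f.2 hg (lin_dirT g _)
    have haZ : opZ k ⟨a, ha⟩ = 0 := opZ_eq_zero_iff.2 fun p => (hk _ hZ' p).1
    have hbZ : opZ k ⟨b, hb⟩ = 0 := opZ_eq_zero_iff.2 fun p => (hk _ hZ' p).2
    have hpi : (2 * Real.pi) ≠ 0 := by have := Real.pi_pos; positivity
    -- The splitting is along the period 2π ∂/∂t whereas the operator is ∂/∂t; hence the factor 2π.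
    refine ⟨⟨a, ha⟩, (2 * Real.pi) • ⟨b, hb⟩, Subtype.ext (funext fun p => ?_), haZ,
      (opY_eq_zero_iff haZ).2 fun p => (hk _ hY' p).1,
      (opX_eq_zero_iff haZ).2 fun p => (hk _ hX' p).1, opT_eq_zero_iff.2 h0, ?_, ?_, ?_⟩
    · rw [map_smul]
      refine (hab p).trans (congrArg (a p + ·) ?_)
      change _ = 2 * Real.pi * (opT k ⟨b, hb⟩ : R4 → ℝ) p
      rw [opT_apply, mul_inv_cancel_left₀ hpi]
    · rw [map_smul, hbZ, smul_zero]
    · rw [map_smul, (opY_eq_zero_iff hbZ).2 fun p => (hk _ hY' p).2, smul_zero]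
    · rw [map_smul, (opX_eq_zero_iff hbZ).2 fun p => (hk _ hX' p).2, smul_zero]
  nilZ f h := opZ_eq_zero_iff.2
    (fderiv_apply_eq_zero_of_periodic f.2.1 (periodic_dirZ f.2) (opZ_eq_zero_iff.1 h))
  nilY f hZ h := by
    have hZY : opZ k (opY k f) = 0 := by
      have : opY k (opZ k f) = opZ k (opY k f) := Subtype.ext (derivAlong_comm f.2.1
        contDiff_fieldY contDiff_fieldZ lieBracket_fieldY_fieldZ)
      rw [← this, hZ, map_zero]
    refine (opY_eq_zero_iff hZ).2 (fderiv_apply_eq_zero_of_periodic f.2.1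
      (periodic_dirY f.2 (opZ_eq_zero_iff.1 hZ)) ?_)
    have h1 := (opY_eq_zero_iff hZY).1 h
    rwa [funext (opY_apply hZ)] at h1
  nilX f hZ hY h := by
    have hZX : opZ k (opX k f) = 0 := by
      have : opX k (opZ k f) = opZ k (opX k f) := Subtype.ext (derivAlong_comm f.2.1
        contDiff_fieldX contDiff_fieldZ lieBracket_fieldX_fieldZ)
      rw [← this, hZ, map_zero]
    refine (opX_eq_zero_iff hZ).2 (fderiv_apply_eq_zero_of_periodic f.2.1
      (periodic_dirX f.2 (opZ_eq_zero_iff.1 hZ)) ?_)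
    have h1 := (opX_eq_zero_iff hZX).1 h
    rwa [funext (opX_apply hZ)] at h1
  nilT f hZ hY hX h := by
    refine opT_eq_zero_iff.2 (fderiv_apply_eq_zero_of_periodic f.2.1 (periodic_dirT f.2) ?_)
    have hpi : (2 * Real.pi) ≠ 0 := by have := Real.pi_pos; positivity
    have h1 : opT k ((2 * Real.pi) • opT k f) = 0 := by rw [map_smul, h, smul_zero]
    have h2 := opT_eq_zero_iff.1 h1
    have h3 : (((2 * Real.pi) • opT k f : periodicFunctions k) : R4 → ℝ) =
        fun p => fderiv ℝ (f : R4 → ℝ) p (2 * Real.pi, 0, 0, 0) := by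
      funext p
      change 2 * Real.pi * (opT k f : R4 → ℝ) p = _
      rw [opT_apply, mul_inv_cancel_left₀ hpi]
    rwa [h3] at h2

end Operators

/-! ### Exactness of closed 2-forms by averaging over deck transformations. -/

section Exactness

variable {n : ℕ} {q k : ℕ+}

/-- A smooth function on `M_{k,0}` all of whose invariant derivatives vanish is constant. -/
theorem exists_eq_const_of_isConstant {f : periodicFunctions k}
    (hf : IsConstant (opT k) (opX k) (opY k) (opZ k) f) : ∃ r : ℝ, ∀ p, (f : R4 → ℝ) p = r := by
  obtain ⟨hZ, hY, hX, hT⟩ := hf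
  refine ⟨(f : R4 → ℝ) 0, fun p => is_const_of_fderiv_eq_zero (𝕜 := ℝ)
    (f.2.1.differentiable (by simp)) (fun p => ?_) p 0⟩
  have h1 : fderiv ℝ (f : R4 → ℝ) p (fieldT p) = 0 := congrFun (congrArg Subtype.val hT) p
  have h2 : fderiv ℝ (f : R4 → ℝ) p (fieldX p) = 0 := congrFun (congrArg Subtype.val hX) p
  have h3 : fderiv ℝ (f : R4 → ℝ) p (fieldY p) = 0 := congrFun (congrArg Subtype.val hY) p
  have h4 : fderiv ℝ (f : R4 → ℝ) p (fieldZ p) = 0 := congrFun (congrArg Subtype.val hZ) p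
  refine ContinuousLinearMap.ext fun u => ?_
  rw [eq_frame_combination p u]
  simp [h1, h2, h3, h4]

theorem FormR4.IsPeriodic.mono {q' : ℕ+} {ξ : FormR4 n} (hξ : FormR4.IsPeriodic q k ξ)
    (h : Osc.lattice q' k ≤ Osc.lattice q k) : FormR4.IsPeriodic q' k ξ :=
  fun g hg => hξ g (h hg)

theorem FormR4.coeff_mem_periodicFunctions {ξ : FormR4 2} (hξ : ContDiff ℝ ∞ ξ)
    (hper : FormR4.IsPeriodic 4 k ξ) :
    ξ.coeff fieldT fieldX ∈ periodicFunctions k ∧ ξ.coeff fieldT fieldY ∈ periodicFunctions k ∧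
    ξ.coeff fieldT fieldZ ∈ periodicFunctions k ∧ ξ.coeff fieldX fieldY ∈ periodicFunctions k ∧
    ξ.coeff fieldX fieldZ ∈ periodicFunctions k ∧ ξ.coeff fieldY fieldZ ∈ periodicFunctions k := by
  have h : ∀ g ∈ Osc.lattice 4 k, ∀ p, _ := fun g hg p => FormR4.coeff_translate g ξ p
  refine ⟨⟨FormR4.contDiff_coeff hξ contDiff_fieldT contDiff_fieldX, fun g hg p => ?_⟩,
    ⟨FormR4.contDiff_coeff hξ contDiff_fieldT contDiff_fieldY, fun g hg p => ?_⟩,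
    ⟨FormR4.contDiff_coeff hξ contDiff_fieldT contDiff_fieldZ, fun g hg p => ?_⟩,
    ⟨FormR4.contDiff_coeff hξ contDiff_fieldX contDiff_fieldY, fun g hg p => ?_⟩,
    ⟨FormR4.contDiff_coeff hξ contDiff_fieldX contDiff_fieldZ, fun g hg p => ?_⟩,
    ⟨FormR4.contDiff_coeff hξ contDiff_fieldY contDiff_fieldZ, fun g hg p => ?_⟩⟩ <;>
  · have h := FormR4.coeff_translate g ξ p
    rw [hper g hg, cos_eq_one_of_mem_lattice hg, sin_eq_zero_of_mem_lattice hg] at h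
    obtain ⟨h1, h2, h3, h4, h5, h6⟩ := h
    linarith

theorem FormR4.isPeriodic_ofCoeff {ηt ηx ηy ηz : R4 → ℝ} (ht : ηt ∈ periodicFunctions k)
    (hx : ηx ∈ periodicFunctions k) (hy : ηy ∈ periodicFunctions k)
    (hz : ηz ∈ periodicFunctions k) : FormR4.IsPeriodic 4 k (FormR4.ofCoeff ηt ηx ηy ηz) := by
  intro g hg
  funext p
  ext v
  have hv : v = ![v 0] := by funext i; fin_cases i; rfl
  have hv' : g.lin ∘ v = ![g.lin (v 0)] := by funext i; fin_cases i; rfl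
  rw [FormR4.translate, ContinuousAlternatingMap.compContinuousLinearMap_apply, hv',
    FormR4.ofCoeff_apply, Osc.formGamma_act, ht.2 g hg, hx.2 g hg, hy.2 g hg, hz.2 g hg, hv,
    FormR4.ofCoeff_apply]
  simp [Osc.lin, cos_eq_one_of_mem_lattice hg, sin_eq_zero_of_mem_lattice hg]

/-- A closed `2`-form on `M_{k,0}` is cohomologous to a form with constant coefficients. -/
theorem FormR4.exists_primitive {ξ : FormR4 2} (hξ : ContDiff ℝ ∞ ξ)
    (hper : FormR4.IsPeriodic 4 k ξ) (hd : extDeriv ξ = 0) :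
    ∃ (η : FormR4 1) (A B E F : ℝ), ContDiff ℝ ∞ η ∧ FormR4.IsPeriodic 4 k η ∧ ∀ p,
      FormR4.coeff (extDeriv η) fieldT fieldX p = ξ.coeff fieldT fieldX p - A ∧
      FormR4.coeff (extDeriv η) fieldT fieldY p = ξ.coeff fieldT fieldY p - B ∧
      FormR4.coeff (extDeriv η) fieldT fieldZ p = ξ.coeff fieldT fieldZ p ∧
      FormR4.coeff (extDeriv η) fieldX fieldY p = ξ.coeff fieldX fieldY p ∧
      FormR4.coeff (extDeriv η) fieldX fieldZ p = ξ.coeff fieldX fieldZ p - E ∧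
      FormR4.coeff (extDeriv η) fieldY fieldZ p = ξ.coeff fieldY fieldZ p - F := by
  obtain ⟨ma, mb, mc, md, me, mf⟩ := FormR4.coeff_mem_periodicFunctions hξ hper
  obtain ⟨h₁, h₂, h₃, h₄⟩ := FormR4.coeff_equations hξ hd
  obtain ⟨ηt, ηx, ηy, ηz, A, B, E, F, hA, hB, hE, hF, ea, eb, ec, ed, ee, ef⟩ :=
    (splittingOperators k).exists_primitive (a := ⟨_, ma⟩) (b := ⟨_, mb⟩) (c := ⟨_, mc⟩)
      (d := ⟨_, md⟩) (e := ⟨_, me⟩) (f := ⟨_, mf⟩) (Subtype.ext h₁) (Subtype.ext h₂)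
      (Subtype.ext h₃) (Subtype.ext h₄)
  obtain ⟨A', hA⟩ := exists_eq_const_of_isConstant hA
  obtain ⟨B', hB⟩ := exists_eq_const_of_isConstant hB
  obtain ⟨E', hE⟩ := exists_eq_const_of_isConstant hE
  obtain ⟨F', hF⟩ := exists_eq_const_of_isConstant hF
  refine ⟨FormR4.ofCoeff ηt ηx ηy ηz, A', B', E', F',
    FormR4.contDiff_ofCoeff ηt.2.1 ηx.2.1 ηy.2.1 ηz.2.1,
    FormR4.isPeriodic_ofCoeff ηt.2 ηx.2 ηy.2 ηz.2, fun p => ?_⟩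
  obtain ⟨d1, d2, d3, d4, d5, d6⟩ :=
    FormR4.coeff_extDeriv_ofCoeff ηt.2.1 ηx.2.1 ηy.2.1 ηz.2.1
  rw [d1, d2, d3, d4, d5, d6]
  refine ⟨?_, ?_, ?_, ?_, ?_, ?_⟩
  · have h : ξ.coeff fieldT fieldX p = (A : R4 → ℝ) p
      + (derivAlong fieldT ηx - derivAlong fieldX ηt) p := congrFun (congrArg Subtype.val ea) p
    rw [h, hA]; ring
  · have h : ξ.coeff fieldT fieldY p = (B : R4 → ℝ) p
      + (derivAlong fieldT ηy - derivAlong fieldY ηt) p := congrFun (congrArg Subtype.val eb) p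
    rw [h, hB]; ring
  · exact (congrFun (congrArg Subtype.val ec) p).symm
  · exact (congrFun (congrArg Subtype.val ed) p).symm
  · have h : ξ.coeff fieldX fieldZ p = (E : R4 → ℝ) p
      + (derivAlong fieldX ηz - derivAlong fieldZ ηx) p := congrFun (congrArg Subtype.val ee) p
    rw [h, hE]; ring
  · have h : ξ.coeff fieldY fieldZ p = (F : R4 → ℝ) p
      + (derivAlong fieldY ηz - derivAlong fieldZ ηy) p := congrFun (congrArg Subtype.val ef) p
    rw [h, hF]; ring

/-- The mean of a form and of its translate by `q π / 2`. -/
def FormR4.meanShift (q : ℕ) (η : FormR4 n) : FormR4 n :=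
  (2⁻¹ : ℝ) • (η + η.translate (Osc.shift q))

theorem FormR4.contDiff_meanShift (q : ℕ) {η : FormR4 n} (hη : ContDiff ℝ ∞ η) :
    ContDiff ℝ ∞ (η.meanShift q) :=
  (hη.add (FormR4.contDiff_translate _ hη)).const_smul (2⁻¹ : ℝ)

theorem FormR4.extDeriv_meanShift (q : ℕ) {η : FormR4 n} (hη : ContDiff ℝ ∞ η) :
    extDeriv (η.meanShift q) = FormR4.meanShift q (extDeriv η) := by
  have h1 : Differentiable ℝ η := hη.differentiable (by simp)
  have h2 : Differentiable ℝ (η.translate (Osc.shift q)) :=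
    (FormR4.contDiff_translate _ hη).differentiable (by simp)
  funext p
  rw [FormR4.meanShift, extDeriv_smul, extDeriv_add (h1 p) (h2 p),
    FormR4.extDeriv_translate _ h1]
  rfl

theorem FormR4.meanShift_eq_self {ξ : FormR4 n} (hξ : FormR4.IsPeriodic q k ξ) :
    ξ.meanShift q = ξ := by
  have h := Osc.shift_mem_lattice q k 1
  rw [one_mul] at h
  rw [FormR4.meanShift, hξ _ h, ← two_smul ℝ, inv_smul_smul₀ two_ne_zero]

theorem FormR4.isPeriodic_meanShift {η : FormR4 n} (hη : FormR4.IsPeriodic (q * 2) k η) :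
    FormR4.IsPeriodic q k (η.meanShift q) := by
  set h := Osc.shift q with hh
  have hmem : h ∈ Osc.lattice q k := by simpa using Osc.shift_mem_lattice q k 1
  have hht : h.t = q * (Real.pi / 2) := rfl
  have h2 : (((2 : ℕ+) : ℕ) : ℤ) = 2 := rfl
  intro g hg
  obtain ⟨l, hl⟩ := hg.1
  unfold FormR4.meanShift
  rw [FormR4.translate_smul, FormR4.translate_add, ← FormR4.translate_mul]
  congr 1
  -- The lattice for q * 2 has index two, and h represents the other coset. For l even, g and its
  -- conjugate by h lie in the sublattice and both summands are fixed; for l odd, they are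
  -- exchanged.
  rcases Int.even_or_odd' l with ⟨r, rfl | rfl⟩
  · have h3 : g ∈ Osc.lattice (q * 2) k :=
      (Osc.mem_lattice_mul_iff hl hg.2).2 ⟨r, by rw [h2]⟩
    have h4 : h * g * h⁻¹ ∈ Osc.lattice (q * 2) k :=
      (Osc.mem_lattice_mul_iff (l := 2 * r) (by simp [hl])
        (mul_mem (mul_mem hmem hg) (inv_mem hmem)).2).2 ⟨r, by rw [h2]⟩
    rw [hη g h3, show h * g = (h * g * h⁻¹) * h by group, FormR4.translate_mul, hη _ h4]
  · have h3 : g * h⁻¹ ∈ Osc.lattice (q * 2) k :=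
      (Osc.mem_lattice_mul_iff (l := 2 * r) (by
          simp only [Osc.mul_t, Osc.inv_t, hl, hht]; push_cast; ring)
        (mul_mem hg (inv_mem hmem)).2).2 ⟨r, by rw [h2]⟩
    have h4 : h * g ∈ Osc.lattice (q * 2) k :=
      (Osc.mem_lattice_mul_iff (l := 2 * (r + 1)) (by
          simp only [Osc.mul_t, hl, hht]; push_cast; ring)
        (mul_mem hmem hg).2).2 ⟨r + 1, by rw [h2]⟩
    rw [hη _ h4, show g = (g * h⁻¹) * h by group, FormR4.translate_mul, hη _ h3, add_comm]

/-- Every closed `2`-form on `M_{k,π}` is exact. -/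
theorem FormR4.exists_extDeriv_eq_two {ξ : FormR4 2} (hξ : ContDiff ℝ ∞ ξ)
    (hper : FormR4.IsPeriodic 2 k ξ) (hd : extDeriv ξ = 0) :
    ∃ η : FormR4 1, ContDiff ℝ ∞ η ∧ FormR4.IsPeriodic 2 k η ∧ extDeriv η = ξ := by
  have h22 : (2 * 2 : ℕ+) = 4 := rfl
  have hper4 : FormR4.IsPeriodic 4 k ξ := hper.mono (h22 ▸ Osc.lattice_mul_le 2 2 k)
  obtain ⟨η, A, B, E, F, hη, hηp, hc⟩ := FormR4.exists_primitive hξ hper4 hd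
  refine ⟨η.meanShift 2, FormR4.contDiff_meanShift 2 hη,
    FormR4.isPeriodic_meanShift (q := 2) (by rw [h22]; exact hηp), ?_⟩
  rw [FormR4.extDeriv_meanShift 2 hη]
  have ht : (Osc.shift 2).t = Real.pi := by
    simp [Osc.shift]; ring
  have hadd : ∀ (U W : R4 → R4) (p : R4), FormR4.coeff (FormR4.meanShift 2 (extDeriv η)) U W p =
      2⁻¹ * (FormR4.coeff (extDeriv η) U W p +
        FormR4.coeff (FormR4.translate (Osc.shift 2) (extDeriv η)) U W p) := fun _ _ _ => rfl
  have hsh : Osc.shift 2 ∈ Osc.lattice 2 k := Osc.shift_mem_lattice 2 k 1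
  -- The rotation by π reverses X and Y: the coefficients on TX, TY, XZ, YZ change sign, those on TZ
  -- and XY do not. As ξ itself is invariant, A, B, E and F enter the two summands of the mean with
  -- opposite signs and cancel.
  have key : ∀ p, _ := fun p => FormR4.coeff_translate (Osc.shift 2) ξ p
  have key' : ∀ p, _ := fun p => FormR4.coeff_translate (Osc.shift 2) (extDeriv η) p
  rw [hper _ hsh, ht, Real.cos_pi, Real.sin_pi] at key
  rw [ht, Real.cos_pi, Real.sin_pi] at key'
  refine FormR4.ext_coeff ?_ ?_ ?_ ?_ ?_ ?_ <;> funext p <;>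
  · obtain ⟨a1, a2, a3, a4, a5, a6⟩ := key p
    obtain ⟨b1, b2, b3, b4, b5, b6⟩ := key' p
    obtain ⟨c1, c2, c3, c4, c5, c6⟩ := hc p
    obtain ⟨d1, d2, d3, d4, d5, d6⟩ := hc ((Osc.shift 2).act p)
    rw [hadd]
    linarith

/-- Every closed `2`-form on `M_{k,π/2}` is exact. -/
theorem FormR4.exists_extDeriv_eq_one {ξ : FormR4 2} (hξ : ContDiff ℝ ∞ ξ)
    (hper : FormR4.IsPeriodic 1 k ξ) (hd : extDeriv ξ = 0) :
    ∃ η : FormR4 1, ContDiff ℝ ∞ η ∧ FormR4.IsPeriodic 1 k η ∧ extDeriv η = ξ := by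
  have h12 : (1 * 2 : ℕ+) = 2 := rfl
  obtain ⟨η, hη, hηp, hdη⟩ := FormR4.exists_extDeriv_eq_two hξ
    (hper.mono (h12 ▸ Osc.lattice_mul_le 1 2 k)) hd
  -- The primitive found for M_{k,π} need not descend to M_{k,π/2}, but its mean does, and ξ is its
  -- own mean.
  refine ⟨η.meanShift 1, FormR4.contDiff_meanShift 1 hη,
    FormR4.isPeriodic_meanShift (q := 1) (by rw [h12]; exact hηp), ?_⟩
  rw [FormR4.extDeriv_meanShift 1 hη, hdη]
  exact FormR4.meanShift_eq_self (q := 1) hper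

end Exactness

/-! ### Divergences on M_{k,0} and degeneracy of exact 2-forms. -/

section Stokes

/-- A divergence of periodic functions is not everywhere positive. -/
theorem exists_sum_fderiv_nonpos {E : Type} [NormedAddCommGroup E] [NormedSpace ℝ E]
    [FiniteDimensional ℝ E] {n : ℕ} (w : Fin n → E) (G : Fin n → E → ℝ)
    (hG : ∀ i, ContDiff ℝ ∞ (G i)) (hper : ∀ i j p, G i (p + w j) = G i p) :
    ∃ p, ∑ i, fderiv ℝ (G i) p (w i) ≤ 0 := by
  induction n with
  | zero => exact ⟨0, by simp⟩
  | succ n ih =>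
    by_contra! hpos
    -- Averaging along w 0 kills the first summand and keeps the other functions periodic, while an
    -- everywhere positive sum would stay positive.
    obtain ⟨p, hp⟩ := ih (fun i => w i.succ)
      (fun i => segmentAverage (fun _ => 1) (w 0) (G i.succ))
      (fun i => contDiff_segmentAverage continuous_const _ (hG _)) (fun i j p => by
        simp only [segmentAverage]
        congr 1
        funext s
        rw [add_right_comm, hper])
    have hcont : ∀ i, Continuous fun p => fderiv ℝ (G i) p (w i) := fun i => by
      have := (hG i).continuous_fderiv (by simp)
      fun_prop
    have h1 := segmentAverage_one_pos (w 0) (continuous_finsetSum _ fun i _ => hcont i) hpos p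
    have h2 : segmentAverage (fun _ => 1) (w 0) (fun p => ∑ i, fderiv ℝ (G i) p (w i)) p =
        ∑ i, fderiv ℝ (segmentAverage (fun _ => 1) (w 0) (G i)) p (w i) := by
      simp only [fderiv_segmentAverage_apply (φ := fun _ => 1) continuous_const (w 0) (hG _)]
      simp only [segmentAverage, one_smul]
      refine intervalIntegral.integral_finsetSum fun i _ => ?_
      have := hcont i
      exact Continuous.intervalIntegrable (by fun_prop) _ _
    rw [h2, Fin.sum_univ_succ, fderiv_segmentAverage_one_apply_self _ (hG 0)
      (hper 0 0), zero_add] at h1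
    exact hp.not_gt h1

variable {k : ℕ+}

/-- U does not vary along w, so it can be moved under the integral. -/
theorem derivAlong_segmentAverage {U : R4 → R4} {w : R4}
    (hU : ∀ (p : R4) (s : ℝ), U (p + s • w) = U p)
    {f : R4 → ℝ} (hf : ContDiff ℝ ∞ f) (p : R4) :
    derivAlong U (segmentAverage (fun _ => 1) w f) p =
      segmentAverage (fun _ => 1) w (derivAlong U f) p := by
  rw [derivAlong, fderiv_segmentAverage_apply continuous_const w hf]
  simp only [segmentAverage, derivAlong, hU]

theorem segmentAverage_mem_periodicFunctions {f : R4 → ℝ} (hf : f ∈ periodicFunctions k) :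
    segmentAverage (fun _ => 1) (0, 0, 0, 1) f ∈ periodicFunctions k :=
  ⟨contDiff_segmentAverage continuous_const _ hf.1, fun g hg p => by
    simp only [segmentAverage, apply_act_add_smul hf hg (lin_fieldZ_dir g)]⟩

/-- The divergence of a smooth vector field on `M_{k,0}` is not everywhere positive. -/
theorem exists_divergence_nonpos {Vt Vx Vy Vz : R4 → ℝ} (ht : Vt ∈ periodicFunctions k)
    (hx : Vx ∈ periodicFunctions k) (hy : Vy ∈ periodicFunctions k)
    (hz : Vz ∈ periodicFunctions k) :
    ∃ p, derivAlong fieldT Vt p + derivAlong fieldX Vx p + derivAlong fieldY Vy p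
      + derivAlong fieldZ Vz p ≤ 0 := by
  by_contra! hpos
  -- Averaging over z removes the Z-term and turns X and Y into ∂/∂x and ∂/∂y, so a divergence on
  -- the torus with periods 2π, 1, 1 is left.
  let A : (R4 → ℝ) → R4 → ℝ := segmentAverage (fun _ => 1) (0, 0, 0, 1)
  have hA : ∀ {f}, f ∈ periodicFunctions k → A f ∈ periodicFunctions k :=
    segmentAverage_mem_periodicFunctions
  have hAZ : ∀ {f}, f ∈ periodicFunctions k → ∀ p, fderiv ℝ (A f) p (0, 0, 0, 1) = 0 :=
    fun hf => fderiv_segmentAverage_one_apply_self _ hf.1 (periodic_dirZ hf)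
  have hZ : ∀ {f} (hf : f ∈ periodicFunctions k), opZ k ⟨A f, hA hf⟩ = 0 :=
    fun hf => opZ_eq_zero_iff.2 (hAZ hf)
  obtain ⟨p, hp⟩ := exists_sum_fderiv_nonpos
    (w := ![((2 * Real.pi, 0, 0, 0) : R4), (0, 1, 0, 0), (0, 0, 1, 0)])
    (G := ![(2 * Real.pi)⁻¹ • A Vt, A Vx, A Vy])
    (fun i => by
      fin_cases i
      exacts [contDiff_const.smul (hA ht).1, (hA hx).1, (hA hy).1])
    (fun i j p => by
      have key : ∀ {f}, f ∈ periodicFunctions k → ∀ j : Fin 3, A f (p +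
          (![((2 * Real.pi, 0, 0, 0) : R4), (0, 1, 0, 0), (0, 0, 1, 0)] : Fin 3 → R4) j)
          = A f p := by
        intro f hf j
        fin_cases j
        exacts [periodic_dirT (hA hf) p, periodic_dirX (hA hf) (hAZ hf) p,
          periodic_dirY (hA hf) (hAZ hf) p]
      fin_cases i
      exacts [congrArg ((2 * Real.pi)⁻¹ * ·) (key ht j), key hx j, key hy j])
  refine hp.not_gt ?_
  have eT : fderiv ℝ ((2 * Real.pi)⁻¹ • A Vt) p (2 * Real.pi, 0, 0, 0) =
      A (derivAlong fieldT Vt) p := by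
    rw [fderiv_const_smul ((hA ht).1.differentiable (by simp) p)]
    exact (opT_apply ⟨A Vt, hA ht⟩ p).symm.trans
      (derivAlong_segmentAverage (fun _ _ => rfl) ht.1 p)
  have eX : fderiv ℝ (A Vx) p (0, 1, 0, 0) = A (derivAlong fieldX Vx) p :=
    (opX_apply (hZ hx) p).symm.trans (derivAlong_segmentAverage (by simp [fieldX]) hx.1 p)
  have eY : fderiv ℝ (A Vy) p (0, 0, 1, 0) = A (derivAlong fieldY Vy) p :=
    (opY_apply (hZ hy) p).symm.trans (derivAlong_segmentAverage (by simp [fieldY]) hy.1 p)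
  have eZ : A (derivAlong fieldZ Vz) p = 0 :=
    (derivAlong_segmentAverage (U := fieldZ) (fun _ _ => rfl) hz.1 p).symm.trans (hAZ hz p)
  have cT := (ht.1.derivAlong contDiff_fieldT).continuous
  have cX := (hx.1.derivAlong contDiff_fieldX).continuous
  have cY := (hy.1.derivAlong contDiff_fieldY).continuous
  have cZ := (hz.1.derivAlong contDiff_fieldZ).continuous
  have h := segmentAverage_one_pos (0, 0, 0, 1) (((cT.add cX).add cY).add cZ) hpos p
  rw [Fin.sum_univ_three]
  change 0 < fderiv ℝ ((2 * Real.pi)⁻¹ • A Vt) p (2 * Real.pi, 0, 0, 0)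
    + fderiv ℝ (A Vx) p (0, 1, 0, 0) + fderiv ℝ (A Vy) p (0, 0, 1, 0)
  -- The averaged Z-term is put back as a vanishing summand. The rewrite also hits the zero on the
  -- left of the inequality, which the next line restores.
  rw [eT, eX, eY, ← add_zero (_ + _ + _), ← eZ]
  conv_lhs => rw [eZ]
  refine h.trans_eq ?_
  have hint : ∀ {f : R4 → ℝ}, Continuous f → IntervalIntegrable
      (fun s : ℝ => f (p + s • (0, 0, 0, 1))) MeasureTheory.volume 0 1 :=
    fun hf => Continuous.intervalIntegrable (by fun_prop) _ _
  simp only [A, segmentAverage, one_smul, Pi.add_apply]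
  rw [intervalIntegral.integral_add (((hint cT).add (hint cX)).add (hint cY)) (hint cZ),
    intervalIntegral.integral_add ((hint cT).add (hint cX)) (hint cY),
    intervalIntegral.integral_add (hint cT) (hint cX)]

theorem derivAlong_neg (U : R4 → R4) (f : R4 → ℝ) : derivAlong U (-f) = -derivAlong U f := by
  funext p
  simp [derivAlong, fderiv_neg]

/-- The product rule in the shape of a coefficient of η∧ξ, an alternating sum of three products. -/
theorem derivAlong_mul_sub_mul_add_mul {a₁ a₂ a₃ b₁ b₂ b₃ : R4 → ℝ} (ha₁ : ContDiff ℝ ∞ a₁)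
    (ha₂ : ContDiff ℝ ∞ a₂) (ha₃ : ContDiff ℝ ∞ a₃) (hb₁ : ContDiff ℝ ∞ b₁)
    (hb₂ : ContDiff ℝ ∞ b₂) (hb₃ : ContDiff ℝ ∞ b₃) (U : R4 → R4) (p : R4) :
    derivAlong U (a₁ * b₁ - a₂ * b₂ + a₃ * b₃) p =
      (derivAlong U a₁ p * b₁ p + a₁ p * derivAlong U b₁ p)
        - (derivAlong U a₂ p * b₂ p + a₂ p * derivAlong U b₂ p)
        + (derivAlong U a₃ p * b₃ p + a₃ p * derivAlong U b₃ p) := by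
  have h₁ : ContDiff ℝ ∞ (a₁ * b₁) := ha₁.mul hb₁
  have h₂ : ContDiff ℝ ∞ (-(a₂ * b₂)) := (ha₂.mul hb₂).neg
  have h₃ : ContDiff ℝ ∞ (a₃ * b₃) := ha₃.mul hb₃
  rw [sub_eq_add_neg, derivAlong_add' (f := a₁ * b₁ + -(a₂ * b₂)) (h₁.add h₂) h₃,
    derivAlong_add' h₁ h₂, derivAlong_neg, derivAlong_mul ha₁ hb₁,
    derivAlong_mul ha₂ hb₂, derivAlong_mul ha₃ hb₃]
  simp only [Pi.add_apply, Pi.neg_apply, Pi.mul_apply]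
  ring

/-- The function `p ↦ η_p (U_p)`. -/
def FormR4.coeffOne (η : FormR4 1) (U : R4 → R4) : R4 → ℝ := fun p => η p ![U p]

theorem alternating_one_apply {θ : R4 [⋀^Fin 1]→L[ℝ] ℝ} (p u : R4) :
    θ ![u] = θ ![fieldT p] * u.1 + θ ![fieldX p] * u.2.1 + θ ![fieldY p] * u.2.2.1
      + θ ![fieldZ p] * formGamma p u := by
  have hadd : ∀ u w : R4, θ ![u + w] = θ ![u] + θ ![w] := fun u w =>
    θ.toMultilinearMap.cons_add ![] u w
  have hsmul : ∀ (r : ℝ) (u : R4), θ ![r • u] = r * θ ![u] := fun r u =>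
    θ.toMultilinearMap.cons_smul ![] r u
  conv_lhs => rw [eq_frame_combination p u]
  simp only [hadd, hsmul]
  ring

theorem FormR4.eq_ofCoeff (η : FormR4 1) : η = FormR4.ofCoeff (η.coeffOne fieldT)
    (η.coeffOne fieldX) (η.coeffOne fieldY) (η.coeffOne fieldZ) := by
  funext p
  ext v
  have hv : v = ![v 0] := by funext i; fin_cases i; rfl
  rw [hv, FormR4.ofCoeff_apply, alternating_one_apply p (v 0)]
  rfl

theorem FormR4.coeffOne_mem_periodicFunctions {η : FormR4 1} (hη : ContDiff ℝ ∞ η)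
    (hper : FormR4.IsPeriodic 4 k η) {U : R4 → R4} (hU : ContDiff ℝ ∞ U)
    (hinv : ∀ g ∈ Osc.lattice 4 k, ∀ p, g.lin (U p) = U (g.act p)) :
    η.coeffOne U ∈ periodicFunctions k := by
  refine ⟨?_, fun g hg p => ?_⟩
  · have hc : ∀ u : R4, ContDiff ℝ ∞ fun p => η p ![u] := fun u =>
      ((ContinuousMultilinearMap.apply ℝ (fun _ : Fin 1 => R4) ℝ ![u]).comp
        (ContinuousAlternatingMap.toContinuousMultilinearMapCLM ℝ)).contDiff.comp hη
    have h : η.coeffOne U = fun p => _ := funext fun p => alternating_one_apply 0 (U p)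
    rw [h]
    unfold formGamma
    have h1 := hc (fieldT 0)
    have h2 := hc (fieldX 0)
    have h3 := hc (fieldY 0)
    have h4 := hc (fieldZ 0)
    refine (((h1.mul ?_).add (h2.mul ?_)).add (h3.mul ?_)).add (h4.mul ?_) <;>
      clear h1 h2 h3 h4 h hc hη hper <;> fun_prop
  · have h : FormR4.coeffOne (η.translate g) U p = η.coeffOne U p := by rw [hper g hg]
    rw [← h, FormR4.coeffOne, FormR4.coeffOne, FormR4.translate,
      ContinuousAlternatingMap.compContinuousLinearMap_apply, ← hinv g hg]
    congr 1
    funext i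
    fin_cases i
    rfl

/-- The Pfaffian of a `2`-form in the frame `∂t, X, Y, Z`. -/
def FormR4.pfaffian (ξ : FormR4 2) : R4 → ℝ :=
  ξ.coeff fieldT fieldX * ξ.coeff fieldY fieldZ - ξ.coeff fieldT fieldY * ξ.coeff fieldX fieldZ
    + ξ.coeff fieldT fieldZ * ξ.coeff fieldX fieldY

theorem FormR4.apply_frame (ξ : FormR4 2) (p u w : R4) :
    ξ p ![u, w] = ξ.coeff fieldT fieldX p * (u.1 * w.2.1 - w.1 * u.2.1)
      + ξ.coeff fieldT fieldY p * (u.1 * w.2.2.1 - w.1 * u.2.2.1)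
      + ξ.coeff fieldT fieldZ p * (u.1 * formGamma p w - w.1 * formGamma p u)
      + ξ.coeff fieldX fieldY p * (u.2.1 * w.2.2.1 - w.2.1 * u.2.2.1)
      + ξ.coeff fieldX fieldZ p * (u.2.1 * formGamma p w - w.2.1 * formGamma p u)
      + ξ.coeff fieldY fieldZ p * (u.2.2.1 * formGamma p w - w.2.2.1 * formGamma p u) :=
  alternating_two_apply_frame (ξ p) p u w

/-- A `2`-form is nondegenerate where its Pfaffian does not vanish, and only there. -/
theorem FormR4.nondegenerate_iff (ξ : FormR4 2) (p : R4) :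
    (∀ v : R4, (∀ w : R4, ξ p ![v, w] = 0) → v = 0) ↔ ξ.pfaffian p ≠ 0 := by
  have hγ : ∀ α β γ δ : ℝ, formGamma p (α, β, γ, δ + (p.2.1 * γ - p.2.2.1 * β) / 2) = δ := by
    intro α β γ δ; simp [formGamma]
  have hpf : ξ.pfaffian p = ξ.coeff fieldT fieldX p * ξ.coeff fieldY fieldZ p
    - ξ.coeff fieldT fieldY p * ξ.coeff fieldX fieldZ p
    + ξ.coeff fieldT fieldZ p * ξ.coeff fieldX fieldY p := rfl
  have hw := ξ.apply_frame p
  rw [hpf]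
  generalize ξ.coeff fieldT fieldX p = a at *
  generalize ξ.coeff fieldT fieldY p = b at *
  generalize ξ.coeff fieldT fieldZ p = c at *
  generalize ξ.coeff fieldX fieldY p = d at *
  generalize ξ.coeff fieldX fieldZ p = e at *
  generalize ξ.coeff fieldY fieldZ p = f at *
  constructor
  -- When the Pfaffian vanishes, the rows of the Pfaffian adjoint matrix, such as (0, f, -e, d), lie
  -- in the kernel. Used in turn, they show that all coefficients are zero, and the zero form is
  -- degenerate.
  · intro h h0
    have key : ∀ α β γ δ : ℝ, (∀ w : R4,
        a * (α * w.2.1 - w.1 * β) + b * (α * w.2.2.1 - w.1 * γ)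
          + c * (α * formGamma p w - w.1 * δ) + d * (β * w.2.2.1 - w.2.1 * γ)
          + e * (β * formGamma p w - w.2.1 * δ)
          + f * (γ * formGamma p w - w.2.2.1 * δ) = 0) → α = 0 ∧ β = 0 ∧ γ = 0 := by
      intro α β γ δ hk
      have := h (α, β, γ, δ + (p.2.1 * γ - p.2.2.1 * β) / 2) fun w => by
        rw [hw, hγ]; exact hk w
      exact ⟨congrArg (·.1) this, congrArg (·.2.1) this, congrArg (·.2.2.1) this⟩
    obtain ⟨-, rfl, he⟩ := key 0 f (-e) d fun w => by linear_combination (-w.1) * h0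
    obtain rfl := neg_eq_zero.1 he
    obtain ⟨-, -, hc⟩ := key 0 0 (-c) b fun w => by linear_combination w.2.1 * h0
    obtain rfl := neg_eq_zero.1 hc
    obtain ⟨rfl, hb, rfl⟩ := key d (-b) a 0 fun w => by linear_combination formGamma p w * h0
    obtain rfl := neg_eq_zero.1 hb
    exact one_ne_zero (key 1 0 0 0 fun w => by ring).1
  · intro h0 v hv
    have e1 := hv (fieldT p)
    have e2 := hv (fieldX p)
    have e3 := hv (fieldY p)
    have e4 := hv (fieldZ p)
    rw [hw] at e1 e2 e3 e4
    generalize hδ : formGamma p v = δ at e1 e2 e3 e4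
    simp only [formGamma, fieldT, fieldX, fieldY, fieldZ] at e1 e2 e3 e4
    -- The same rows express the Pfaffian times each coordinate of v through the four equations.
    have h1 : v.1 = 0 := mul_left_cancel₀ h0 (by linear_combination f * e2 - e * e3 + d * e4)
    have h2 : v.2.1 = 0 := mul_left_cancel₀ h0 (by linear_combination -f * e1 + c * e3 - b * e4)
    have h3 : v.2.2.1 = 0 := mul_left_cancel₀ h0 (by linear_combination e * e1 - c * e2 + a * e4)
    have h4 : δ = 0 := mul_left_cancel₀ h0 (by linear_combination -d * e1 + b * e2 - a * e3)
    rw [eq_frame_combination p v, h1, h2, h3, hδ, h4]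
    simp

/-- An exact `2`-form on `M_{k,0}` is degenerate somewhere. -/
theorem FormR4.exists_pfaffian_eq_zero {ξ : FormR4 2} {η : FormR4 1} (hξ : ContDiff ℝ ∞ ξ)
    (hper : FormR4.IsPeriodic 4 k ξ) (hη : ContDiff ℝ ∞ η) (hηper : FormR4.IsPeriodic 4 k η)
    (h : extDeriv η = ξ) : ∃ p, ξ.pfaffian p = 0 := by
  obtain ⟨ma, mb, mc, md, me, mf⟩ := FormR4.coeff_mem_periodicFunctions hξ hper
  have hd : extDeriv ξ = 0 := by
    rw [← h]
    refine extDeriv_extDeriv hη ?_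
    rw [minSmoothness_of_isRCLikeNormedField]
    exact WithTop.coe_le_coe.2 (le_top : (2 : ℕ∞) ≤ ⊤)
  obtain ⟨c1, c2, c3, c4⟩ := FormR4.coeff_equations hξ hd
  have mt := FormR4.coeffOne_mem_periodicFunctions hη hηper contDiff_fieldT
    fun g _ => Osc.lin_fieldT g
  have mx := FormR4.coeffOne_mem_periodicFunctions hη hηper contDiff_fieldX
    fun g hg => lin_fieldX_of_mem_lattice hg
  have my := FormR4.coeffOne_mem_periodicFunctions hη hηper contDiff_fieldY
    fun g hg => lin_fieldY_of_mem_lattice hg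
  have mz := FormR4.coeffOne_mem_periodicFunctions hη hηper contDiff_fieldZ
    fun g _ => Osc.lin_fieldZ g
  have hE := FormR4.coeff_extDeriv_ofCoeff mt.1 mx.1 my.1 mz.1
  rw [← η.eq_ofCoeff, h] at hE
  obtain ⟨x1, x2, x3, x4, x5, x6⟩ := hE
  have hpf : Continuous ξ.pfaffian := by
    unfold FormR4.pfaffian
    exact ((ma.1.continuous.mul mf.1.continuous).sub (mb.1.continuous.mul me.1.continuous)).add
      (mc.1.continuous.mul md.1.continuous)
  have hpfa : ∀ p, ξ.pfaffian p = ξ.coeff fieldT fieldX p * ξ.coeff fieldY fieldZ p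
    - ξ.coeff fieldT fieldY p * ξ.coeff fieldX fieldZ p
    + ξ.coeff fieldT fieldZ p * ξ.coeff fieldX fieldY p := fun _ => rfl
  generalize η.coeffOne fieldT = ηt at *
  generalize η.coeffOne fieldX = ηx at *
  generalize η.coeffOne fieldY = ηy at *
  generalize η.coeffOne fieldZ = ηz at *
  generalize ξ.coeff fieldT fieldX = a at *
  generalize ξ.coeff fieldT fieldY = b at *
  generalize ξ.coeff fieldT fieldZ = c at *
  generalize ξ.coeff fieldX fieldY = d at *
  generalize ξ.coeff fieldX fieldZ = e at *
  generalize ξ.coeff fieldY fieldZ = f at *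
  have hmem : ∀ {a₁ a₂ a₃ b₁ b₂ b₃ : R4 → ℝ}, a₁ ∈ periodicFunctions k →
      a₂ ∈ periodicFunctions k → a₃ ∈ periodicFunctions k → b₁ ∈ periodicFunctions k →
      b₂ ∈ periodicFunctions k → b₃ ∈ periodicFunctions k →
      a₁ * b₁ - a₂ * b₂ + a₃ * b₃ ∈ periodicFunctions k := fun h1 h2 h3 h4 h5 h6 =>
    add_mem (sub_mem (mul_mem_periodicFunctions h1 h4) (mul_mem_periodicFunctions h2 h5))
      (mul_mem_periodicFunctions h3 h6)
  -- The coefficients of the 3-form η∧ξ on XYZ, TYZ, TXZ and TXY.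
  have m1 := hmem md me mf mz my mx
  have m2 := hmem mb mc mf mz my mt
  have m3 := hmem ma mc me mz mx mt
  have m4 := hmem ma mb md my mx mt
  -- This is d(η∧ξ) = dη∧ξ = ξ∧ξ on (T, X, Y, Z). The terms due to [X, Y] = Z in dη and in dξ = 0
  -- cancel.
  have hdiv : ∀ p, derivAlong fieldT (d * ηz - e * ηy + f * ηx) p
      - derivAlong fieldX (b * ηz - c * ηy + f * ηt) p
      + derivAlong fieldY (a * ηz - c * ηx + e * ηt) p
      - derivAlong fieldZ (a * ηy - b * ηx + d * ηt) p = 2 * ξ.pfaffian p := by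
    intro p
    rw [derivAlong_mul_sub_mul_add_mul md.1 me.1 mf.1 mz.1 my.1 mx.1,
      derivAlong_mul_sub_mul_add_mul mb.1 mc.1 mf.1 mz.1 my.1 mt.1,
      derivAlong_mul_sub_mul_add_mul ma.1 mc.1 me.1 mz.1 mx.1 mt.1,
      derivAlong_mul_sub_mul_add_mul ma.1 mb.1 md.1 my.1 mx.1 mt.1, hpfa]
    replace c1 := congrFun c1 p
    replace c2 := congrFun c2 p
    replace c3 := congrFun c3 p
    replace c4 := congrFun c4 p
    replace x1 := congrFun x1 p
    replace x2 := congrFun x2 p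
    replace x3 := congrFun x3 p
    replace x4 := congrFun x4 p
    replace x5 := congrFun x5 p
    replace x6 := congrFun x6 p
    simp only [Pi.add_apply, Pi.sub_apply, Pi.zero_apply] at c1 c2 c3 c4 x1 x2 x3 x4 x5 x6
    linear_combination ηz p * c1 - ηy p * c2 + ηx p * c3 - ηt p * c4 - d p * x3 + e p * x2
      - f p * x1 + b p * x5 - c p * x4 - a p * x6
  -- Applied to a vector field and to its negative, this gives a point where the Pfaffian is ≤ 0 and
  -- one where it is ≥ 0; ℝ⁴ is connected.
  obtain ⟨p, hp⟩ := exists_divergence_nonpos m1 (neg_mem m2) m3 (neg_mem m4)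
  obtain ⟨p', hp'⟩ := exists_divergence_nonpos (neg_mem m1) m2 (neg_mem m3) m4
  simp only [derivAlong_neg, Pi.neg_apply] at hp hp'
  have h1 := hdiv p
  have h2 := hdiv p'
  exact mem_range_of_exists_le_of_exists_ge hpf ⟨p, by linarith⟩ ⟨p', by linarith⟩

end Stokes

/-! ### Forms invariant under ℝ × H₃(ℝ) or under the oscillator group. -/

section InvariantForms

variable {q k : ℕ+}

/-- The exterior product of two linear forms. -/
def wedgeOne (φ ψ : R4 →L[ℝ] ℝ) : R4 [⋀^Fin 2]→L[ℝ] ℝ :=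
  ContinuousAlternatingMap.alternatizeUncurryFin
    (φ.smulRight (ContinuousAlternatingMap.ofSubsingletonLIE (𝕜 := ℝ) (ι := Fin 1) (0 : Fin 1) ψ))

theorem wedgeOne_apply (φ ψ : R4 →L[ℝ] ℝ) (u w : R4) :
    wedgeOne φ ψ ![u, w] = φ u * ψ w - φ w * ψ u := by
  rw [wedgeOne, ContinuousAlternatingMap.alternatizeUncurryFin_apply, Fin.sum_univ_two]
  simp [Fin.removeNth]
  ring

/-- The left-invariant form `a τ∧α + b τ∧β + c α∧β + e α∧γ + f β∧γ` on `ℝ × H₃(ℝ)`. -/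
def nilForm (a b c e f : ℝ) : FormR4 2 := fun p =>
  a • wedgeOne coordT coordX + b • wedgeOne coordT coordY
    -- Expanding γ in α∧γ and β∧γ sends its dx and dy parts into the coefficient of dx∧dy.
    + (c - (e * p.2.1 + f * p.2.2.1) / 2) • wedgeOne coordX coordY
    + e • wedgeOne coordX coordZ + f • wedgeOne coordY coordZ

theorem nilForm_apply (a b c e f : ℝ) (p u w : R4) :
    nilForm a b c e f p ![u, w] = nilTwoForm a b c e f p u w := by
  simp [nilForm, nilTwoForm, wedgeOne_apply, Nil.v]
  ring

theorem eq_nilForm_iff {a b c e f : ℝ} {ξ : FormR4 2} :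
    ξ = nilForm a b c e f ↔ ∀ p u w : R4, ξ p ![u, w] = nilTwoForm a b c e f p u w := by
  refine ⟨fun h p u w => by rw [h, nilForm_apply], fun h => ?_⟩
  funext p
  ext v
  have hv : v = ![v 0, v 1] := by funext i; fin_cases i <;> rfl
  rw [hv, h, nilForm_apply]

theorem contDiff_nilForm (a b c e f : ℝ) : ContDiff ℝ ∞ (nilForm a b c e f) := by
  unfold nilForm
  fun_prop

/-- The only variable coefficient multiplies dx∧dy and depends on x and y alone. -/
theorem extDeriv_nilForm (a b c e f : ℝ) : extDeriv (nilForm a b c e f) = 0 := by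
  funext p
  ext v
  have hd : ∀ u w : R4, HasFDerivAt (fun p => nilForm a b c e f p ![u, w])
      ((-(u.2.1 * w.2.2.1 - w.2.1 * u.2.2.1) / 2) • (e • coordX + f • coordY)) p := by
    intro u w
    have h : (fun p => nilForm a b c e f p ![u, w]) = fun p =>
        ((-(u.2.1 * w.2.2.1 - w.2.1 * u.2.2.1) / 2) • (e • coordX + f • coordY)) p
          + nilForm a b c e f 0 ![u, w] := by
      funext p
      simp [nilForm_apply, nilTwoForm, Nil.v]
      ring
    rw [h]
    exact (ContinuousLinearMap.hasFDerivAt _).add_const _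
  have r0 : (0 : Fin 3).removeNth v = ![v 1, v 2] := by funext i; fin_cases i <;> rfl
  have r1 : (1 : Fin 3).removeNth v = ![v 0, v 2] := by funext i; fin_cases i <;> rfl
  have r2 : (2 : Fin 3).removeNth v = ![v 0, v 1] := by funext i; fin_cases i <;> rfl
  rw [extDeriv_apply ((contDiff_nilForm a b c e f).differentiable (by simp) p), Fin.sum_univ_three,
    r0, r1, r2, (hd _ _).fderiv, (hd _ _).fderiv, (hd _ _).fderiv]
  simp
  ring

theorem FormR4.pfaffian_nilForm (a b c e f : ℝ) (p : R4) :
    (nilForm a b c e f).pfaffian p = a * f - b * e := by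
  simp only [FormR4.pfaffian, FormR4.coeff, Pi.add_apply, Pi.sub_apply, Pi.mul_apply,
    nilForm_apply, nilTwoForm, Nil.v, fieldT, fieldX, fieldY, fieldZ]
  ring

theorem FormR4.isPeriodic_nilForm (a b c e f : ℝ) :
    FormR4.IsPeriodic 4 k (nilForm a b c e f) := by
  intro g hg
  rw [eq_nilForm_iff]
  intro p u w
  rw [FormR4.translate, alternating_comp_two_apply, nilForm_apply]
  simp [nilTwoForm, Nil.v, Osc.lin, Osc.act_x, Osc.act_y, cos_eq_one_of_mem_lattice hg,
    sin_eq_zero_of_mem_lattice hg]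
  ring

theorem Nil.isLeftInvariant_iff {ξ : FormR4 2} : DForm.IsLeftInvariant (E := R4) (G := Nil) ξ ↔
    ∀ (g : Nil) (p : R4), (ξ (g.act p)).compContinuousLinearMap g.lin = ξ p := by
  have h : ∀ (g : Nil) (p : R4), DForm.pullback (E := R4) (M := Nil) (N := Nil)
      (fun h : Nil => g * h) ξ p = (ξ (g.act p)).compContinuousLinearMap g.lin := by
    intro g p
    unfold DForm.pullback
    rw [(Nil.hasMFDerivAt_mul_left g p).mfderiv]
    rfl
  exact forall_congr' fun g => ⟨fun hg p => (h g p).symm.trans (congrFun hg p),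
    fun hg => funext fun p => (h g p).trans (hg p)⟩

theorem isLeftInvariant_nilForm (a b c e f : ℝ) :
    DForm.IsLeftInvariant (E := R4) (G := Nil) (nilForm a b c e f) := by
  rw [Nil.isLeftInvariant_iff]
  intro g p
  ext v
  have hv : v = ![v 0, v 1] := by funext i; fin_cases i <;> rfl
  rw [hv, alternating_comp_two_apply, nilForm_apply, nilForm_apply]
  simp [nilTwoForm, Nil.v, Nil.lin, Nil.act_x, Nil.act_y]
  ring

theorem Nil.act_zero (p : R4) : Nil.act (show Nil from p) 0 = p := by
  rw [Nil.act_eq, map_zero, zero_add]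
  rfl

theorem Osc.act_zero (g : Osc) : g.act 0 = g.coord := by
  rw [Osc.act_eq, map_zero, zero_add]

theorem derivAlong_const (U : R4 → R4) (r : ℝ) : derivAlong U (fun _ => r) = 0 := by
  funext p
  simp [derivAlong]

/-- The closed left-invariant `2`-forms on `ℝ × H₃(ℝ)`. -/
theorem exists_eq_nilForm {ξ : FormR4 2} (hξ : ContDiff ℝ ∞ ξ) (hd : extDeriv ξ = 0)
    (hinv : DForm.IsLeftInvariant (E := R4) (G := Nil) ξ) :
    ∃ a b c e f, ξ = nilForm a b c e f := by
  rw [Nil.isLeftInvariant_iff] at hinv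
  have hc : ∀ {U W : R4 → R4}, (∀ (g : Nil) (p : R4), g.lin (U p) = U (g.act p)) →
      (∀ (g : Nil) (p : R4), g.lin (W p) = W (g.act p)) →
      ξ.coeff U W = fun _ => ξ.coeff U W 0 := by
    intro U W hU hW
    funext p
    conv_rhs => rw [FormR4.coeff, ← hinv (show Nil from p) 0, alternating_comp_two_apply, hU, hW,
      Nil.act_zero]
    rfl
  have h1 := hc Nil.lin_fieldT Nil.lin_fieldX
  have h2 := hc Nil.lin_fieldT Nil.lin_fieldY
  have h3 := hc Nil.lin_fieldT Nil.lin_fieldZ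
  have h4 := hc Nil.lin_fieldX Nil.lin_fieldY
  have h5 := hc Nil.lin_fieldX Nil.lin_fieldZ
  have h6 := hc Nil.lin_fieldY Nil.lin_fieldZ
  -- All coefficients are constant, so the first closedness equation reduces to its bracket term,
  -- the coefficient of τ∧γ.
  have h0 : ξ.coeff fieldT fieldZ = 0 := by
    have := (FormR4.coeff_equations hξ hd).1
    rwa [h1, h2, h4, derivAlong_const, derivAlong_const, derivAlong_const, sub_zero, zero_add,
      zero_add] at this
  refine ⟨ξ.coeff fieldT fieldX 0, ξ.coeff fieldT fieldY 0, ξ.coeff fieldX fieldY 0,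
    ξ.coeff fieldX fieldZ 0, ξ.coeff fieldY fieldZ 0, eq_nilForm_iff.2 fun p u w => ?_⟩
  rw [ξ.apply_frame, h1, h2, h4, h5, h6, h0]
  simp only [nilTwoForm, Nil.v, formGamma, Pi.zero_apply]
  ring

theorem derivAlong_cos_add_sin {f : R4 → ℝ} {A B : ℝ}
    (hf : ∀ p, f p = Real.cos p.1 * A + Real.sin p.1 * B) (U : R4 → R4) (p : R4) :
    derivAlong U f p = (-Real.sin p.1 * A + Real.cos p.1 * B) * (U p).1 := by
  have h1 : HasFDerivAt (fun p : R4 => p.1) coordT p := coordT.hasFDerivAt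
  have h := (h1.cos.mul_const A).add (h1.sin.mul_const B)
  have hf' : f = (fun p : R4 => Real.cos p.1 * A) + fun p : R4 => Real.sin p.1 * B := funext hf
  rw [derivAlong, hf', h.fderiv]
  simp
  ring

/-- A closed left-invariant `2`-form on the oscillator group is degenerate. -/
theorem pfaffian_eq_zero_of_invariant {ξ : FormR4 2} (hξ : ContDiff ℝ ∞ ξ) (hd : extDeriv ξ = 0)
    (hinv : ∀ g : Osc, ξ.translate g = ξ) : ξ.pfaffian 0 = 0 := by
  obtain ⟨c1, c2, c3, -⟩ := FormR4.coeff_equations hξ hd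
  have hc : ∀ g : Osc, _ := fun g => FormR4.coeff_translate g ξ 0
  simp only [hinv, Osc.act_zero] at hc
  have hpf : ξ.pfaffian 0 = ξ.coeff fieldT fieldX 0 * ξ.coeff fieldY fieldZ 0
    - ξ.coeff fieldT fieldY 0 * ξ.coeff fieldX fieldZ 0
    + ξ.coeff fieldT fieldZ 0 * ξ.coeff fieldX fieldY 0 := rfl
  rw [hpf]
  generalize ξ.coeff fieldT fieldX = a at *
  generalize ξ.coeff fieldT fieldY = b at *
  generalize ξ.coeff fieldT fieldZ = c at *
  generalize ξ.coeff fieldX fieldY = d at *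
  generalize ξ.coeff fieldX fieldZ = e at *
  generalize ξ.coeff fieldY fieldZ = f at *
  replace hc : ∀ p : R4, a 0 = Real.cos p.1 * a p - Real.sin p.1 * b p ∧
      b 0 = Real.sin p.1 * a p + Real.cos p.1 * b p ∧ c 0 = c p ∧ d 0 = d p ∧
      e 0 = Real.cos p.1 * e p - Real.sin p.1 * f p ∧
      f 0 = Real.sin p.1 * e p + Real.cos p.1 * f p := hc
  -- Inverting the rotation: the pairs (a, b) and (e, f) turn with t, while c and d are constant.
  have ha : ∀ p : R4, a p = Real.cos p.1 * a 0 + Real.sin p.1 * b 0 := fun p => by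
    obtain ⟨h1, h2, -⟩ := hc p
    linear_combination -Real.cos p.1 * h1 - Real.sin p.1 * h2 - a p * Real.sin_sq_add_cos_sq p.1
  have hb : ∀ p : R4, b p = Real.cos p.1 * b 0 + Real.sin p.1 * (-a 0) := fun p => by
    obtain ⟨h1, h2, -⟩ := hc p
    linear_combination Real.sin p.1 * h1 - Real.cos p.1 * h2 - b p * Real.sin_sq_add_cos_sq p.1
  have he : ∀ p : R4, e p = Real.cos p.1 * e 0 + Real.sin p.1 * f 0 := fun p => by
    obtain ⟨-, -, -, -, h1, h2⟩ := hc p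
    linear_combination -Real.cos p.1 * h1 - Real.sin p.1 * h2 - e p * Real.sin_sq_add_cos_sq p.1
  have hf : ∀ p : R4, f p = Real.cos p.1 * f 0 + Real.sin p.1 * (-e 0) := fun p => by
    obtain ⟨-, -, -, -, h1, h2⟩ := hc p
    linear_combination Real.sin p.1 * h1 - Real.cos p.1 * h2 - f p * Real.sin_sq_add_cos_sq p.1
  have hcc : c = fun _ => c 0 := funext fun p => (hc p).2.2.1.symm
  have hdd : d = fun _ => d 0 := funext fun p => (hc p).2.2.2.1.symm
  -- At the origin ∂e/∂t = f 0 and ∂f/∂t = -e 0, and all other derivatives in these equations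
  -- vanish. So c 0, f 0 and e 0 are zero, and every term of the Pfaffian contains one of them.
  have k1 := congrFun c1 0
  have k2 := congrFun c2 0
  have k3 := congrFun c3 0
  rw [hcc] at k2 k3
  rw [hdd] at k1
  simp only [Pi.add_apply, Pi.sub_apply, Pi.zero_apply, derivAlong_const,
    derivAlong_cos_add_sin ha, derivAlong_cos_add_sin hb, derivAlong_cos_add_sin he,
    derivAlong_cos_add_sin hf] at k1 k2 k3
  simp [fieldT, fieldX, fieldY, fieldZ] at k1 k2 k3
  rw [k1, k2, k3]
  ring

/-- A `2`-form on the oscillator group, as a form on `ℝ⁴`. -/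
def Osc.toForm (σ : DForm R4 2 Osc) : FormR4 2 := σ

theorem Osc.inChart_eq (σ : DForm R4 2 Osc) (x : Osc) : σ.inChart x = (Osc.toForm σ) := by
  let D : R4 → R4 →L[ℝ] R4 := fun p => mfderiv 𝓘(ℝ, R4) 𝓘(ℝ, R4) (id : R4 → R4) p
  have h : ∀ p : R4, D p = ContinuousLinearMap.id ℝ R4 := fun _ => mfderiv_id
  funext p
  change (DForm.eval σ p).compContinuousLinearMap (D p) = _
  rw [h]
  rfl

theorem Osc.d_eq (σ : DForm R4 2 Osc) : σ.d = extDeriv (Osc.toForm σ) := by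
  let D : R4 → R4 →L[ℝ] R4 := fun p => mfderiv 𝓘(ℝ, R4) 𝓘(ℝ, R4) (id : R4 → R4) p
  have h : ∀ p : R4, D p = ContinuousLinearMap.id ℝ R4 := fun _ => mfderiv_id
  funext p
  unfold DForm.d
  rw [Osc.inChart_eq]
  exact congrArg (extDeriv (Osc.toForm σ) p).compContinuousLinearMap (h p)

theorem Osc.not_isLeftInvariant {σ : DForm R4 2 Osc} (hσ : σ.IsSymplectic) :
    ¬ σ.IsLeftInvariant := by
  intro hinv
  have hs : ContDiff ℝ ∞ (Osc.toForm σ) := by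
    have := hσ.smooth (1 : Osc)
    rw [Osc.inChart_eq] at this
    exact contDiffOn_univ.1 this
  have hd : extDeriv (Osc.toForm σ) = 0 := by
    rw [← Osc.d_eq]
    exact hσ.closed
  refine (FormR4.nondegenerate_iff _ 0).1 (hσ.nondegenerate (show Osc from (0 : R4)))
    (pfaffian_eq_zero_of_invariant hs hd fun g => ?_)
  exact (FormR4.translate_eq_pullback g _).trans (hinv g)

theorem Solv.not_isInvariantVia {σ : DForm R4 2 (Solv q k)} (hσ : σ.IsSymplectic) :
    ¬ σ.IsInvariantVia (Solv.proj q k) := by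
  intro hinv
  have hs := Solv.contDiff_lift hσ.smooth
  have hd : extDeriv (Solv.lift σ) = 0 := by
    rw [← Solv.lift_d hs, hσ.closed]
    rfl
  refine (FormR4.nondegenerate_iff _ 0).1 (Solv.lift_nondegenerate.1 hσ.nondegenerate 0)
    (pfaffian_eq_zero_of_invariant hs hd fun g => ?_)
  exact (FormR4.translate_eq_pullback g _).trans (hinv g)

/-- The invariant forms descend to `M_{k,0}`. -/
theorem MZero.existsUnique_pullback_eq (a b c e f : ℝ) :
    ∃! σ : DForm R4 2 (MZero k), ∀ (p : Nil) (u w : R4),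
      (DForm.pullback (MZero.nilProj k) σ) p ![u, w] = nilTwoForm a b c e f p u w := by
  obtain ⟨σ, hσ⟩ := Solv.exists_lift_eq (FormR4.isPeriodic_nilForm (k := k) a b c e f)
  exact ⟨σ, eq_nilForm_iff.1 hσ, fun σ' h =>
    Solv.lift_injective ((eq_nilForm_iff.2 h).trans hσ.symm)⟩

/-- The Pfaffian of the lift is the constant a f - b e, so nondegeneracy at one point is
nondegeneracy everywhere. -/
theorem MZero.isSymplectic_and_isInvariantVia_iff (σ : DForm R4 2 (MZero k)) :
    (σ.IsSymplectic ∧ σ.IsInvariantVia (MZero.nilProj k)) ↔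
      ∃ a b c e f : ℝ, a * f - b * e ≠ 0 ∧ ∀ (p : Nil) (u w : R4),
        (DForm.pullback (MZero.nilProj k) σ) p ![u, w] = nilTwoForm a b c e f p u w := by
  constructor
  · rintro ⟨hσ, hinv⟩
    have hs := Solv.contDiff_lift hσ.smooth
    have hd : extDeriv (Solv.lift σ) = 0 := by
      rw [← Solv.lift_d hs, hσ.closed]
      rfl
    obtain ⟨a, b, c, e, f, h⟩ := exists_eq_nilForm hs hd hinv
    refine ⟨a, b, c, e, f, ?_, eq_nilForm_iff.1 h⟩
    have h1 := (FormR4.nondegenerate_iff _ 0).1 (Solv.lift_nondegenerate.1 hσ.nondegenerate 0)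
    rwa [h, FormR4.pfaffian_nilForm] at h1
  · rintro ⟨a, b, c, e, f, h0, h⟩
    have h : Solv.lift σ = nilForm a b c e f := eq_nilForm_iff.2 h
    have hs : ContDiff ℝ ∞ (Solv.lift σ) := h ▸ contDiff_nilForm a b c e f
    refine ⟨⟨Solv.isSmooth_of_contDiff_lift hs, Solv.lift_injective ?_,
      Solv.lift_nondegenerate.2 fun p => (FormR4.nondegenerate_iff _ p).2 ?_⟩, ?_⟩
    · rw [Solv.lift_d hs, h, extDeriv_nilForm]
      rfl
    · rwa [h, FormR4.pfaffian_nilForm]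
    · have h1 := isLeftInvariant_nilForm a b c e f
      rw [← h] at h1
      exact h1

end InvariantForms

/-! ### Betti numbers and nonexistence of symplectic forms. -/

section Cohomology

variable {q k : ℕ+}

theorem bettiNumber_eq_zero (h : ∀ ξ : FormR4 2, ContDiff ℝ ∞ ξ → FormR4.IsPeriodic q k ξ →
      extDeriv ξ = 0 → ∃ η : FormR4 1, ContDiff ℝ ∞ η ∧ FormR4.IsPeriodic q k η ∧ extDeriv η = ξ) :
    bettiNumber R4 2 (Solv q k) = 0 := by
  have hle : closedForms R4 2 (Solv q k) ≤ exactForms R4 (Solv q k) 2 := by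
    rintro σ ⟨hs, hd⟩
    have hs' := Solv.contDiff_lift hs
    obtain ⟨η, hη, hper, hdη⟩ := h _ hs' (Solv.lift_isPeriodic σ) (by
      rw [← Solv.lift_d hs', hd]; rfl)
    obtain ⟨η, rfl⟩ := Solv.exists_lift_eq hper
    exact ⟨η, Solv.isSmooth_of_contDiff_lift hη, Solv.lift_injective
      ((Solv.lift_d hη).trans hdη)⟩
  have : Subsingleton (deRhamCohomology R4 2 (Solv q k)) :=
    Submodule.Quotient.subsingleton_iff.2 (Submodule.submoduleOf_eq_top.2 hle)
  exact rank_subsingleton' _ _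

/-- A primitive for the lattice of q is also periodic under the lattice of M_{k,0}. There the frame
coefficients are periodic functions, and `FormR4.exists_pfaffian_eq_zero` contradicts nondegeneracy.
-/
theorem not_exists_isSymplectic (hq : Osc.lattice 4 k ≤ Osc.lattice q k)
    (h : ∀ ξ : FormR4 2, ContDiff ℝ ∞ ξ → FormR4.IsPeriodic q k ξ →
      extDeriv ξ = 0 → ∃ η : FormR4 1, ContDiff ℝ ∞ η ∧ FormR4.IsPeriodic q k η ∧ extDeriv η = ξ) :
    ¬ ∃ σ : DForm R4 2 (Solv q k), σ.IsSymplectic := by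
  rintro ⟨σ, hσ⟩
  have hs := Solv.contDiff_lift hσ.smooth
  have hper := Solv.lift_isPeriodic σ
  obtain ⟨η, hη, hηper, hdη⟩ := h _ hs hper (by rw [← Solv.lift_d hs, hσ.closed]; rfl)
  obtain ⟨p, hp⟩ := FormR4.exists_pfaffian_eq_zero hs (hper.mono hq) hη (hηper.mono hq) hdη
  exact (FormR4.nondegenerate_iff _ p).1 (Solv.lift_nondegenerate.1 hσ.nondegenerate p) hp

end Cohomology

end

theorem theorem1p2 (k : ℕ+) :
    -- `M_{k,0}` is the Kodaira–Thurston manifold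
    (∃ Ψ : KodairaThurston k ≃ₘ⟮𝓘(ℝ, R4), 𝓘(ℝ, R4)⟯ MZero k,
      ∀ p : Nil, Ψ (KodairaThurston.proj k p) = MZero.nilProj k p) ∧
    -- all the invariant forms `a τ∧α + b τ∧β + c α∧β + e α∧γ + f β∧γ` descend to `M_{k,0}`
    (∀ a b c e f : ℝ, ∃! σ : DForm R4 2 (MZero k), ∀ (p : Nil) (u w : R4),
      (DForm.pullback (MZero.nilProj k) σ) p ![u, w] = nilTwoForm a b c e f p u w) ∧
    -- the symplectic forms on `M_{k,0}` that are invariant under `ℝ × H₃(ℝ)`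
    (∀ σ : DForm R4 2 (MZero k),
      (σ.IsSymplectic ∧ σ.IsInvariantVia (MZero.nilProj k)) ↔
        ∃ a b c e f : ℝ, a * f - b * e ≠ 0 ∧ ∀ (p : Nil) (u w : R4),
          (DForm.pullback (MZero.nilProj k) σ) p ![u, w] = nilTwoForm a b c e f p u w) ∧
    -- none of the symplectic forms on `M_{k,0}` is invariant under the oscillator group
    (∀ σ : DForm R4 2 (MZero k), σ.IsSymplectic → ¬ σ.IsInvariantVia (Solv.proj 4 k)) ∧
    -- the oscillator group has no left-invariant symplectic form
    (¬ ∃ σ : DForm R4 2 Osc, σ.IsSymplectic ∧ σ.IsLeftInvariant) ∧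
    -- `M_{k,0}` is a two-sheeted covering of `M_{k,π}` and a four-sheeted covering of `M_{k,π/2}`
    (∃ P : MZero k → MPi k, (∀ g : Osc, P (Solv.proj 4 k g) = Solv.proj 2 k g) ∧
      IsCoveringMap P ∧ IsLocalDiffeomorph 𝓘(ℝ, R4) 𝓘(ℝ, R4) ∞ P ∧
      ∀ m : MPi k, (P ⁻¹' {m}).ncard = 2) ∧
    (∃ P : MZero k → MPiHalf k, (∀ g : Osc, P (Solv.proj 4 k g) = Solv.proj 1 k g) ∧
      IsCoveringMap P ∧ IsLocalDiffeomorph 𝓘(ℝ, R4) 𝓘(ℝ, R4) ∞ P ∧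
      ∀ m : MPiHalf k, (P ⁻¹' {m}).ncard = 4) ∧
    -- the second Betti numbers of `M_{k,π}` and `M_{k,π/2}` vanish
    bettiNumber R4 2 (MPi k) = 0 ∧ bettiNumber R4 2 (MPiHalf k) = 0 ∧
    -- and these manifolds admit no symplectic form
    (¬ ∃ σ : DForm R4 2 (MPi k), σ.IsSymplectic) ∧
    (¬ ∃ σ : DForm R4 2 (MPiHalf k), σ.IsSymplectic) := by
  -- Here and in the coverings below, 2 * 2 and 1 * 4 reduce to 4 by computation.
  have h22 : Osc.lattice 4 k ≤ Osc.lattice 2 k := Osc.lattice_mul_le 2 2 k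
  have h14 : Osc.lattice 4 k ≤ Osc.lattice 1 k := Osc.lattice_mul_le 1 4 k
  exact ⟨exists_diffeomorph_kodairaThurston k, MZero.existsUnique_pullback_eq,
    MZero.isSymplectic_and_isInvariantVia_iff, fun _ => Solv.not_isInvariantVia,
    fun ⟨_, hσ, hinv⟩ => Osc.not_isLeftInvariant hσ hinv,
    exists_covering_solv 2 2 k, exists_covering_solv 1 4 k,
    bettiNumber_eq_zero fun _ => FormR4.exists_extDeriv_eq_two,
    bettiNumber_eq_zero fun _ => FormR4.exists_extDeriv_eq_one,
    not_exists_isSymplectic h22 fun _ => FormR4.exists_extDeriv_eq_two,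
    not_exists_isSymplectic h14 fun _ => FormR4.exists_extDeriv_eq_one⟩
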